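/- Let $d\ge 0$. Let $\mathcal L_0$ be the space of arcs on $(\mathbb C^d,0)$, i.e. of $d$-tuples $\varphi$ of convergent power series in one variable $\tau$ without constant term, on which the group $\mathrm{Aut}_{\mathbb C,0}$ of analytic coordinate changes $h$ of $(\mathbb C,0)$ acts by $h*\varphi=\varphi\circ h^{-1}$. Let $\mathcal B_0=\mathcal L_0/\mathrm{Aut}_{\mathbb C,0}$ be the set of branches, and $p_b:\mathcal L_0\to\mathcal B_0$ the quotient map. Let $\mathcal L_0^n$ be the affine space of $n$-jets of arcs (coefficients of $\tau,\dots,\tau^n$), $\mathcal B_0^n=\mathcal L_0^n/\mathrm{Aut}_{\mathbb C,0}$, and write $\pi_n:\mathcal L_0\to\mathcal L_0^n$ and $\pi_n:\mathcal B_0\to\mathcal B_0^n$ for the natural maps. For $0\le i<n$ the quotient of the set of $n$-jets of order exactly $i+1$ by $\mathrm{Aut}_{\mathbb C,0}$ is a quasi-projective variety $Q_{n,i}$; a subset $Y\subset\mathcal B_0^n\setminus\{0\}$ is constructible if every $Y_i=Y\cap Q_{n,i}$ is constructible in $Q_{n,i}$, and then $[Y]:=\sum_i[Y_i]\in K_0(\mathcal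 V_{\mathbb C})$, the Grothendieck ring of complex quasi-projective varieties. Let $\mathbb L$ be the class of the affine line and $R=K_0(\mathcal V_{\mathbb C})[\mathbb L^{-1}]$. A set $X=\pi_n^{-1}(Y)$ is called cylindric: in $\mathcal L_0$, for $Y\subset\mathcal L_0^n$ constructible, with motivic measure $\chi_g(X)=[Y]\,\mathbb L^{-dn}\in R$; in $\mathcal B_0$, for $Y\subset\mathcal B_0^n\setminus\{0\}$ constructible, with motivic measure $\chi_g(X)=[Y]\,\mathbb L^{-(d-1)n}\in R$. Let $G$ be an abelian group with a group topology in which the open subgroups form a basis of neighbourhoods of $0$ (e.g. any abelian group with the discrete topology, or a group of formal power series). A function $\psi$ on $\mathcal L_0$ or on $\mathcal B_0$ with values in $G$ is constructible if it has countably many values and $\psi^{-1}(a)$ is cylindric for each $a\ne0$. A constructible function $\psi$ is integrable if for each open subgroup $U\subset G$ only finitely many values of $\psi$ lie outside $U$; its integral is then the convergent sum $$\int\psi\,d\chi_g=\sum_{a\in G,\ a\ne 0}\chi_g(\psi^{-1}(a))\cdot a\ \in\ R\,\widehat\otimes\,G:=\varprojlim_U R\otimes_{\mathbb Z}G/U .$$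 Let $G[[T]]$ be the group of formal power series with the product topology of its coefficients. For $F\in R\,\widehat\otimes\,G[[T]]$ with coefficients $F_k\in R\,\widehat\otimes\,G$, let $F|_{T\mapsto\mathbb L}:=\sum_k\mathbb L^kF_k$, provided that this sum converges. Let $\psi:\mathcal B_0\to G$ be a constructible integrable function, and let $\widetilde\psi^*:\mathcal L_0\to G[[T]]$, $\widetilde\psi^*(\varphi)=\psi(p_b(\varphi))\,T^{\mathrm{ord}(\varphi)}$, where $\mathrm{ord}(\varphi)$ is the order of the arc $\varphi$ at $\tau=0$ ($T^{\mathrm{ord}(0)}=0$). Then $\widetilde\psi^*$ is constructible and integrable, the substitution $T\mapsto\mathbb L$ in its integral converges, and $$\Bigl(\int_{\mathcal L_0}\widetilde\psi^*\,d\chi_g\Bigr)\Big|_{T\mapsto\mathbb L}=(\mathbb L-1)\int_{\mathcal B_0}\psi\,d\chi_g .$$ -/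

import Mathlib

open Topology Filter
open scoped TensorProduct

noncomputable section

namespace MotivicArcs

/-! ### Spaces with functions and complex quasi-projective varieties -/

/-- A space with functions over `ℂ`: a topological space with a sheaf of `ℂ`-valued functions that
contains the constants, is closed under sums, products and inverses of nowhere vanishing functions,
and whose functions have open non-vanishing sets. The sheaf is encoded by the predicate `regAt f x`:
near `x` the function `f` is a section, so the sections over an open `U` are the functions that
are regular at every point of `U`. -/
structure FunSpace where
  carrier : Type
  top : TopologicalSpace carrier
  regAt : (carrier → ℂ) → carrier → Prop
  congr' : ∀ f g x, (∀ᶠ y in 𝓝 x, f y = g y) → regAt f x → regAt g x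
  eventually' : ∀ f x, regAt f x → ∀ᶠ y in 𝓝 x, regAt f y
  const' : ∀ (c : ℂ) x, regAt (fun _ => c) x
  add' : ∀ f g x, regAt f x → regAt g x → regAt (fun y => f y + g y) x
  mul' : ∀ f g x, regAt f x → regAt g x → regAt (fun y => f y * g y) x
  inv' : ∀ f x, regAt f x → f x ≠ 0 → regAt (fun y => (f y)⁻¹) x
  ne' : ∀ f x, regAt f x → f x ≠ 0 → ∀ᶠ y in 𝓝 x, f y ≠ 0

instance (X : FunSpace) : TopologicalSpace X.carrier := X.top

namespace FunSpace

/-- Morphisms: continuous maps that pull regular functions back to regular functions. -/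
def IsMorphism {X Y : FunSpace} (f : X.carrier → Y.carrier) : Prop :=
  Continuous f ∧ ∀ (g : Y.carrier → ℂ) (x : X.carrier), Y.regAt g (f x) → X.regAt (g ∘ f) x

/-- Isomorphism of spaces with functions. -/
def Iso (X Y : FunSpace) : Prop :=
  ∃ e : X.carrier ≃ Y.carrier, IsMorphism (X := X) (Y := Y) e ∧ IsMorphism (X := Y) (Y := X) e.symm

/-- A subset with the induced topology; the functions are those that extend locally to regular
functions of the ambient space. -/
def sub (X : FunSpace) (S : Set X.carrier) : FunSpace where
  carrier := {x // x ∈ S}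
  top := inferInstance
  regAt f x := ∃ g, X.regAt g x.1 ∧ ∀ᶠ y in 𝓝 x, f y = g y.1
  congr' := by
    rintro f g x h ⟨k, hk, hf⟩
    refine ⟨k, hk, ?_⟩
    filter_upwards [h, hf] with y h1 h2
    rw [← h1, h2]
  eventually' := by
    rintro f x ⟨g, hg, hf⟩
    have h1 := continuous_subtype_val.continuousAt.eventually (X.eventually' g x.1 hg)
    filter_upwards [h1, hf.eventually_nhds] with y h2 h3
    exact ⟨g, h2, h3⟩
  const' c x := ⟨fun _ => c, X.const' c _, Eventually.of_forall fun _ => rfl⟩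
  add' := by
    rintro f g x ⟨k, hk, hf⟩ ⟨l, hl, hg⟩
    refine ⟨_, X.add' k l _ hk hl, ?_⟩
    filter_upwards [hf, hg] with y h1 h2
    rw [h1, h2]
  mul' := by
    rintro f g x ⟨k, hk, hf⟩ ⟨l, hl, hg⟩
    refine ⟨_, X.mul' k l _ hk hl, ?_⟩
    filter_upwards [hf, hg] with y h1 h2
    rw [h1, h2]
  inv' := by
    rintro f x ⟨k, hk, hf⟩ hx
    refine ⟨_, X.inv' k _ hk (by rwa [← hf.self_of_nhds]), ?_⟩
    filter_upwards [hf] with y h1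
    rw [h1]
  ne' := by
    rintro f x ⟨k, hk, hf⟩ hx
    have h1 := continuous_subtype_val.continuousAt.eventually
      (X.ne' k x.1 hk (by rwa [← hf.self_of_nhds]))
    filter_upwards [hf, h1] with y h2 h3
    rwa [h2]

/-- The quotient by (the equivalence relation generated by) a relation, with the quotient topology;
a function is regular if its pullback is. -/
def quot (X : FunSpace) (r : X.carrier → X.carrier → Prop) : FunSpace where
  carrier := Quot r
  top := inferInstance
  regAt f x := ∀ᶠ y in 𝓝 x, ∀ u : X.carrier, Quot.mk r u = y → X.regAt (fun v => f (Quot.mk r v)) u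
  congr' := by
    intro f g x h hf
    filter_upwards [h.eventually_nhds, hf] with y h1 h2 u hu
    refine X.congr' _ _ u ?_ (h2 u hu)
    subst hu
    exact continuous_quot_mk.continuousAt.eventually h1
  eventually' f x hf := hf.eventually_nhds
  const' c x := Eventually.of_forall fun _ u _ => X.const' c u
  add' := by
    intro f g x hf hg
    filter_upwards [hf, hg] with y h1 h2 u hu
    exact X.add' _ _ u (h1 u hu) (h2 u hu)
  mul' := by
    intro f g x hf hg
    filter_upwards [hf, hg] with y h1 h2 u hu
    exact X.mul' _ _ u (h1 u hu) (h2 u hu)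
  ne' := by
    intro f x hf hx
    obtain ⟨W, hW, hWo, hxW⟩ := eventually_nhds_iff.1 hf
    refine eventually_nhds_iff.2 ⟨{y | y ∈ W ∧ f y ≠ 0}, fun y hy => hy.2, ?_, hxW, hx⟩
    rw [← isQuotientMap_quot_mk.isOpen_preimage, isOpen_iff_mem_nhds]
    rintro u ⟨hu1, hu2⟩
    filter_upwards [X.ne' _ u (hW _ hu1 u rfl) hu2,
      (hWo.preimage continuous_quot_mk).mem_nhds hu1] with v h1 h2
    exact ⟨h2, h1⟩
  inv' := by
    intro f x hf hx
    obtain ⟨W, hW, hWo, hxW⟩ := eventually_nhds_iff.1 hf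
    refine eventually_nhds_iff.2 ⟨{y | y ∈ W ∧ f y ≠ 0}, ?_, ?_, hxW, hx⟩
    · rintro y ⟨hy1, hy2⟩ u rfl
      exact X.inv' _ u (hW _ hy1 u rfl) hy2
    · rw [← isQuotientMap_quot_mk.isOpen_preimage, isOpen_iff_mem_nhds]
      rintro u ⟨hu1, hu2⟩
      filter_upwards [X.ne' _ u (hW _ hu1 u rfl) hu2,
        (hWo.preimage continuous_quot_mk).mem_nhds hu1] with v h1 h2
      exact ⟨h2, h1⟩

end FunSpace

/-- Points of the affine space with coordinates indexed by `ι`. -/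
@[ext]
structure AffinePoint (ι : Type) where
  coord : ι → ℂ

/-- The Zariski topology: the sets `{P ≠ 0}`, `P` a polynomial, form a basis. -/
instance (ι : Type) : TopologicalSpace (AffinePoint ι) :=
  TopologicalSpace.generateFrom
    (Set.range fun P : MvPolynomial ι ℂ => {x : AffinePoint ι | MvPolynomial.eval x.coord P ≠ 0})

lemma eventually_eval_ne {ι : Type} (x : AffinePoint ι) (P : MvPolynomial ι ℂ)
    (h : MvPolynomial.eval x.coord P ≠ 0) : ∀ᶠ y : AffinePoint ι in 𝓝 x, MvPolynomial.eval y.coord P ≠ 0 :=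
  IsOpen.mem_nhds (TopologicalSpace.isOpen_generateFrom_of_mem ⟨P, rfl⟩) h

/-- The affine space with its regular functions: locally quotients of polynomials. -/
def affineSpace (ι : Type) : FunSpace where
  carrier := AffinePoint ι
  top := inferInstance
  regAt f x := ∃ P Q : MvPolynomial ι ℂ, MvPolynomial.eval x.coord Q ≠ 0 ∧
    ∀ᶠ y : AffinePoint ι in 𝓝 x, f y = MvPolynomial.eval y.coord P / MvPolynomial.eval y.coord Q
  congr' := by
    rintro f g x h ⟨P, Q, hQ, hf⟩
    refine ⟨P, Q, hQ, ?_⟩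
    filter_upwards [h, hf] with y h1 h2
    rw [← h1, h2]
  eventually' := by
    rintro f x ⟨P, Q, hQ, hf⟩
    filter_upwards [eventually_eval_ne x Q hQ, hf.eventually_nhds] with y h1 h2
    exact ⟨P, Q, h1, h2⟩
  const' c x := ⟨MvPolynomial.C c, 1, by simp, Eventually.of_forall fun y => by simp⟩
  add' := by
    rintro f g x ⟨P, Q, hQ, hf⟩ ⟨P', Q', hQ', hg⟩
    refine ⟨P * Q' + Q * P', Q * Q', by simp [hQ, hQ'], ?_⟩
    filter_upwards [hf, hg, eventually_eval_ne x Q hQ, eventually_eval_ne x Q' hQ'] with y h1 h2 h3 h4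
    rw [h1, h2, div_add_div _ _ h3 h4]
    simp
  mul' := by
    rintro f g x ⟨P, Q, hQ, hf⟩ ⟨P', Q', hQ', hg⟩
    refine ⟨P * P', Q * Q', by simp [hQ, hQ'], ?_⟩
    filter_upwards [hf, hg] with y h1 h2
    rw [h1, h2, div_mul_div_comm]
    simp
  inv' := by
    rintro f x ⟨P, Q, hQ, hf⟩ hx
    have hP : MvPolynomial.eval x.coord P ≠ 0 := by
      intro h
      exact hx (by rw [hf.self_of_nhds, h, zero_div])
    refine ⟨Q, P, hP, ?_⟩
    filter_upwards [hf] with y h1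
    rw [h1, inv_div]
  ne' := by
    rintro f x ⟨P, Q, hQ, hf⟩ hx
    have hP : MvPolynomial.eval x.coord P ≠ 0 := by
      intro h
      exact hx (by rw [hf.self_of_nhds, h, zero_div])
    filter_upwards [hf, eventually_eval_ne x P hP, eventually_eval_ne x Q hQ] with y h1 h2 h3
    rw [h1]
    exact div_ne_zero h2 h3

/-- The projective space `ℙ^N = (𝔸^(N+1) ∖ {0}) / ℂ*`. -/
def projectiveSpace (N : ℕ) : FunSpace :=
  ((affineSpace (Fin (N + 1))).sub {x : AffinePoint (Fin (N + 1)) | x.coord ≠ 0}).quot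
    fun x y => ∃ a : ℂ, a ≠ 0 ∧ ∀ i, y.1.coord i = a * x.1.coord i

/-- Complex quasi-projective varieties (reduced, possibly reducible): locally closed subsets of
projective spaces. -/
structure QPVar where
  N : ℕ
  S : Set (projectiveSpace N).carrier
  isLocallyClosed : IsLocallyClosed S

/-- The space with functions of a quasi-projective variety. -/
def QPVar.space (V : QPVar) : FunSpace := (projectiveSpace V.N).sub V.S

/-- A space with functions is quasi-projective if it is isomorphic to a quasi-projective variety. -/
def FunSpace.IsQuasiProjective (X : FunSpace) : Prop := ∃ V : QPVar, X.Iso V.space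

/-- `Z` is a product of `X` and `Y` in the category of quasi-projective varieties. -/
def IsProduct (Z X Y : QPVar) : Prop :=
  ∃ (p : Z.space.carrier → X.space.carrier) (q : Z.space.carrier → Y.space.carrier),
    FunSpace.IsMorphism p ∧ FunSpace.IsMorphism q ∧
    ∀ (W : QPVar) (f : W.space.carrier → X.space.carrier) (g : W.space.carrier → Y.space.carrier),
      FunSpace.IsMorphism f → FunSpace.IsMorphism g →
      ∃! h : W.space.carrier → Z.space.carrier, FunSpace.IsMorphism h ∧ p ∘ h = f ∧ q ∘ h = g

/-! ### The Grothendieck ring of complex quasi-projective varieties -/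

/-- The defining relations of the Grothendieck ring. -/
inductive K0Rel : FreeCommRing QPVar → Prop
  | iso (X Y : QPVar) (h : X.space.Iso Y.space) :
      K0Rel (FreeCommRing.of X - FreeCommRing.of Y)
  | scissor (X Y W : QPVar) (T : Set X.space.carrier) (hT : IsClosed T)
      (hY : (X.space.sub T).Iso Y.space) (hW : (X.space.sub Tᶜ).Iso W.space) :
      K0Rel (FreeCommRing.of X - (FreeCommRing.of Y + FreeCommRing.of W))
  | prod (Z X Y : QPVar) (h : IsProduct Z X Y) :
      K0Rel (FreeCommRing.of Z - FreeCommRing.of X * FreeCommRing.of Y)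
  | one (X : QPVar) (h : Nonempty (Unique X.space.carrier)) :
      K0Rel (FreeCommRing.of X - 1)

/-- The Grothendieck ring `K₀(V_ℂ)` of complex quasi-projective varieties. -/
def K0 : Type := FreeCommRing QPVar ⧸ Ideal.span {x : FreeCommRing QPVar | K0Rel x}

instance : CommRing K0 :=
  inferInstanceAs (CommRing (FreeCommRing QPVar ⧸ Ideal.span {x : FreeCommRing QPVar | K0Rel x}))

/-- The class `[V] ∈ K₀(V_ℂ)` of a quasi-projective variety. -/
def QPVar.cls (V : QPVar) : K0 :=
  Ideal.Quotient.mk (Ideal.span {x : FreeCommRing QPVar | K0Rel x}) (FreeCommRing.of V)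

open Classical in
/-- The class in `K₀(V_ℂ)` of a quasi-projective space with functions (and `0` otherwise). -/
def classOf (X : FunSpace) : K0 :=
  if h : X.IsQuasiProjective then h.choose.cls else 0

/-- A partition of `Y ⊆ X` into finitely many locally closed, quasi-projective subspaces. -/
def IsQPPartition (X : FunSpace) (Y : Set X.carrier) (m : ℕ) (P : Fin m → Set X.carrier) : Prop :=
  (∀ i, IsLocallyClosed (P i)) ∧ (∀ i, (X.sub (P i)).IsQuasiProjective) ∧
    Pairwise (fun i j => Disjoint (P i) (P j)) ∧ ⋃ i, P i = Y

open Classical in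
/-- The class `[Y] = ∑ [Y_i]` of a subset `Y` of `X` that has a partition into finitely many
locally closed quasi-projective subspaces `Y_i` (and `0` otherwise). -/
def constructibleClass (X : FunSpace) (Y : Set X.carrier) : K0 :=
  if h : ∃ p : Σ m : ℕ, (Fin m → Set X.carrier), IsQPPartition X Y p.1 p.2 then
    ∑ i, classOf (X.sub (h.choose.2 i))
  else 0

/-- The class `𝕃` of the affine line. -/
def lef : K0 := classOf (affineSpace (Fin 1))

/-- The localization `K₀(V_ℂ)[𝕃⁻¹]`. -/
def K0L : Type := Localization.Away lef

instance : CommRing K0L := inferInstanceAs (CommRing (Localization.Away lef))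

instance : Algebra K0 K0L := inferInstanceAs (Algebra K0 (Localization.Away lef))

instance : IsLocalization.Away lef K0L :=
  inferInstanceAs (IsLocalization.Away lef (Localization.Away lef))

/-- `𝕃` as an invertible element of `K₀(V_ℂ)[𝕃⁻¹]`. -/
def lefUnit : K0Lˣ := (IsLocalization.Away.algebraMap_isUnit (S := K0L) lef).unit

/-! ### Arcs, branches and their jets -/

/-- A power series in one variable with positive radius of convergence, that is, (the Taylor series
of) a germ of an analytic function at `0`. -/
def IsConvergent (f : PowerSeries ℂ) : Prop :=
  ∃ r : ℝ, 0 < r ∧ Summable fun n : ℕ => ‖PowerSeries.coeff n f‖ * r ^ n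

/-- The space `𝓛₀` of arcs `(ℂ, 0) → (ℂ^d, 0)`. -/
def Arc (d : ℕ) : Type :=
  {φ : Fin d → PowerSeries ℂ // ∀ j, PowerSeries.constantCoeff (φ j) = 0 ∧ IsConvergent (φ j)}

/-- The group `Aut_{ℂ,0}` of local changes of the coordinate (as a set). -/
def CoordChange : Type :=
  {h : PowerSeries ℂ // PowerSeries.constantCoeff h = 0 ∧ PowerSeries.coeff 1 h ≠ 0 ∧
    IsConvergent h}

/-- `IsTransform h φ φ'` says that `φ' = h * φ = φ ∘ h⁻¹`, that is, `φ = φ' ∘ h`. -/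
def IsTransform {d : ℕ} (h : CoordChange) (φ φ' : Arc d) : Prop :=
  ∀ j, φ.1 j = PowerSeries.subst h.1 (φ'.1 j)

/-- Two arcs in the same `Aut_{ℂ,0}`-orbit. -/
def ArcRel (d : ℕ) (φ φ' : Arc d) : Prop := ∃ h : CoordChange, IsTransform h φ φ'

/-- The space `𝓑₀ = 𝓛₀ / Aut_{ℂ,0}` of branches. -/
def Branch (d : ℕ) : Type := Quot (ArcRel d)

/-- The factorization map `p_b : 𝓛₀ → 𝓑₀`. -/
def toBranch {d : ℕ} (φ : Arc d) : Branch d := Quot.mk _ φ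

/-- The order of an arc (`⊤` for the zero arc). -/
def Arc.ord {d : ℕ} (φ : Arc d) : ℕ∞ := ⨅ j, (φ.1 j).order

/-- The space `𝓛₀^n` of `n`-jets of arcs: the affine space of the coefficients at `τ, …, τ^n`;
the coordinate `(l, j)` is the coefficient at `τ^(l+1)` of the `j`-th component. -/
abbrev jetSpace (d n : ℕ) : FunSpace := affineSpace (Fin n × Fin d)

/-- The set of `n`-jets. -/
abbrev Jet (d n : ℕ) : Type := (jetSpace d n).carrier

/-- The coefficients of a jet. -/
def Jet.coeff {d n : ℕ} (x : Jet d n) (l : Fin n) (j : Fin d) : ℂ := 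
  AffinePoint.coord x (l, j)

/-- The truncation map `𝓛₀ → 𝓛₀^n`. -/
def jet {d : ℕ} (n : ℕ) (φ : Arc d) : Jet d n :=
  AffinePoint.mk fun p : Fin n × Fin d => PowerSeries.coeff (p.1 + 1) (φ.1 p.2)

/-- Two jets in the same orbit of the action of `Aut_{ℂ,0}` induced on `𝓛₀^n`. -/
def JetRel (d n : ℕ) (x x' : Jet d n) : Prop :=
  ∃ (h : CoordChange) (φ φ' : Arc d), IsTransform h φ φ' ∧ jet n φ = x ∧ jet n φ' = x'

/-- The set `𝓑₀^n = 𝓛₀^n / Aut_{ℂ,0}`. -/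
def BranchJet (d n : ℕ) : Type := Quot (JetRel d n)

/-- The class of the zero jet in `𝓑₀^n`. -/
def BranchJet.zero (d n : ℕ) : BranchJet d n :=
  Quot.mk _ (AffinePoint.mk fun _ : Fin n × Fin d => 0 : Jet d n)

/-- The map `π_n : 𝓑₀ → 𝓑₀^n`. -/
def branchJet {d : ℕ} (n : ℕ) : Branch d → BranchJet d n :=
  Quot.map (jet n) fun φ φ' ⟨h, hh⟩ => ⟨h, φ, φ', hh, rfl, rfl⟩

/-- The stratum `𝔪^i 𝓛₀^n ∖ 𝔪^(i+1) 𝓛₀^n`: the `n`-jets of order exactly `i + 1`. -/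
def orderStratum (d n : ℕ) (i : Fin n) : Set (Jet d n) :=
  {x | (∀ l < i, ∀ j, Jet.coeff x l j = 0) ∧ ∃ j, Jet.coeff x i j ≠ 0}

/-- The quotient variety `(𝔪^i 𝓛₀^n ∖ 𝔪^(i+1) 𝓛₀^n) / Aut_{ℂ,0}`. -/
def stratumQuotient (d n : ℕ) (i : Fin n) : FunSpace :=
  ((jetSpace d n).sub (orderStratum d n i)).quot fun x y => JetRel d n x.1 y.1

/-- The inclusion of the quotient of a stratum in `𝓑₀^n`. -/
def stratumInclusion (d n : ℕ) (i : Fin n) : (stratumQuotient d n i).carrier → BranchJet d n :=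
  Quot.map Subtype.val fun _ _ h => h

/-- The part `Y_i` of a subset `Y` of `𝓑₀^n` in the quotient of the `i`-th stratum. -/
def stratumPart {d n : ℕ} (Y : Set (BranchJet d n)) (i : Fin n) :
    Set (stratumQuotient d n i).carrier :=
  stratumInclusion d n i ⁻¹' Y

/-- Constructible subsets of `𝓑₀^{n*} = 𝓑₀^n ∖ {0}`. -/
def IsConstructibleBranchJet {d n : ℕ} (Y : Set (BranchJet d n)) : Prop :=
  BranchJet.zero d n ∉ Y ∧ ∀ i, IsConstructible (stratumPart Y i)

/-- The class `[Y] = ∑ [Y_i]` of a constructible subset of `𝓑₀^{n*}`. -/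
def branchJetClass {d n : ℕ} (Y : Set (BranchJet d n)) : K0 :=
  ∑ i : Fin n, constructibleClass (stratumQuotient d n i) (stratumPart Y i)

/-! ### Cylindric sets and the motivic measure -/

/-- Cylindric subsets of the space of arcs. -/
def IsArcCylinder {d : ℕ} (X : Set (Arc d)) : Prop :=
  ∃ p : Σ n : ℕ, Set (Jet d n), IsConstructible p.2 ∧ X = jet p.1 ⁻¹' p.2

open Classical in
/-- The motivic measure `χ_g(X) = [Y] 𝕃^(-dn)` of a cylindric set of arcs `X = π_n⁻¹(Y)`. -/
def arcMeasure {d : ℕ} (X : Set (Arc d)) : K0L :=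
  if h : IsArcCylinder X then
    algebraMap K0 K0L (constructibleClass (jetSpace d h.choose.1) h.choose.2) *
      ((lefUnit ^ (-((d : ℤ) * h.choose.1)) : K0Lˣ) : K0L)
  else 0

/-- Cylindric subsets of the space of branches. -/
def IsBranchCylinder {d : ℕ} (X : Set (Branch d)) : Prop :=
  ∃ p : Σ n : ℕ, Set (BranchJet d n), IsConstructibleBranchJet p.2 ∧ X = branchJet p.1 ⁻¹' p.2

open Classical in
/-- The motivic measure `χ_g(X) = [Y] 𝕃^(-(d-1)n)` of a cylindric set of branches
`X = π_n⁻¹(Y)`. -/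
def branchMeasure {d : ℕ} (X : Set (Branch d)) : K0L :=
  if h : IsBranchCylinder X then
    algebraMap K0 K0L (branchJetClass h.choose.2) *
      ((lefUnit ^ (-(((d : ℤ) - 1) * h.choose.1)) : K0Lˣ) : K0L)
  else 0

/-! ### Completed coefficients and integration -/

section Completed

variable {G : Type*} [AddCommGroup G] [TopologicalSpace G]

/-- The `K₀(V_ℂ)[𝕃⁻¹]`-linear map `K₀(V_ℂ)[𝕃⁻¹] ⊗ G/U → K₀(V_ℂ)[𝕃⁻¹] ⊗ H/V` induced by a
homomorphism `f : G → H` with `f(U) ⊆ V`. -/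
def quotientMap {H : Type*} [AddCommGroup H] (f : G →+ H) (U : AddSubgroup G) (V : AddSubgroup H)
    (h : U ≤ V.comap f) : K0L ⊗[ℤ] (G ⧸ U) →ₗ[K0L] K0L ⊗[ℤ] (H ⧸ V) :=
  LinearMap.baseChange K0L (QuotientAddGroup.map U V f h).toIntLinearMap

variable (G) in
/-- The completed tensor product `K₀(V_ℂ)[𝕃⁻¹] ⊗̂ G = lim_U K₀(V_ℂ)[𝕃⁻¹] ⊗ G/U`, `U` running over
the open subgroups of `G`. For discrete `G` it is the usual tensor product. -/
def Completed : Submodule K0L ((U : OpenAddSubgroup G) → K0L ⊗[ℤ] (G ⧸ (U : AddSubgroup G))) where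
  carrier := {x | ∀ (U V : OpenAddSubgroup G) (h : (U : AddSubgroup G) ≤ (V : AddSubgroup G)),
    quotientMap (AddMonoidHom.id G) U V (fun _ ha => h ha) (x U) = x V}
  zero_mem' := fun U V h => map_zero _
  add_mem' := fun hx hy U V h => by
    simp only [Pi.add_apply, map_add]
    rw [hx U V h, hy U V h]
  smul_mem' := fun c x hx U V h => by
    simp only [Pi.smul_apply, map_smul]
    rw [hx U V h]

/-- The limit topology on the completed tensor product (each factor is discrete). -/
instance : TopologicalSpace (Completed G) :=
  ⨅ U : OpenAddSubgroup G, TopologicalSpace.induced (fun x : Completed G => x.1 U) ⊥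

/-- The element `r ⊗ a` of the completed tensor product. -/
def pureTensor (r : K0L) (a : G) : Completed G :=
  ⟨fun U => r ⊗ₜ[ℤ] (QuotientAddGroup.mk a : G ⧸ (U : AddSubgroup G)), fun _ _ _ => by
    simp only [quotientMap, LinearMap.baseChange_tmul]
    rfl⟩

/-- Functoriality of the completed tensor product in continuous homomorphisms. -/
def Completed.map {H : Type*} [AddCommGroup H] [TopologicalSpace H] (f : G →+ H)
    (hf : Continuous f) (x : Completed G) : Completed H :=
  ⟨fun V => quotientMap f (V.comap f hf : OpenAddSubgroup G) V le_rfl (x.1 (V.comap f hf)), by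
    intro V W h
    have hx := x.2 (V.comap f hf) (W.comap f hf) (fun a ha => h ha)
    beta_reduce
    rw [← hx]
    simp only [quotientMap, ← LinearMap.comp_apply, ← LinearMap.baseChange_comp]
    congr 2
    ext a
    obtain ⟨a, rfl⟩ := QuotientAddGroup.mk_surjective a
    rfl⟩

end Completed

section Integral

variable {S : Type*} {G : Type*} [AddCommGroup G]

/-- Constructible functions with respect to a family of cylindric sets: countably many values, and
cylindric level sets over the nonzero values. -/
def IsConstructibleFun (cyl : Set S → Prop) (ψ : S → G) : Prop :=
  (Set.range ψ).Countable ∧ ∀ a : G, a ≠ 0 → cyl (ψ ⁻¹' {a})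

variable [TopologicalSpace G]

/-- A constructible function is integrable if the series `∑ χ_g(ψ⁻¹(a)) · a` over its nonzero values
makes sense in `G`: modulo each open subgroup of `G`, only finitely many values are nonzero. -/
def IsIntegrableFun (cyl : Set S → Prop) (ψ : S → G) : Prop :=
  IsConstructibleFun cyl ψ ∧ ∀ U : OpenAddSubgroup G, (Set.range ψ \ (U : Set G)).Finite

/-- The integral `∑_{a ≠ 0} χ_g(ψ⁻¹(a)) · a`. -/
def integral (μ : Set S → K0L) (ψ : S → G) : Completed G :=
  ∑' a : {a : G // a ≠ 0}, pureTensor (μ (ψ ⁻¹' {a.1})) a.1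

end Integral

section Branches

variable {d : ℕ} {G : Type*} [AddCommGroup G]

/-- The lifted function `ψ ∘ p_b` on the space of arcs, multiplied by `T^ord`. A series
`∑ g_k T^k` in `G[[T]]` is the sequence `k ↦ g_k`, and `G[[T]]` has the product topology;
`T^ord = 0` at the zero arc. -/
def twistedLift (ψ : Branch d → G) (φ : Arc d) : ℕ → G :=
  open Classical in fun k => if φ.ord = k then ψ (toBranch φ) else 0

variable [TopologicalSpace G]

/-- Integrable constructible functions on the space of arcs. -/
def ArcIntegrable (ψ : Arc d → G) : Prop := IsIntegrableFun IsArcCylinder ψ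

/-- Integrable constructible functions on the space of branches. -/
def BranchIntegrable (ψ : Branch d → G) : Prop := IsIntegrableFun IsBranchCylinder ψ

/-- The integral `∫_{𝓛₀} ψ dχ_g`. -/
def arcIntegral (ψ : Arc d → G) : Completed G := integral arcMeasure ψ

/-- The integral `∫_{𝓑₀} ψ dχ_g`. -/
def branchIntegral (ψ : Branch d → G) : Completed G := integral branchMeasure ψ

/-- The coefficient at `T^k`. -/
def coeffT (k : ℕ) (F : Completed (ℕ → G)) : Completed G :=
  Completed.map (Pi.evalAddMonoidHom (fun _ => G) k) (continuous_apply k) F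

/-- The substitution `T ↦ 𝕃` in `F` makes sense and has the value `x`: `∑_k 𝕃^k F_k = x`. -/
def HasValueAtLef (F : Completed (ℕ → G)) (x : Completed G) : Prop :=
  HasSum (fun k : ℕ => (algebraMap K0 K0L lef) ^ k • coeffT k F) x

end Branches

end MotivicArcs

end

open MotivicArcs

namespace MotivicArcs

/-! ### Morphisms of spaces with functions -/

namespace FunSpace

variable {X Y Z : FunSpace}

/-! Everything reduces to one cylindric set of branches `B`, the level set of a nonzero value of
`ψ`. If `A_k` denotes the set of arcs of order `k` over `B`, the claim is `∑ 𝕃^k χ_g(A_k) = (𝕃 - 1)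
χ_g(B)`, which is `sum_arcMeasure_arcsOver`. Only finitely many `A_k` are nonempty, because a
defining set of `n`-jets omits the zero jet.

At the level of `n`-jets this is a statement about one stratum, `constructibleClass_liftStratum`:
over a constructible subset `Z` of the quotient of the jets of order `k = i + 1`, the jets have
class `[Z] (𝕃 - 1) 𝕃^(n-k)`. The factor `𝕃^k` cancels the dependence on `k`, and the normalizations
`𝕃^(-dn)` and `𝕃^(-(d-1)n)` account for the remaining `𝕃^n`.

The geometric reason is that a coordinate change `X v` acts on jets of order `i + 1` through `v`
modulo `X^(n-i)`, that is, through `ℂ*` and `r = n - i - 1` unipotent parameters. The unipotent part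
acts freely: where the lowest coefficient of component `j` is nonzero, extracting an `(i+1)`-st root
turns this component into a monomial, and the normal form and the parameters `b` are unique and
regular in the jet (`exists_normal_form`, `IsNormal.unique`). This gives the factor `𝕃^r`. What
remains is `ℂ*` acting on the coefficients of normal forms with weights `m + 1`, possibly with
finite stabilizers (`IsNormal.rescale`). On the locus where the normal form has a fixed support `F`,
the stabilizer is the group of `g`-th roots of unity, `g` being the gcd of the weights, and the
quotient of `ℂ*` by it is again `ℂ*`, acting with the coprime weights `e = weight / g`. Bézout's
identity yields a Laurent monomial of weight one, and the slice where it equals `1` trivializes the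
action. Thus the quotient of a piece is the slice (`IsPiece.quot_iso_slice`) and the piece is slice
times `ℂ*` times affine `r`-space (`IsPiece.lift_iso_slice`); only scissor relations and products
with a line are needed.

The integrals are compared in each quotient by an open subgroup, where only finitely many values
matter (`Completed.hasSum_iff`, `proj_integral`). The measure of arcs has to be independent of the
jet level (`arcMeasure_eq`). For branches the identity is proved for the very representation chosen
in the definition. -/

lemma IsMorphism.comp {g : Y.carrier → Z.carrier} {f : X.carrier → Y.carrier}
    (hg : IsMorphism (X := Y) (Y := Z) g) (hf : IsMorphism (X := X) (Y := Y) f) :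
    IsMorphism (X := X) (Y := Z) (g ∘ f) :=
  ⟨hg.1.comp hf.1, fun k _ hk => hf.2 _ _ (hg.2 k _ hk)⟩

lemma isMorphism_id : IsMorphism (X := X) (Y := X) id := ⟨continuous_id, fun _ _ h => h⟩

lemma Iso.of_maps (f : X.carrier → Y.carrier) (g : Y.carrier → X.carrier)
    (hf : IsMorphism (X := X) (Y := Y) f) (hg : IsMorphism (X := Y) (Y := X) g)
    (hgf : ∀ x, g (f x) = x) (hfg : ∀ y, f (g y) = y) : X.Iso Y :=
  ⟨⟨f, g, hgf, hfg⟩, hf, hg⟩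

lemma Iso.refl (X : FunSpace) : X.Iso X := ⟨Equiv.refl _, isMorphism_id, isMorphism_id⟩

lemma Iso.symm (h : X.Iso Y) : Y.Iso X := by
  obtain ⟨e, h1, h2⟩ := h
  exact ⟨e.symm, h2, h1⟩

lemma Iso.trans (h : X.Iso Y) (h' : Y.Iso Z) : X.Iso Z := by
  obtain ⟨e, h1, h2⟩ := h
  obtain ⟨e', h1', h2'⟩ := h'
  exact ⟨e.trans e', h1'.comp h1, h2.comp h2'⟩

lemma isMorphism_val (S : Set X.carrier) :
    IsMorphism (X := X.sub S) (Y := X) Subtype.val :=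
  ⟨continuous_subtype_val, fun g _ hg => ⟨g, hg, Eventually.of_forall fun _ => rfl⟩⟩

lemma sub_regAt {S : Set X.carrier} {f : X.carrier → ℂ} {x : (X.sub S).carrier}
    (h : X.regAt f x.1) : (X.sub S).regAt (fun y => f y.1) x :=
  (isMorphism_val S).2 f x h

/-- Regular functions on a subspace are locally restrictions of ambient ones, so their pullbacks
agree locally with pullbacks along the map to the ambient space. -/
lemma isMorphism_to_sub {S : Set X.carrier} {f : Y.carrier → (X.sub S).carrier}
    (h : IsMorphism (X := Y) (Y := X) fun y => (f y).1) :
    IsMorphism (X := Y) (Y := X.sub S) f := by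
  have hc : Continuous f := continuous_induced_rng.2 h.1
  refine ⟨hc, ?_⟩
  rintro g y ⟨k, hk, hg⟩
  refine Y.congr' _ _ y ?_ (h.2 k y hk)
  filter_upwards [hc.continuousAt.eventually hg] with z hz
  exact hz.symm

lemma Iso.sub_of_maps {S : Set X.carrier} {T : Set Y.carrier} (f : X.carrier → Y.carrier)
    (g : Y.carrier → X.carrier)
    (hf : IsMorphism (X := X.sub S) (Y := Y) fun x => f x.1)
    (hg : IsMorphism (X := Y.sub T) (Y := X) fun y => g y.1)
    (hfT : ∀ x ∈ S, f x ∈ T) (hgS : ∀ y ∈ T, g y ∈ S)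
    (hgf : ∀ x ∈ S, g (f x) = x) (hfg : ∀ y ∈ T, f (g y) = y) : (X.sub S).Iso (Y.sub T) :=
  Iso.of_maps (fun x => ⟨f x.1, hfT _ x.2⟩) (fun y => ⟨g y.1, hgS _ y.2⟩)
    (isMorphism_to_sub hf) (isMorphism_to_sub hg) (fun x => Subtype.ext (hgf _ x.2))
    (fun y => Subtype.ext (hfg _ y.2))

lemma sub_sub_iso (S : Set X.carrier) (T : Set (X.sub S).carrier) :
    ((X.sub S).sub T).Iso (X.sub (Subtype.val '' T)) := by
  refine Iso.of_maps (fun x => ⟨x.1.1, x.1, x.2, rfl⟩)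
    (fun y => ⟨⟨y.1, by obtain ⟨z, hz, h⟩ := y.2; exact h ▸ z.2⟩, by
      obtain ⟨y, z, hz, rfl⟩ := y; exact hz⟩) ?_ ?_ (fun _ => rfl) (fun _ => rfl)
  · exact isMorphism_to_sub ((isMorphism_val S).comp (isMorphism_val T))
  · exact isMorphism_to_sub (isMorphism_to_sub (isMorphism_val _))

lemma sub_sub_preimage_iso (S T : Set X.carrier) :
    ((X.sub S).sub (Subtype.val ⁻¹' T)).Iso (X.sub (S ∩ T)) := by
  have h := sub_sub_iso S (Subtype.val ⁻¹' T : Set (X.sub S).carrier)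
  rwa [show (Subtype.val '' (Subtype.val ⁻¹' T : Set (X.sub S).carrier)) = S ∩ T from
    Subtype.image_preimage_coe S T] at h

lemma Iso.sub_equiv (e : X.carrier ≃ Y.carrier) (h1 : IsMorphism (X := X) (Y := Y) e)
    (h2 : IsMorphism (X := Y) (Y := X) e.symm) (S : Set X.carrier) :
    (X.sub S).Iso (Y.sub (e '' S)) := by
  refine Iso.sub_of_maps e e.symm (h1.comp (isMorphism_val S)) (h2.comp (isMorphism_val _))
    (fun x hx => ⟨x, hx, rfl⟩) ?_ (fun x _ => e.symm_apply_apply x)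
    (fun y _ => e.apply_symm_apply y)
  rintro _ ⟨x, hx, rfl⟩
  simpa using hx

/-- The functions regular at all points of `T`. -/
def regOn (X : FunSpace) (T : Set X.carrier) : Subalgebra ℂ (X.carrier → ℂ) where
  carrier := {f | ∀ x ∈ T, X.regAt f x}
  mul_mem' hf hg x hx := X.mul' _ _ x (hf x hx) (hg x hx)
  add_mem' hf hg x hx := X.add' _ _ x (hf x hx) (hg x hx)
  algebraMap_mem' c x _ := X.const' c x

lemma regAt_zpow {f : X.carrier → ℂ} {x : X.carrier} (h : X.regAt f x) (h0 : f x ≠ 0) (n : ℤ) :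
    X.regAt (fun y => f y ^ n) x := by
  have key : ∀ m : ℕ, X.regAt (fun y => f y ^ m) x := fun m =>
    pow_mem (S := X.regOn {x}) (x := f) (by rintro _ rfl; exact h) m x rfl
  obtain ⟨m, rfl | rfl⟩ := n.eq_nat_or_neg
  · simpa using key m
  · simpa using X.inv' _ x (key m) (pow_ne_zero _ h0)

lemma isMorphism_mk (r : X.carrier → X.carrier → Prop) :
    IsMorphism (X := X) (Y := X.quot r) (Quot.mk r) :=
  ⟨continuous_quot_mk, fun _ x h => h.self_of_nhds x rfl⟩

lemma quot_regAt {r : X.carrier → X.carrier → Prop} {f : (X.quot r).carrier → ℂ}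
    {q : (X.quot r).carrier} {V : Set (X.quot r).carrier} (hV : IsOpen V) (hq : q ∈ V)
    (h : ∀ u, (Quot.mk r u : (X.quot r).carrier) ∈ V → X.regAt (fun v => f (Quot.mk r v)) u) :
    (X.quot r).regAt f q := by
  filter_upwards [hV.mem_nhds hq] with y hy u hu
  exact h u (by rw [hu]; exact hy)

end FunSpace

open FunSpace

lemma affineSpace_regAt_coord {ι : Type} (i : ι) (x : AffinePoint ι) :
    (affineSpace ι).regAt (fun y : AffinePoint ι => y.coord i) x :=
  ⟨MvPolynomial.X i, 1, by simp, Eventually.of_forall fun y => by simp⟩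

lemma regAt_eval {X : FunSpace} {ι : Type} {f : X.carrier → AffinePoint ι} {x : X.carrier}
    (h : ∀ i, X.regAt (fun y => (f y).coord i) x) (P : MvPolynomial ι ℂ) :
    X.regAt (fun y => MvPolynomial.eval (f y).coord P) x := by
  induction P using MvPolynomial.induction_on with
  | C a => simpa using X.const' a x
  | add p q hp hq => simpa using X.add' _ _ x hp hq
  | mul_X p i hp => simpa using X.mul' _ _ x hp (h i)

/-- Polynomials in regular functions are regular. The axiom on open nonvanishing sets then gives
continuity on the basic opens, and the axiom on inverses handles quotients of polynomials. -/
lemma isMorphism_affine {X : FunSpace} {ι : Type} {f : X.carrier → AffinePoint ι}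
    (h : ∀ i x, X.regAt (fun y => (f y).coord i) x) :
    IsMorphism (X := X) (Y := affineSpace ι) f := by
  have hc : Continuous (f : X.carrier → AffinePoint ι) := by
    refine continuous_generateFrom_iff.2 ?_
    rintro _ ⟨P, rfl⟩
    rw [isOpen_iff_mem_nhds]
    intro x hx
    exact X.ne' _ x (regAt_eval (fun i => h i x) P) hx
  refine ⟨hc, ?_⟩
  rintro g x ⟨P, Q, hQ, hg⟩
  refine X.congr' _ _ x ?_ (X.mul' _ _ x (regAt_eval (fun i => h i x) P)
    (X.inv' _ x (regAt_eval (fun i => h i x) Q) hQ))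
  filter_upwards [hc.continuousAt.eventually hg] with y hy
  exact ((hy : g (f y) = _).trans (div_eq_mul_inv _ _)).symm

lemma regAt_coord_comp {X : FunSpace} {ι : Type} {f : X.carrier → AffinePoint ι}
    (h : IsMorphism (X := X) (Y := affineSpace ι) f) (i : ι) (x : X.carrier) :
    X.regAt (fun y => (f y).coord i) x :=
  h.2 _ x (affineSpace_regAt_coord i _)

lemma affineSpace_iso_reindex {ι κ : Type} (e : ι ≃ κ) :
    (affineSpace ι).Iso (affineSpace κ) := by
  refine Iso.of_maps (X := affineSpace ι) (Y := affineSpace κ)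
    (fun x : AffinePoint ι => AffinePoint.mk fun k => x.coord (e.symm k))
    (fun x : AffinePoint κ => AffinePoint.mk fun k => x.coord (e k)) ?_ ?_ ?_ ?_
  · exact isMorphism_affine fun i x => affineSpace_regAt_coord _ x
  · exact isMorphism_affine fun i x => affineSpace_regAt_coord _ x
  · intro x
    exact AffinePoint.ext (by simp)
  · intro x
    exact AffinePoint.ext (by simp)

/-! ### The affine space is quasi-projective -/

/-- The point `[1 : x]` of the projective space. -/
noncomputable def toProjective (N : ℕ) (x : AffinePoint (Fin N)) : (projectiveSpace N).carrier :=
  Quot.mk _ ⟨AffinePoint.mk (Fin.cons 1 x.coord : Fin (N + 1) → ℂ), fun h => by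
    simpa using congrFun h 0⟩

/-- The inhomogeneous coordinates `x_i / x_0`. -/
noncomputable def inhomogeneous (N : ℕ) (q : (projectiveSpace N).carrier) : AffinePoint (Fin N) :=
  Quot.lift (fun x => AffinePoint.mk fun i : Fin N => x.1.coord i.succ * (x.1.coord 0)⁻¹) (by
    rintro x y ⟨a, ha, h⟩
    ext i
    simp only [h]
    by_cases h0 : x.1.coord 0 = 0
    · simp [h0]
    · field_simp) q

lemma inhomogeneous_toProjective {N : ℕ} (x : AffinePoint (Fin N)) :
    inhomogeneous N (toProjective N x) = x := by
  ext i
  simp [inhomogeneous, toProjective]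

/-- The chart `x_0 ≠ 0`. -/
def projectiveChart (N : ℕ) : Set (projectiveSpace N).carrier :=
  {q | Quot.lift (fun x => x.1.coord 0 ≠ 0) (by
    rintro x y ⟨a, ha, h⟩
    simp [h, ha]) q}

lemma isOpen_projectiveChart (N : ℕ) : IsOpen (projectiveChart N) := by
  refine isOpen_coinduced.2 ?_
  have : IsOpen {x : AffinePoint (Fin (N + 1)) | x.coord 0 ≠ 0} := by
    refine TopologicalSpace.isOpen_generateFrom_of_mem ⟨MvPolynomial.X 0, ?_⟩
    ext x; simp
  exact this.preimage continuous_subtype_val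

lemma toProjective_inhomogeneous {N : ℕ} {q : (projectiveSpace N).carrier}
    (hq : q ∈ projectiveChart N) : toProjective N (inhomogeneous N q) = q := by
  obtain ⟨x, rfl⟩ := Quot.exists_rep q
  have h0 : x.1.coord 0 ≠ 0 := hq
  refine Quot.sound ⟨x.1.coord 0, h0, fun i => ?_⟩
  refine Fin.cases ?_ (fun i => ?_) i
  · simp
  · simp [inhomogeneous]
    field_simp

lemma affineSpace_iso_chart (N : ℕ) :
    (affineSpace (Fin N)).Iso ((projectiveSpace N).sub (projectiveChart N)) := by
  refine Iso.of_maps (X := affineSpace (Fin N))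
    (fun x => ⟨toProjective N x, by
      change (1 : ℂ) ≠ 0; exact one_ne_zero⟩)
    (fun q => inhomogeneous N q.1) ?_ ?_ (fun x => inhomogeneous_toProjective x)
    (fun q => Subtype.ext (toProjective_inhomogeneous q.2))
  · refine isMorphism_to_sub ?_
    refine (isMorphism_mk _).comp (X := affineSpace (Fin N)) ?_
    refine isMorphism_to_sub (Y := affineSpace (Fin N)) ?_
    refine isMorphism_affine fun i x => ?_
    refine Fin.cases ?_ (fun i => ?_) i
    · simpa using (affineSpace (Fin N)).const' 1 x
    · exact affineSpace_regAt_coord i x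
  · refine isMorphism_affine fun i q => ?_
    refine sub_regAt (X := projectiveSpace N) (f := fun q => (inhomogeneous N q).coord i) ?_
    refine quot_regAt (isOpen_projectiveChart N) q.2 fun u hu => ?_
    have h0 : u.1.coord 0 ≠ 0 := hu
    exact FunSpace.mul' _ _ _ _ (sub_regAt (affineSpace_regAt_coord i.succ u.1))
      (FunSpace.inv' _ _ _ (sub_regAt (affineSpace_regAt_coord 0 u.1)) h0)

lemma FunSpace.IsQuasiProjective.of_iso {X Y : FunSpace} (h : X.Iso Y) (hY : Y.IsQuasiProjective) :
    X.IsQuasiProjective := by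
  obtain ⟨V, hV⟩ := hY
  exact ⟨V, h.trans hV⟩

lemma FunSpace.IsQuasiProjective.sub {X : FunSpace} (h : X.IsQuasiProjective) {S : Set X.carrier}
    (hS : IsLocallyClosed S) : (X.sub S).IsQuasiProjective := by
  obtain ⟨V, e, h1, h2⟩ := h
  have hl : IsLocallyClosed (e '' S) := by
    have : e '' S = e.symm ⁻¹' S := e.image_eq_preimage_symm S
    rw [this]
    exact hS.preimage h2.1
  refine ⟨⟨V.N, Subtype.val '' (e '' S), ?_⟩,
    (Iso.sub_equiv e h1 h2 S).trans (sub_sub_iso _ _)⟩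
  exact hl.image IsInducing.subtypeVal (by
    have h : Set.range (Subtype.val : {x // x ∈ V.S} → _) = V.S := Subtype.range_coe_subtype
    exact h.symm ▸ V.isLocallyClosed)

lemma affineSpace_isQuasiProjective (ι : Type) [Finite ι] :
    (affineSpace ι).IsQuasiProjective := by
  obtain ⟨n, ⟨e⟩⟩ := Finite.exists_equiv_fin ι
  exact .of_iso ((affineSpace_iso_reindex e).trans (affineSpace_iso_chart n))
    ⟨⟨n, projectiveChart n, (isOpen_projectiveChart n).isLocallyClosed⟩, Iso.refl _⟩

/-! ### Classes in the Grothendieck ring -/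

lemma mk_eq_mk_of_K0Rel {x y : FreeCommRing QPVar} (h : K0Rel (x - y)) :
    (Ideal.Quotient.mk (Ideal.span {x : FreeCommRing QPVar | K0Rel x}) x : K0) =
      Ideal.Quotient.mk (Ideal.span {x : FreeCommRing QPVar | K0Rel x}) y :=
  Ideal.Quotient.eq.2 (Ideal.subset_span h)

lemma cls_eq_of_iso {V W : QPVar} (h : V.space.Iso W.space) : V.cls = W.cls :=
  mk_eq_mk_of_K0Rel (K0Rel.iso V W h)

/-- By the isomorphism relation, the choice of a model in `classOf` does not matter. -/
lemma classOf_eq_cls {X : FunSpace} {V : QPVar} (h : X.Iso V.space) : classOf X = V.cls := by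
  have hX : X.IsQuasiProjective := ⟨V, h⟩
  rw [classOf, dif_pos hX]
  exact cls_eq_of_iso (hX.choose_spec.symm.trans h)

lemma classOf_congr {X Y : FunSpace} (h : X.Iso Y) : classOf X = classOf Y := by
  by_cases hY : Y.IsQuasiProjective
  · obtain ⟨V, hV⟩ := hY
    rw [classOf_eq_cls hV, classOf_eq_cls (h.trans hV)]
  · rw [classOf, classOf, dif_neg hY, dif_neg fun hX => hY (hX.of_iso h.symm)]

lemma classOf_scissor {X : FunSpace} (hX : X.IsQuasiProjective) {T : Set X.carrier}
    (hT : IsClosed T) : classOf X = classOf (X.sub T) + classOf (X.sub Tᶜ) := by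
  obtain ⟨Y, hY⟩ := hX.sub hT.isLocallyClosed
  obtain ⟨W, hW⟩ := hX.sub hT.isOpen_compl.isLocallyClosed
  obtain ⟨V, e, h1, h2⟩ := hX
  rw [classOf_eq_cls hY, classOf_eq_cls hW, classOf_eq_cls ⟨e, h1, h2⟩]
  have hT' : IsClosed (e '' T) := by
    rw [e.image_eq_preimage_symm]
    exact hT.preimage h2.1
  have := mk_eq_mk_of_K0Rel (K0Rel.scissor V Y W (e '' T) hT'
    ((Iso.sub_equiv e h1 h2 T).symm.trans hY) (by
      rw [← Set.image_compl_eq e.bijective]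
      exact (Iso.sub_equiv e h1 h2 Tᶜ).symm.trans hW))
  rw [map_add] at this
  exact this

/-- The closed part and its complement are both isomorphic to the empty space itself, so the scissor
relation reads `c = c + c`. -/
lemma classOf_of_isEmpty {X : FunSpace} (h : IsEmpty X.carrier) : classOf X = 0 := by
  by_cases hX : X.IsQuasiProjective
  · have h1 := classOf_scissor hX (T := ∅) isClosed_empty
    have h2 : classOf (X.sub ∅) = classOf X := classOf_congr <|
      Iso.of_maps Subtype.val (fun x => (h.false x).elim) (isMorphism_val _)
        ⟨continuous_iff_continuousAt.2 fun x => (h.false x).elim, fun _ x => (h.false x).elim⟩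
        (fun x => (h.false x.1).elim) (fun x => (h.false x).elim)
    have h3 : classOf (X.sub ∅ᶜ) = classOf X := classOf_congr <|
      Iso.of_maps Subtype.val (fun x => (h.false x).elim) (isMorphism_val _)
        ⟨continuous_iff_continuousAt.2 fun x => (h.false x).elim, fun _ x => (h.false x).elim⟩
        (fun x => (h.false x.1).elim) (fun x => (h.false x).elim)
    rw [h2, h3] at h1
    simpa using h1
  · rw [classOf, dif_neg hX]

lemma classOf_sub_empty (X : FunSpace) : classOf (X.sub ∅) = 0 :=
  classOf_of_isEmpty (inferInstanceAs (IsEmpty (∅ : Set X.carrier)))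

lemma isQuasiProjective_of_isEmpty {X : FunSpace} (h : IsEmpty X.carrier) :
    X.IsQuasiProjective := by
  have hE : IsEmpty ((affineSpace (Fin 0)).sub ∅).carrier :=
    inferInstanceAs (IsEmpty (∅ : Set (AffinePoint (Fin 0))))
  refine .of_iso (Y := (affineSpace (Fin 0)).sub ∅) ?_
    ((affineSpace_isQuasiProjective (Fin 0)).sub isClosed_empty.isLocallyClosed)
  exact Iso.of_maps (fun x => (h.false x).elim) (fun x => (hE.false x).elim)
    ⟨continuous_iff_continuousAt.2 fun x => (h.false x).elim, fun _ x => (h.false x).elim⟩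
    ⟨continuous_iff_continuousAt.2 fun x => (hE.false x).elim, fun _ x => (hE.false x).elim⟩
    (fun x => (h.false x).elim) (fun x => (hE.false x).elim)

/-! ### Partitions into locally closed subspaces -/

/-- The class of a locally closed quasi-projective subspace is additive. -/
lemma classOf_sub_add {X : FunSpace} {S : Set X.carrier} (hS : (X.sub S).IsQuasiProjective)
    {C : Set X.carrier} (hC : IsClosed C) :
    classOf (X.sub S) = classOf (X.sub (S ∩ C)) + classOf (X.sub (S ∩ Cᶜ)) := by
  rw [classOf_scissor hS (hC.preimage (isMorphism_val S).1),
    classOf_congr (sub_sub_preimage_iso S C)]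
  exact congrArg _ (classOf_congr (sub_sub_preimage_iso S Cᶜ))

lemma isQuasiProjective_sub_inter {X : FunSpace} {S T : Set X.carrier}
    (hS : (X.sub S).IsQuasiProjective) (hT : IsLocallyClosed T) :
    (X.sub (S ∩ T)).IsQuasiProjective :=
  (hS.sub (hT.preimage (isMorphism_val S).1)).of_iso (sub_sub_preimage_iso S T).symm

/-- Scissor relations cut along closed sets only, whereas the `V i` are merely locally closed.
Writing `V a = A ∩ B` with `A` open and `B` closed, one cuts `S` first along `B` and then along
`Aᶜ`. One part is `S ∩ V a`; the other two miss `V a`, so the induction hypothesis applies to them,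
and they are glued again inside each remaining `V i`. -/
lemma classOf_sub_eq_sum {X : FunSpace} {ι : Type*} (I : Finset ι) (V : ι → Set X.carrier)
    (hV : ∀ i ∈ I, IsLocallyClosed (V i)) (hd : (I : Set ι).PairwiseDisjoint V)
    {S : Set X.carrier} (hS : (X.sub S).IsQuasiProjective) (hSV : S ⊆ ⋃ i ∈ I, V i) :
    classOf (X.sub S) = ∑ i ∈ I, classOf (X.sub (S ∩ V i)) := by
  classical
  induction I using Finset.induction_on generalizing S with
  | empty =>
    obtain rfl : S = ∅ := by simpa [Set.subset_empty_iff] using hSV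
    simpa using classOf_sub_empty X
  | insert a I ha ih =>
    have hVa := hV a (Finset.mem_insert_self a I)
    obtain ⟨A, B, hA, hB, hAB⟩ := hVa
    have hd' : (I : Set ι).PairwiseDisjoint V := hd.subset (by simp)
    have hda : ∀ i ∈ I, Disjoint (V a) (V i) := fun i hi =>
      hd (by simp) (by simp [hi]) (fun h => ha (h ▸ hi))
    have hind : ∀ T : Set X.carrier, T ⊆ S → (X.sub T).IsQuasiProjective → Disjoint T (V a) →
        classOf (X.sub T) = ∑ i ∈ I, classOf (X.sub (T ∩ V i)) := by
      intro T hTS hT hTa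
      refine ih (fun i hi => hV i (Finset.mem_insert_of_mem hi)) hd' hT fun x hx => ?_
      have := hSV (hTS hx)
      simp only [Finset.mem_insert, Set.iUnion_iUnion_eq_or_left, Set.mem_union] at this
      exact this.resolve_left fun h => hTa.le_bot ⟨hx, h⟩
    have hBl := hB.isLocallyClosed
    have hBc := hB.isOpen_compl.isLocallyClosed
    have hAl := hA.isLocallyClosed
    have hAc := hA.isClosed_compl.isLocallyClosed
    have e1 : S ∩ B ∩ A = S ∩ V a := by rw [hAB, Set.inter_assoc, Set.inter_comm B]
    have q1 := isQuasiProjective_sub_inter hS hBl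
    have s0 := classOf_sub_add hS hB
    have s1 := classOf_sub_add q1 hA.isClosed_compl
    rw [compl_compl, e1] at s1
    have hh1 := hind (S ∩ B ∩ Aᶜ) (fun x hx => hx.1.1) (isQuasiProjective_sub_inter q1 hAc)
      (Set.disjoint_left.2 fun x hx hx' => hx.2 (by rw [hAB] at hx'; exact hx'.1))
    have hh2 := hind (S ∩ Bᶜ) (fun x hx => hx.1) (isQuasiProjective_sub_inter hS hBc)
      (Set.disjoint_left.2 fun x hx hx' => hx.2 (by rw [hAB] at hx'; exact hx'.2))
    rw [Finset.sum_insert ha, s0, s1, hh1, hh2, add_comm (Finset.sum _ _), add_assoc,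
      ← Finset.sum_add_distrib]
    congr 1
    refine Finset.sum_congr rfl fun i hi => ?_
    have hi' := hV i (Finset.mem_insert_of_mem hi)
    have q := isQuasiProjective_sub_inter hS hi'
    rw [classOf_sub_add q hB]
    congr 1
    · congr 2
      ext x
      have h0 := Set.disjoint_left.1 (hda i hi)
      have := @h0 x
      simp only [hAB, Set.mem_inter_iff, Set.mem_compl_iff] at *
      tauto
    · congr 2
      ext x
      simp only [Set.mem_inter_iff, Set.mem_compl_iff]
      tauto

/-- Both sums equal the double sum over the common refinement. Hence the partition chosen in
`constructibleClass` is irrelevant. -/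
lemma sum_classOf_eq {X : FunSpace} {Y : Set X.carrier} {m m' : ℕ} {P : Fin m → Set X.carrier}
    {P' : Fin m' → Set X.carrier} (h : IsQPPartition X Y m P) (h' : IsQPPartition X Y m' P') :
    ∑ i, classOf (X.sub (P i)) = ∑ i, classOf (X.sub (P' i)) := by
  have key : ∀ {m m' : ℕ} {P : Fin m → Set X.carrier} {P' : Fin m' → Set X.carrier},
      IsQPPartition X Y m P → IsQPPartition X Y m' P' →
      ∑ i, classOf (X.sub (P i)) = ∑ i, ∑ j, classOf (X.sub (P i ∩ P' j)) := by
    intro m m' P P' h h'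
    refine Finset.sum_congr rfl fun i _ => ?_
    refine classOf_sub_eq_sum Finset.univ P' (fun j _ => h'.1 j) (fun a _ b _ hab => h'.2.2.1 hab)
      (h.2.1 i) ?_
    simp only [Finset.mem_univ, Set.iUnion_true, h'.2.2.2, ← h.2.2.2]
    exact Set.subset_iUnion P i
  rw [key h h', key h' h, Finset.sum_comm]
  simp only [Set.inter_comm]

lemma constructibleClass_eq_sum {X : FunSpace} {Y : Set X.carrier} {ι : Type*} [Fintype ι]
    {P : ι → Set X.carrier} (h1 : ∀ i, IsLocallyClosed (P i))
    (h2 : ∀ i, (X.sub (P i)).IsQuasiProjective) (h3 : Pairwise fun i j => Disjoint (P i) (P j))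
    (h4 : ⋃ i, P i = Y) : constructibleClass X Y = ∑ i, classOf (X.sub (P i)) := by
  let e := Fintype.equivFin ι
  have hP : IsQPPartition X Y (Fintype.card ι) (P ∘ e.symm) :=
    ⟨fun i => h1 _, fun i => h2 _, fun i j hij => h3 (e.symm.injective.ne hij), by
      rw [← h4]; exact e.symm.surjective.iUnion_comp P⟩
  have hex : ∃ p : Σ m : ℕ, (Fin m → Set X.carrier), IsQPPartition X Y p.1 p.2 :=
    ⟨⟨_, _⟩, hP⟩
  rw [constructibleClass, dif_pos hex, sum_classOf_eq hex.choose_spec hP]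
  exact e.symm.sum_comp fun i => classOf (X.sub (P i))

/-! ### Products with affine spaces -/

/-- The restriction of coordinates along a map of index sets. -/
def AffinePoint.comap {ι κ : Type} (e : ι → κ) (x : AffinePoint κ) : AffinePoint ι :=
  ⟨fun i => x.coord (e i)⟩

lemma isMorphism_comap {ι κ : Type} (e : ι → κ) :
    IsMorphism (X := affineSpace κ) (Y := affineSpace ι) (AffinePoint.comap e) :=
  isMorphism_affine fun i x => affineSpace_regAt_coord (e i) x

lemma affineSpace_continuous_comap {ι κ : Type} (e : ι → κ) :
    Continuous (AffinePoint.comap e) :=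
  (isMorphism_comap e).1

/-- The class of a subset of an affine space. -/
noncomputable def affineClass {ι : Type} (S : Set (AffinePoint ι)) : K0 :=
  classOf ((affineSpace ι).sub S)

lemma isQuasiProjective_affine_sub {ι : Type} [Finite ι] {S : Set (AffinePoint ι)}
    (hS : IsLocallyClosed S) : ((affineSpace ι).sub S).IsQuasiProjective :=
  (affineSpace_isQuasiProjective ι).sub hS

/-- A locally closed subset of an affine space times the affine line. -/
lemma classOf_comap_some {ι : Type} [Finite ι] {S : Set (AffinePoint ι)}
    (hS : IsLocallyClosed S) :
    affineClass (AffinePoint.comap some ⁻¹' S : Set (AffinePoint (Option ι))) =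
      affineClass S * lef := by
  obtain ⟨Z, eZ, hZ1, hZ2⟩ := (affineSpace_isQuasiProjective (Option ι)).sub
    (hS.preimage (affineSpace_continuous_comap some))
  obtain ⟨X, eX, hX1, hX2⟩ := (affineSpace_isQuasiProjective ι).sub hS
  obtain ⟨Y, eY, hY1, hY2⟩ := affineSpace_isQuasiProjective (Fin 1)
  have cZ : affineClass (AffinePoint.comap some ⁻¹' S) = Z.cls := classOf_eq_cls ⟨eZ, hZ1, hZ2⟩
  have cX : affineClass S = X.cls := classOf_eq_cls ⟨eX, hX1, hX2⟩
  rw [cZ, cX, lef, classOf_eq_cls ⟨eY, hY1, hY2⟩]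
  let p : ((affineSpace (Option ι)).sub (AffinePoint.comap some ⁻¹' S)).carrier →
      ((affineSpace ι).sub S).carrier := fun z => ⟨AffinePoint.comap some z.1, z.2⟩
  let q : ((affineSpace (Option ι)).sub (AffinePoint.comap some ⁻¹' S)).carrier →
      AffinePoint (Fin 1) := fun z => ⟨fun _ => z.1.coord none⟩
  have hp : IsMorphism (X := (affineSpace (Option ι)).sub (AffinePoint.comap some ⁻¹' S))
      (Y := (affineSpace ι).sub S) p :=
    isMorphism_to_sub ((isMorphism_comap some).comp (isMorphism_val _))
  have hq : IsMorphism (X := (affineSpace (Option ι)).sub (AffinePoint.comap some ⁻¹' S))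
      (Y := affineSpace (Fin 1)) q :=
    isMorphism_affine fun _ z => sub_regAt (affineSpace_regAt_coord none z.1)
  -- The product relation is stated by a universal property; here it holds because a morphism to a
  -- subspace of an affine space is a tuple of regular functions.
  have hprod : IsProduct Z X Y := by
    refine ⟨eX ∘ p ∘ eZ.symm, eY ∘ q ∘ eZ.symm, hX1.comp (hp.comp hZ2),
      hY1.comp (hq.comp hZ2), fun W f g hf hg => ?_⟩
    let f' := eX.symm ∘ f
    let g' := eY.symm ∘ g
    have hf' : IsMorphism (X := W.space) (Y := (affineSpace ι).sub S) f' := hX2.comp hf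
    have hg' : IsMorphism (X := W.space) (Y := affineSpace (Fin 1)) g' := hY2.comp hg
    let h : W.space.carrier →
        ((affineSpace (Option ι)).sub (AffinePoint.comap some ⁻¹' S)).carrier := fun w =>
      ⟨⟨fun o => o.elim ((g' w).coord 0) fun i => (f' w).1.coord i⟩, (f' w).2⟩
    have hh : IsMorphism (X := W.space)
        (Y := (affineSpace (Option ι)).sub (AffinePoint.comap some ⁻¹' S)) h := by
      refine isMorphism_to_sub (isMorphism_affine fun o w => ?_)
      cases o with
      | none => exact regAt_coord_comp hg' 0 w
      | some i => exact regAt_coord_comp ((isMorphism_val _).comp hf') i w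
    refine ⟨eZ ∘ h, ⟨hZ1.comp hh, ?_, ?_⟩, ?_⟩
    · funext w
      have : p (h w) = f' w := rfl
      simp [this, f']
    · funext w
      have : q (h w) = eY.symm (g w) := AffinePoint.ext (funext fun i => by
        rw [Subsingleton.elim i 0]
        rfl)
      change eY (q (eZ.symm (eZ (h w)))) = g w
      rw [eZ.symm_apply_apply, this]
      exact eY.apply_symm_apply _
    · rintro k ⟨-, rfl, rfl⟩
      funext w
      refine (eZ.eq_symm_apply.1 ?_).symm
      refine Subtype.ext (AffinePoint.ext (funext fun o => ?_))
      cases o with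
      | none =>
        exact congrArg (fun y : AffinePoint (Fin 1) => y.coord 0)
          (eY.symm_apply_apply (q (eZ.symm (k w))))
      | some i =>
        simp only [h, f', p, Function.comp_apply, Equiv.symm_apply_apply]
        rfl
  have := mk_eq_mk_of_K0Rel (K0Rel.prod Z X Y hprod)
  rw [map_mul] at this
  exact this

lemma classOf_comap_equiv {ι κ : Type} (e : ι ≃ κ) (S : Set (AffinePoint ι)) :
    affineClass (AffinePoint.comap e ⁻¹' S : Set (AffinePoint κ)) = affineClass S := by
  refine classOf_congr (Iso.sub_of_maps (X := affineSpace κ) (Y := affineSpace ι)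
    (AffinePoint.comap e) (AffinePoint.comap e.symm) ((isMorphism_comap _).comp (isMorphism_val _))
    ((isMorphism_comap _).comp (isMorphism_val _)) (fun x hx => hx) ?_ ?_ ?_)
  · intro y hy
    have h : AffinePoint.comap e (AffinePoint.comap e.symm y) = y :=
      AffinePoint.ext (by simp [AffinePoint.comap])
    exact (congrArg (· ∈ S) h).mpr hy
  · intro x _
    exact AffinePoint.ext (by simp [AffinePoint.comap])
  · intro x _
    exact AffinePoint.ext (by simp [AffinePoint.comap])

/-- A locally closed subset of an affine space times an affine space. -/
lemma classOf_comap_inl {ι : Type} [Finite ι] {S : Set (AffinePoint ι)}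
    (hS : IsLocallyClosed S) (n : ℕ) :
    affineClass (AffinePoint.comap Sum.inl ⁻¹' S : Set (AffinePoint (ι ⊕ Fin n))) =
      affineClass S * lef ^ n := by
  induction n with
  | zero =>
    rw [pow_zero, mul_one]
    exact classOf_comap_equiv (Equiv.sumEmpty ι (Fin 0)).symm S
  | succ n ih =>
    let e : Option (ι ⊕ Fin n) ≃ ι ⊕ Fin (n + 1) :=
      { toFun := fun o => o.elim (Sum.inr (Fin.last n)) (Sum.map id Fin.castSucc)
        invFun := Sum.elim (fun i => some (Sum.inl i))
          (Fin.lastCases none fun k => some (Sum.inr k))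
        left_inv := by rintro (_ | _ | _) <;> simp
        right_inv := by
          rintro (_ | k)
          · simp
          · refine Fin.lastCases ?_ (fun k => ?_) k <;> simp }
    rw [pow_succ, ← mul_assoc, ← ih, ← classOf_comap_some
      (hS.preimage (affineSpace_continuous_comap Sum.inl)), ← classOf_comap_equiv e.symm]
    refine congrArg affineClass ?_
    ext x
    simp [AffinePoint.comap, e]

/-- A locally closed subset of an affine space times the punctured affine line. -/
lemma classOf_comap_some_ne {ι : Type} [Finite ι] {S : Set (AffinePoint ι)}
    (hS : IsLocallyClosed S) :
    affineClass (AffinePoint.comap some ⁻¹' S ∩ {x : AffinePoint (Option ι) | x.coord none ≠ 0}) =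
      affineClass S * (lef - 1) := by
  have hC : IsClosed {x : AffinePoint (Option ι) | x.coord none = 0} := by
    refine ⟨?_⟩
    refine TopologicalSpace.isOpen_generateFrom_of_mem ⟨MvPolynomial.X none, ?_⟩
    ext x; simp
  have h : affineClass (AffinePoint.comap some ⁻¹' S) =
      affineClass (AffinePoint.comap some ⁻¹' S ∩ {x : AffinePoint (Option ι) | x.coord none = 0}) +
      affineClass (AffinePoint.comap some ⁻¹' S ∩ {x : AffinePoint (Option ι) | x.coord none ≠ 0}) :=
    classOf_sub_add (X := affineSpace (Option ι)) (isQuasiProjective_affine_sub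
      (hS.preimage (affineSpace_continuous_comap some))) hC
  have h1 : affineClass
      (AffinePoint.comap some ⁻¹' S ∩ {x : AffinePoint (Option ι) | x.coord none = 0}) =
      affineClass S := by
    refine classOf_congr (Iso.sub_of_maps (X := affineSpace (Option ι)) (Y := affineSpace ι)
      (AffinePoint.comap some) (fun x => ⟨fun o => o.elim 0 x.coord⟩)
      ((isMorphism_comap _).comp (isMorphism_val _)) ?_ (fun x hx => hx.1) ?_ ?_ ?_)
    · refine isMorphism_affine fun o x => ?_
      cases o with
      | none => exact FunSpace.const' _ _ _
      | some i => exact sub_regAt (affineSpace_regAt_coord i x.1)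
    · exact fun y hy => ⟨hy, rfl⟩
    · rintro x ⟨-, hx⟩
      refine AffinePoint.ext (funext fun o => ?_)
      cases o with
      | none => exact hx.symm
      | some i => rfl
    · exact fun _ _ => rfl
  rw [classOf_comap_some hS, h1] at h
  rw [mul_sub, h, mul_one, add_sub_cancel_left]

/-! ### Constructible sets -/

instance affinePoint_noetherianSpace {ι : Type} [Finite ι] :
    TopologicalSpace.NoetherianSpace (AffinePoint ι) := by
  -- The Zariski topology is induced from the prime spectrum of a Noetherian ring by sending a point
  -- to the kernel of evaluation.
  let f : AffinePoint ι → PrimeSpectrum (MvPolynomial ι ℂ) := fun x =>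
    ⟨RingHom.ker (MvPolynomial.eval x.coord), RingHom.ker_isPrime _⟩
  have hf : IsInducing f := by
    refine ⟨?_⟩
    rw [(PrimeSpectrum.isTopologicalBasis_basic_opens (R := MvPolynomial ι ℂ)).eq_generateFrom,
      induced_generateFrom_eq]
    change TopologicalSpace.generateFrom _ = _
    congr 1
    rw [← Set.range_comp]
    congr 1
  exact hf.noetherianSpace

/-- A constructible set is a union of fibres of a map to a finite type with locally closed
fibres. -/
lemma exists_map_of_isConstructible {X : Type*} [TopologicalSpace X] {s : Set X}
    (h : IsConstructible s) : ∃ (m : ℕ) (f : X → Fin m) (A : Set (Fin m)),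
      (∀ t, IsLocallyClosed (f ⁻¹' {t})) ∧ s = f ⁻¹' A := by
  suffices H : ∃ (τ : Type) (_ : Finite τ) (f : X → τ) (A : Set τ),
      (∀ t, IsLocallyClosed (f ⁻¹' {t})) ∧ s = f ⁻¹' A by
    obtain ⟨τ, _, f, A, h1, rfl⟩ := H
    obtain ⟨m, ⟨e⟩⟩ := Finite.exists_equiv_fin τ
    refine ⟨m, e ∘ f, e.symm ⁻¹' A, fun t => ?_, ?_⟩
    · convert h1 (e.symm t) using 1
      ext x
      simp [Equiv.eq_symm_apply]
    · ext x; simp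
  induction h using IsConstructible.empty_union_induction with
  | open_retrocompact U hU _ =>
    refine ⟨Prop, inferInstance, fun x => x ∈ U, {True}, fun t => ?_, by ext; simp⟩
    by_cases ht : t
    · convert hU.isLocallyClosed using 1
      ext; simp [ht]
    · convert hU.isClosed_compl.isLocallyClosed using 1
      ext; simp [ht]
  | union s hs t ht ih1 ih2 =>
    obtain ⟨τ, _, f, A, h1, rfl⟩ := ih1
    obtain ⟨τ', _, f', A', h1', rfl⟩ := ih2
    refine ⟨τ × τ', inferInstance, fun x => (f x, f' x), {p | p.1 ∈ A ∨ p.2 ∈ A'}, fun t => ?_, rfl⟩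
    convert (h1 t.1).inter (h1' t.2) using 1
    ext; simp [Prod.ext_iff]
  | compl s hs ih =>
    obtain ⟨τ, _, f, A, h1, rfl⟩ := ih
    exact ⟨τ, inferInstance, f, Aᶜ, h1, rfl⟩

lemma isConstructible_of_isLocallyClosed {X : Type*} [TopologicalSpace X]
    [TopologicalSpace.NoetherianSpace X] {s : Set X} (h : IsLocallyClosed s) :
    IsConstructible s := by
  have key : ∀ U : Set X, IsOpen U → IsConstructible U := fun U hU =>
    IsRetrocompact.isConstructible hU fun _ _ _ => TopologicalSpace.NoetherianSpace.isCompact _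
  obtain ⟨U, Z, hU, hZ, rfl⟩ := h
  exact (key U hU).inter (isConstructible_compl.1 (key _ hZ.isOpen_compl))

/-- The partition of a constructible subset of an affine space by a map with locally closed
fibres. -/
lemma constructibleClass_affine_eq_sum {ι : Type} [Finite ι] {τ : Type*} [Fintype τ]
    {f : AffinePoint ι → τ} (hf : ∀ t, IsLocallyClosed (f ⁻¹' {t})) (A : Set τ)
    [DecidablePred (· ∈ A)] :
    constructibleClass (affineSpace ι) (f ⁻¹' A) =
      ∑ t with t ∈ A, affineClass (f ⁻¹' {t}) := by
  rw [Finset.sum_subtype (p := (· ∈ A)) _ (by simp)]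
  refine constructibleClass_eq_sum (X := affineSpace ι) (fun t : {t // t ∈ A} => hf t.1)
    (fun t => isQuasiProjective_affine_sub (hf t.1)) ?_ ?_
  · intro s t hst
    refine Set.disjoint_left.2 fun x hx hx' => hst (Subtype.ext ?_)
    exact (hx : f x = s.1).symm.trans hx'
  · refine Set.ext fun x => Set.mem_iUnion.trans ⟨?_, fun h => ⟨⟨f x, h⟩, rfl⟩⟩
    rintro ⟨⟨t, ht⟩, rfl⟩
    exact ht

/-! ### Normal forms of jets -/

section Series

open PowerSeries

variable {A : Type*} [CommRing A]

/-- The geometric sum factorization. When `k` is invertible the cofactor is a unit, which governs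
both existence and uniqueness of `k`-th roots. -/
lemma pow_sub_pow_eq_mul (u v : A⟦X⟧) (k : ℕ) (hu : constantCoeff u = 1)
    (hv : constantCoeff v = 1) :
    ∃ S : A⟦X⟧, constantCoeff S = k ∧ u ^ k - v ^ k = S * (u - v) :=
  ⟨∑ i ∈ Finset.range k, u ^ i * v ^ (k - 1 - i), by simp [hu, hv],
    (geom_sum₂_mul u v k).symm⟩

/-- Truncated roots of power series with constant coefficient `1`. -/
lemma exists_root_of_constantCoeff_one (F : A⟦X⟧) (hF : constantCoeff F = 1) {k : ℕ}
    (hk : IsUnit (k : A)) (s : ℕ) :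
    ∃ u : A⟦X⟧, constantCoeff u = 1 ∧ (X : A⟦X⟧) ^ (s + 1) ∣ F - u ^ k := by
  induction s with
  | zero => exact ⟨1, by simp, by simp [X_dvd_iff, hF]⟩
  | succ s ih =>
    obtain ⟨u, hu, q, hq⟩ := ih
    obtain ⟨e, he⟩ := hk.exists_right_inv
    -- A Newton step: the increment changes the `k`-th power by a series times the increment, with
    -- constant term `k`, so `e = 1/k` times the lowest error coefficient removes that error.
    have hu' : constantCoeff (u + X ^ (s + 1) * C (e * constantCoeff q)) = 1 := by simp [hu]
    refine ⟨u + X ^ (s + 1) * C (e * constantCoeff q), hu', ?_⟩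
    obtain ⟨S, hS, hSu⟩ := pow_sub_pow_eq_mul _ u k hu' hu
    have h : F - (u + X ^ (s + 1) * C (e * constantCoeff q)) ^ k =
        X ^ (s + 1) * (q - S * C (e * constantCoeff q)) := by
      rw [mul_sub, ← hq]
      linear_combination -hSu
    rw [h, pow_succ]
    refine mul_dvd_mul_left _ (X_dvd_iff.2 ?_)
    simp only [map_sub, map_mul, hS, constantCoeff_C]
    linear_combination -(constantCoeff q) * he

lemma dvd_sub_of_dvd_pow_sub_pow {u v : ℂ⟦X⟧} {k s : ℕ} (hu : constantCoeff u = 1)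
    (hv : constantCoeff v = 1) (hk : k ≠ 0) (h : (X : ℂ⟦X⟧) ^ s ∣ u ^ k - v ^ k) :
    (X : ℂ⟦X⟧) ^ s ∣ u - v := by
  obtain ⟨S, hS, hSu⟩ := pow_sub_pow_eq_mul u v k hu hv
  have hS' : IsUnit S := isUnit_iff_constantCoeff.2 (by
    rw [hS]
    exact (Nat.cast_ne_zero.2 hk).isUnit)
  rwa [hSu, hS'.dvd_mul_left] at h

lemma coeff_X_mul_pow_of_lt (v : A⟦X⟧) {m l : ℕ} (h : m < l) : coeff m ((X * v) ^ l) = 0 := by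
  rw [mul_pow, coeff_X_pow_mul', if_neg (by omega)]

lemma coeff_X_mul_pow_self (v : A⟦X⟧) (m : ℕ) :
    coeff m ((X * v) ^ m) = constantCoeff v ^ m := by
  rw [mul_pow, coeff_X_pow_mul', if_pos le_rfl]
  simp

variable {d n : ℕ}

/-- The series `∑ c_(m,j) h^(m+1)`. -/
noncomputable def arcSeries (c : Fin n × Fin d → A) (j : Fin d) (h : A⟦X⟧) : A⟦X⟧ :=
  ∑ m : Fin n, C (c (m, j)) * h ^ (m.1 + 1)

lemma map_arcSeries {B : Type*} [CommRing B] (f : A →+* B) (c : Fin n × Fin d → A) (j : Fin d)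
    (h : A⟦X⟧) : PowerSeries.map f (arcSeries c j h) =
      arcSeries (fun p => f (c p)) j (PowerSeries.map f h) := by
  simp [arcSeries]

lemma arcSeries_sub (c c' : Fin n × Fin d → A) (j : Fin d) (h : A⟦X⟧) :
    arcSeries c j h - arcSeries c' j h = arcSeries (c - c') j h := by
  simp [arcSeries, sub_mul]

lemma constantCoeff_arcSeries (c : Fin n × Fin d → A) (j : Fin d) {h : A⟦X⟧}
    (hh : constantCoeff h = 0) : constantCoeff (arcSeries c j h) = 0 := by
  simp [arcSeries, hh]

/-- The lowest coefficient of `arcSeries`. -/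
lemma coeff_arcSeries (c : Fin n × Fin d → A) (j : Fin d) (v : A⟦X⟧) (i : Fin n)
    (hc : ∀ m < i, c (m, j) = 0) :
    coeff (i.1 + 1) (arcSeries c j (X * v)) = c (i, j) * constantCoeff v ^ (i.1 + 1) := by
  rw [arcSeries, map_sum, Finset.sum_eq_single i]
  · rw [coeff_C_mul, coeff_X_mul_pow_self]
  · intro m _ hm
    rw [coeff_C_mul]
    rcases lt_or_gt_of_ne hm with h | h
    · rw [hc m h, zero_mul]
    · rw [coeff_X_mul_pow_of_lt _ (by have : i.1 < m.1 := h; omega), mul_zero]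
  · simp

lemma coeff_arcSeries_X (c : Fin n × Fin d → A) (j : Fin d) (i : Fin n) :
    coeff (i.1 + 1) (arcSeries c j X) = c (i, j) := by
  simp only [arcSeries, map_sum, coeff_C_mul, coeff_X_pow]
  rw [Finset.sum_eq_single i]
  · simp
  · intro m _ hm
    rw [if_neg (by intro h; exact hm (Fin.ext (by omega))), mul_zero]
  · simp

lemma X_pow_dvd_iff_fin {f : A⟦X⟧} (hf : constantCoeff f = 0) :
    (X : A⟦X⟧) ^ (n + 1) ∣ f ↔ ∀ m : Fin n, coeff (m.1 + 1) f = 0 := by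
  rw [X_pow_dvd_iff]
  constructor
  · exact fun h m => h _ (by omega)
  · rintro h (_ | m) hm
    · simpa using hf
    · exact h ⟨m, by omega⟩

/-- The powers of `X * u` have increasing orders and leading coefficient `1`, so the linear system
for the coefficients is triangular. -/
lemma coeff_eq_zero_of_dvd_arcSeries {c : Fin n × Fin d → A} {j : Fin d} {u : A⟦X⟧} {N : ℕ}
    (hu : constantCoeff u = 1) (h : (X : A⟦X⟧) ^ N ∣ arcSeries c j (X * u)) (m : Fin n)
    (hm : m.1 + 1 < N) : c (m, j) = 0 := by
  induction m using WellFoundedLT.induction with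
  | ind m ih =>
    have h1 := coeff_arcSeries c j u m fun l hl => ih l hl (by have : l.1 < m.1 := hl; omega)
    rw [X_pow_dvd_iff.1 h _ hm, hu, one_pow, mul_one] at h1
    exact h1.symm

/-- Truncated expansions in powers of `X * u`. -/
lemma exists_expansion (g u : A⟦X⟧) (hg : constantCoeff g = 0) (hu : constantCoeff u = 1) (n : ℕ) :
    ∃ c : ℕ → A, (X : A⟦X⟧) ^ (n + 1) ∣
      g - ∑ m ∈ Finset.range n, C (c m) * (X * u) ^ (m + 1) := by
  induction n with
  | zero => exact ⟨0, by simpa [X_dvd_iff] using hg⟩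
  | succ n ih =>
    obtain ⟨c, q, hq⟩ := ih
    refine ⟨Function.update c n (constantCoeff q), ?_⟩
    rw [Finset.sum_range_succ, Function.update_self, ← sub_sub, Finset.sum_congr rfl
      (g := fun m => C (c m) * (X * u) ^ (m + 1)) (fun m hm => by
        rw [Function.update_of_ne (Finset.mem_range.1 hm).ne]), hq, pow_succ _ (n + 1)]
    have : X ^ (n + 1) * q - C (constantCoeff q) * (X * u) ^ (n + 1) =
        X ^ (n + 1) * (q - C (constantCoeff q) * u ^ (n + 1)) := by ring
    rw [this]
    refine mul_dvd_mul_left _ (X_dvd_iff.2 ?_)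
    simp [hu]

/-- The series `1 + b_0 X + ⋯ + b_(r-1) X^r`. -/
noncomputable def unipotent {r : ℕ} (b : Fin r → A) : A⟦X⟧ := 1 + ∑ s : Fin r, C (b s) * X ^ (s.1 + 1)

lemma constantCoeff_unipotent {r : ℕ} (b : Fin r → A) : constantCoeff (unipotent b) = 1 := by
  simp [unipotent]

lemma map_unipotent {B : Type*} [CommRing B] (f : A →+* B) {r : ℕ} (b : Fin r → A) :
    PowerSeries.map f (unipotent b) = unipotent fun s => f (b s) := by
  simp [unipotent]

lemma coeff_unipotent {r : ℕ} (b : Fin r → A) (s : Fin r) :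
    coeff (s.1 + 1) (unipotent b) = b s := by
  simp only [unipotent, map_add, map_sum, coeff_C_mul, coeff_X_pow, coeff_one]
  rw [Finset.sum_eq_single s]
  · simp
  · intro m _ hm
    rw [if_neg (by intro h; exact hm (Fin.ext (by omega))), mul_zero]
  · simp

lemma dvd_sub_unipotent {u : A⟦X⟧} (hu : constantCoeff u = 1) (r : ℕ) :
    (X : A⟦X⟧) ^ (r + 1) ∣ u - unipotent fun s : Fin r => coeff (s.1 + 1) u := by
  rw [X_pow_dvd_iff_fin (by simp [hu, constantCoeff_unipotent])]
  intro m
  rw [map_sub, coeff_unipotent, sub_self]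

lemma unipotent_injective {r : ℕ} {b b' : Fin r → A}
    (h : (X : A⟦X⟧) ^ (r + 1) ∣ unipotent b - unipotent b') : b = b' := by
  rw [X_pow_dvd_iff_fin (by simp [constantCoeff_unipotent])] at h
  funext s
  simpa [coeff_unipotent, sub_eq_zero] using h s

/-- Jets whose `j`-th component is a monomial of degree `i + 1`, and all whose components have
at least this order. -/
structure IsNormal (i : Fin n) (j : Fin d) (c : Fin n × Fin d → ℂ) : Prop where
  low : ∀ m < i, ∀ j', c (m, j') = 0
  lead : c (i, j) ≠ 0
  rest : ∀ m ≠ i, c (m, j) = 0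

lemma IsNormal.arcSeries_eq {i : Fin n} {j : Fin d} {c : Fin n × Fin d → ℂ} (hc : IsNormal i j c)
    (h : ℂ⟦X⟧) : arcSeries c j h = C (c (i, j)) * h ^ (i.1 + 1) := by
  rw [arcSeries, Finset.sum_eq_single i]
  · intro m _ hm
    rw [hc.rest m hm, map_zero, zero_mul]
  · simp

/-- Every occurring power of the parameter contributes at least `i + 1` factors `X`, so only the
first `n - i` coefficients of `u` influence the `n`-jet. -/
lemma arcSeries_congr {i : Fin n} {c : Fin n × Fin d → ℂ} (hc : ∀ m < i, ∀ j', c (m, j') = 0)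
    {u u' : ℂ⟦X⟧} (h : (X : ℂ⟦X⟧) ^ (n - i) ∣ u - u') (j : Fin d) :
    (X : ℂ⟦X⟧) ^ (n + 1) ∣ arcSeries c j (X * u) - arcSeries c j (X * u') := by
  rw [arcSeries, arcSeries, ← Finset.sum_sub_distrib]
  refine Finset.dvd_sum fun m _ => ?_
  by_cases hm : m < i
  · simp [hc m hm]
  · have hm' : i.1 ≤ m.1 := not_lt.1 hm
    rw [← mul_sub, mul_pow, mul_pow, ← mul_sub]
    refine Dvd.dvd.mul_left ?_ _
    refine (pow_dvd_pow _ (by omega : n + 1 ≤ (m.1 + 1) + (n - i))).trans ?_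
    rw [pow_add]
    exact mul_dvd_mul_left _ (h.trans (sub_dvd_pow_sub_pow _ _ _))

/-- Uniqueness of normal forms. -/
lemma IsNormal.unique {i : Fin n} {j : Fin d} {c c' : Fin n × Fin d → ℂ} (hc : IsNormal i j c)
    (hc' : IsNormal i j c') {u u' : ℂ⟦X⟧} (hu : constantCoeff u = 1) (hu' : constantCoeff u' = 1)
    (h : ∀ j', (X : ℂ⟦X⟧) ^ (n + 1) ∣ arcSeries c j' (X * u) - arcSeries c' j' (X * u')) :
    c = c' ∧ (X : ℂ⟦X⟧) ^ (n - i) ∣ u - u' := by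
  have ha : c (i, j) = c' (i, j) := by
    have h1 := X_pow_dvd_iff.1 (h j) (i.1 + 1) (by omega)
    rw [map_sub, coeff_arcSeries c j u i fun m hm => hc.low m hm j,
      coeff_arcSeries c' j u' i fun m hm => hc'.low m hm j, hu, hu', sub_eq_zero] at h1
    simpa using h1
  -- Component `j` is the same monomial on both sides; cancelling its coefficient and `X ^ (i + 1)`
  -- leaves a congruence of `(i+1)`-st powers, and roots with constant term `1` are unique.
  have h2 : (X : ℂ⟦X⟧) ^ (n - i) ∣ u - u' := by
    have h1 := h j
    rw [hc.arcSeries_eq, hc'.arcSeries_eq, ← ha, ← mul_sub, mul_pow, mul_pow, ← mul_sub,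
      ((isUnit_iff_ne_zero.2 hc.lead).map C).dvd_mul_left,
      (by rw [← pow_add]; congr 1; omega : (X : ℂ⟦X⟧) ^ (n + 1) = X ^ (i.1 + 1) * X ^ (n - i)),
      mul_dvd_mul_iff_left (pow_ne_zero _ X_ne_zero)] at h1
    exact dvd_sub_of_dvd_pow_sub_pow hu hu' (by omega) h1
  refine ⟨?_, h2⟩
  -- With `u'` replaced by `u`, both jets are expanded in the same parameter, and triangularity
  -- forces equal coefficients.
  have h3 : ∀ j', (X : ℂ⟦X⟧) ^ (n + 1) ∣ arcSeries (c - c') j' (X * u) := fun j' => by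
    rw [← arcSeries_sub]
    have := dvd_sub (h j') (arcSeries_congr hc'.low h2 j')
    convert this using 1
    ring
  funext ⟨m, j'⟩
  have := coeff_eq_zero_of_dvd_arcSeries hu (h3 j') m (by omega)
  simpa [sub_eq_zero] using this

lemma subst_arcSeries {h : ℂ⟦X⟧} (hh : constantCoeff h = 0) (c : Fin n × Fin d → ℂ) (j : Fin d)
    (g : ℂ⟦X⟧) : subst h (arcSeries c j g) = arcSeries c j (subst h g) := by
  have hs := HasSubst.of_constantCoeff_zero' hh
  have hC : ∀ a : ℂ, substAlgHom (R := ℂ) hs (C a) = C a := fun a =>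
    (substAlgHom (R := ℂ) hs).commutes a
  rw [← coe_substAlgHom hs]
  simp [arcSeries, hC]

lemma dvd_subst {h : ℂ⟦X⟧} (hh : constantCoeff h = 0) {f : ℂ⟦X⟧} {N : ℕ}
    (hf : (X : ℂ⟦X⟧) ^ N ∣ f) : (X : ℂ⟦X⟧) ^ N ∣ subst h f := by
  have hs := HasSubst.of_constantCoeff_zero' hh
  obtain ⟨q, rfl⟩ := hf
  rw [subst_mul hs, subst_pow hs, subst_X hs]
  exact (pow_dvd_pow_of_dvd (X_dvd_iff.2 hh) N).mul_right _

lemma constantCoeff_subst_of_zero {h : ℂ⟦X⟧} (hh : constantCoeff h = 0) (f : ℂ⟦X⟧) :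
    constantCoeff (subst h f) = constantCoeff f := by
  have hs := HasSubst.of_constantCoeff_zero' hh
  have h1 : (X : ℂ⟦X⟧) ^ 1 ∣ f - C (constantCoeff f) := by simp [X_dvd_iff]
  have h2 := dvd_subst hh h1
  have hC : substAlgHom (R := ℂ) hs (C (constantCoeff f)) = C (constantCoeff f) :=
    (substAlgHom (R := ℂ) hs).commutes _
  rw [subst_sub hs, ← coe_substAlgHom hs, hC, pow_one, X_dvd_iff, map_sub, sub_eq_zero] at h2
  rw [← coe_substAlgHom hs]
  simpa using h2

/-- Coordinate changes rescale normal forms. -/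
lemma IsNormal.rescale {i : Fin n} {j : Fin d} {x x' c c' : Fin n × Fin d → ℂ} {u u' v : ℂ⟦X⟧}
    (hc : IsNormal i j c) (hc' : IsNormal i j c') (hu : constantCoeff u = 1)
    (hu' : constantCoeff u' = 1) (hv : constantCoeff v ≠ 0)
    (hx : ∀ j', (X : ℂ⟦X⟧) ^ (n + 1) ∣ arcSeries x j' X - arcSeries c j' (X * u))
    (hx' : ∀ j', (X : ℂ⟦X⟧) ^ (n + 1) ∣ arcSeries x' j' X - arcSeries c' j' (X * u'))
    (h : ∀ j', (X : ℂ⟦X⟧) ^ (n + 1) ∣ arcSeries x j' X - arcSeries x' j' (X * v)) (m : Fin n)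
    (j' : Fin d) : c (m, j') = constantCoeff v ^ (m.1 + 1) * c' (m, j') := by
  have hh : constantCoeff (X * v) = 0 := by simp
  have hs := HasSubst.of_constantCoeff_zero' hh
  set a := constantCoeff v
  -- Composing the normal form of `x'` with `X * v` gives the parameter `a * X * w`. The constant
  -- `a` is absorbed into the coefficients, and `w` has constant term `1`, so uniqueness of normal
  -- forms applies.
  set w := C a⁻¹ * (v * subst (X * v) u') with hw
  have hw1 : constantCoeff w = 1 := by
    simp only [hw, map_mul, constantCoeff_C, constantCoeff_subst_of_zero hh, hu', mul_one]
    exact inv_mul_cancel₀ hv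
  have hnorm : IsNormal i j fun p => a ^ (p.1.1 + 1) * c' p :=
    ⟨fun m hm j' => by simp [hc'.low m hm j'], mul_ne_zero (pow_ne_zero _ hv) hc'.lead,
      fun m hm => by simp [hc'.rest m hm]⟩
  have key := (hc.unique hnorm hu hw1 fun j' => ?_).1
  · exact congrFun key (m, j')
  · have h1 := dvd_subst hh (hx' j')
    rw [subst_sub hs, subst_arcSeries hh, subst_arcSeries hh, subst_X hs, subst_mul hs,
      subst_X hs] at h1
    have h2 := dvd_sub (dvd_add (h j') h1) (hx j')
    convert h2 using 1
    have : arcSeries (fun p => a ^ (p.1.1 + 1) * c' p) j' (X * w) =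
        arcSeries c' j' (X * v * subst (X * v) u') := by
      refine Finset.sum_congr rfl fun m _ => ?_
      have e : C a * C a⁻¹ = (1 : ℂ⟦X⟧) := by rw [← map_mul, mul_inv_cancel₀ hv, map_one]
      simp only [hw, map_mul, map_pow]
      rw [show C a ^ (m.1 + 1) * C (c' (m, j')) * (X * (C a⁻¹ * (v * subst (X * v) u'))) ^ (m.1 + 1)
        = C (c' (m, j')) * (C a * C a⁻¹ * (X * v * subst (X * v) u')) ^ (m.1 + 1) by ring, e, one_mul]
    rw [this]
    ring

end Series

/-! ### Normal forms and orbits of jets under coordinate changes -/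

section Jets

open PowerSeries

variable {d n : ℕ}

/-- The coordinates of a jet. -/
def Jet.coords (x : Jet d n) : Fin n × Fin d → ℂ := AffinePoint.coord x

lemma dvd_sub_arcSeries_jet (φ : Arc d) (j : Fin d) :
    (X : ℂ⟦X⟧) ^ (n + 1) ∣ φ.1 j - arcSeries (Jet.coords (jet n φ)) j X := by
  rw [X_pow_dvd_iff_fin (by
    rw [map_sub, (φ.2 j).1, constantCoeff_arcSeries _ _ constantCoeff_X, sub_zero])]
  intro m
  rw [map_sub, coeff_arcSeries_X, sub_eq_zero]
  rfl

lemma jet_eq_of_dvd {φ : Arc d} {x : Jet d n}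
    (h : ∀ j, (X : ℂ⟦X⟧) ^ (n + 1) ∣ φ.1 j - arcSeries x.coords j X) : jet n φ = x := by
  refine AffinePoint.ext (funext fun p => ?_)
  have h1 := X_pow_dvd_iff.1 (h p.2) (p.1.1 + 1) (by omega)
  rw [map_sub, coeff_arcSeries_X, sub_eq_zero] at h1
  exact h1

lemma isConvergent_coe (p : Polynomial ℂ) : IsConvergent (p : ℂ⟦X⟧) := by
  refine ⟨1, one_pos, summable_of_ne_finset_zero (s := p.support) fun n hn => ?_⟩
  simp [Polynomial.notMem_support_iff.1 hn]

lemma arcSeries_coe (c : Fin n × Fin d → ℂ) (j : Fin d) (p : Polynomial ℂ) :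
    ∃ q : Polynomial ℂ, arcSeries c j (p : ℂ⟦X⟧) = q :=
  ⟨∑ m : Fin n, Polynomial.C (c (m, j)) * p ^ (m.1 + 1), by
    rw [← Polynomial.coeToPowerSeries.ringHom_apply, ← Polynomial.coeToPowerSeries.ringHom_apply,
      map_sum]
    simp [arcSeries]⟩

/-- The polynomial arc `∑ c_(m,j) p^(m+1)`. -/
noncomputable def polyArc (c : Fin n × Fin d → ℂ) (p : Polynomial ℂ) (hp : constantCoeff (p : ℂ⟦X⟧) = 0) :
    Arc d :=
  ⟨fun j => arcSeries c j (p : ℂ⟦X⟧), fun j => ⟨constantCoeff_arcSeries _ _ hp, by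
    obtain ⟨q, hq⟩ := arcSeries_coe c j p
    exact (congrArg IsConvergent hq).mpr (isConvergent_coe q)⟩⟩

lemma jet_surjective (d n : ℕ) : Function.Surjective (jet (d := d) n) := fun x =>
  ⟨polyArc x.coords Polynomial.X (by simp), jet_eq_of_dvd fun j => by
    simp [polyArc]⟩

/-- Composition with a coordinate change `X * v` respects congruence modulo `X ^ (n + 1)`, so the
arcs can be replaced by their truncations. -/
lemma JetRel.exists_series {x x' : Jet d n} (h : JetRel d n x x') :
    ∃ v : ℂ⟦X⟧, constantCoeff v ≠ 0 ∧ ∀ j, (X : ℂ⟦X⟧) ^ (n + 1) ∣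
      arcSeries x.coords j X - arcSeries x'.coords j (X * v) := by
  obtain ⟨⟨h, h0, h1, hc⟩, φ, φ', hφ, rfl, rfl⟩ := h
  obtain ⟨v, rfl⟩ := X_dvd_iff.2 h0
  refine ⟨v, ?_, fun j => ?_⟩
  · rwa [← zero_add 1, coeff_succ_X_mul, coeff_zero_eq_constantCoeff_apply] at h1
  · have hs := HasSubst.of_constantCoeff_zero' h0
    have h2 := dvd_subst h0 (dvd_sub_arcSeries_jet (n := n) φ' j)
    rw [subst_sub hs, subst_arcSeries h0, subst_X hs, ← hφ j] at h2
    convert dvd_sub h2 (dvd_sub_arcSeries_jet (n := n) φ j) using 1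
    ring

/-- A polynomial parameter change applied to polynomial arcs realizes the congruence, and
convergence is then automatic. -/
lemma jetRel_of_dvd {x c : Jet d n} {p : Polynomial ℂ} (hp : constantCoeff (p : ℂ⟦X⟧) ≠ 0)
    (h : ∀ j, (X : ℂ⟦X⟧) ^ (n + 1) ∣ arcSeries x.coords j X -
      arcSeries c.coords j (X * (p : ℂ⟦X⟧))) : JetRel d n x c := by
  have hXp : ((Polynomial.X * p : Polynomial ℂ) : ℂ⟦X⟧) = X * (p : ℂ⟦X⟧) := by simp
  have h0 : constantCoeff (X * (p : ℂ⟦X⟧)) = 0 := by simp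
  have hs := HasSubst.of_constantCoeff_zero' h0
  refine ⟨⟨((Polynomial.X * p : Polynomial ℂ) : ℂ⟦X⟧), by rw [hXp, h0], ?_, isConvergent_coe _⟩,
    polyArc c.coords (Polynomial.X * p) (by rw [hXp, h0]), polyArc c.coords Polynomial.X (by simp),
    fun j => ?_, jet_eq_of_dvd fun j => ?_, jet_eq_of_dvd fun j => by simp [polyArc]⟩
  · rwa [hXp, ← zero_add 1, coeff_succ_X_mul, coeff_zero_eq_constantCoeff_apply]
  · simp only [polyArc, hXp]
    rw [subst_arcSeries h0, Polynomial.coe_X, subst_X hs]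
  · simp only [polyArc, hXp]
    exact (dvd_sub_comm).1 (h j)

lemma unipotent_coe {r : ℕ} (b : Fin r → ℂ) : ∃ p : Polynomial ℂ, unipotent b = (p : ℂ⟦X⟧) :=
  ⟨1 + ∑ s : Fin r, Polynomial.C (b s) * Polynomial.X ^ (s.1 + 1), by
    rw [← Polynomial.coeToPowerSeries.ringHom_apply, map_add, map_sum]
    simp [unipotent]⟩

/-- The evaluation of regular functions at a point of their domain. -/
def evalHom {X : FunSpace} {T : Set X.carrier} (x : X.carrier) : X.regOn T →+* ℂ :=
  (Pi.evalRingHom (fun _ => ℂ) x).comp (X.regOn T).val.toRingHom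

lemma evalHom_apply {X : FunSpace} {T : Set X.carrier} (x : X.carrier) (f : X.regOn T) :
    evalHom x f = f.1 x := rfl

/-- The jet `∑ c_m h^m` with `h = X (1 + b_0 X + ⋯)`. -/
noncomputable def jetOf {r : ℕ} (c : Fin n × Fin d → ℂ) (b : Fin r → ℂ) : Jet d n :=
  AffinePoint.mk fun p => coeff (p.1.1 + 1) (arcSeries c p.2 (X * unipotent b))

lemma dvd_sub_jetOf {r : ℕ} (c : Fin n × Fin d → ℂ) (b : Fin r → ℂ) (j : Fin d) :
    (X : ℂ⟦X⟧) ^ (n + 1) ∣ arcSeries (jetOf c b).coords j X - arcSeries c j (X * unipotent b) := by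
  rw [X_pow_dvd_iff_fin (by
    rw [map_sub, constantCoeff_arcSeries _ _ constantCoeff_X,
      constantCoeff_arcSeries _ _ (by simp), sub_zero])]
  intro m
  rw [map_sub, coeff_arcSeries_X, sub_eq_zero]
  rfl

lemma eq_jetOf {r : ℕ} {x : Jet d n} {c : Fin n × Fin d → ℂ} {b : Fin r → ℂ}
    (h : ∀ j, (X : ℂ⟦X⟧) ^ (n + 1) ∣ arcSeries x.coords j X - arcSeries c j (X * unipotent b)) :
    x = jetOf c b := by
  refine AffinePoint.ext (funext fun p => ?_)
  have h1 := X_pow_dvd_iff.1 (h p.2) (p.1.1 + 1) (by omega)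
  rw [map_sub, coeff_arcSeries_X, sub_eq_zero] at h1
  exact h1

/-- The coefficients can be computed over the ring of functions regular at `x`; evaluation at a
point is a ring homomorphism and commutes with this. -/
lemma regAt_jetOf {X : FunSpace} {x : X.carrier} {r : ℕ} {c : Fin n × Fin d → X.carrier → ℂ}
    {b : Fin r → X.carrier → ℂ} (hc : ∀ p, X.regAt (c p) x) (hb : ∀ s, X.regAt (b s) x)
    (p : Fin n × Fin d) :
    X.regAt (fun y => (jetOf (fun p => c p y) (fun s => b s y)).coords p) x := by
  let c' : Fin n × Fin d → X.regOn {x} := fun p => ⟨c p, by rintro _ rfl; exact hc p⟩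
  let b' : Fin r → X.regOn {x} := fun s => ⟨b s, by rintro _ rfl; exact hb s⟩
  have h := (coeff (p.1.1 + 1) (arcSeries c' p.2 (PowerSeries.X * unipotent b'))).2 x rfl
  convert h using 1
  funext y
  rw [← evalHom_apply y, ← coeff_map, map_arcSeries, map_mul, map_X, map_unipotent]
  rfl

lemma dvd_sub_leading {x : Fin n × Fin d → ℂ} {i : Fin n} {j : Fin d} {r : ℕ}
    (hr : r + (i.1 + 1) = n) (hx : ∀ m < i, x (m, j) = 0) (hxa : x (i, j) ≠ 0) :
    (X : ℂ⟦X⟧) ^ (n + 1) ∣ arcSeries x j X - C (x (i, j)) * (X ^ (i.1 + 1) *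
      unipotent fun s : Fin r => (x (i, j))⁻¹ * x (⟨i.1 + 1 + s.1, by omega⟩, j)) := by
  rw [X_pow_dvd_iff_fin (by rw [map_sub, constantCoeff_arcSeries _ _ constantCoeff_X]; simp)]
  intro m
  rw [map_sub, coeff_arcSeries_X, coeff_C_mul, coeff_X_pow_mul', sub_eq_zero]
  split_ifs with h
  · obtain ⟨s, hs⟩ := Nat.exists_eq_add_of_le h
    have hs' : m.1 + 1 - (i.1 + 1) = s := by omega
    rw [hs']
    rcases s with _ | s
    · have : m = i := Fin.ext (by omega)
      rw [coeff_zero_eq_constantCoeff_apply, constantCoeff_unipotent, this, mul_one]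
    · have := coeff_unipotent (fun s : Fin r => (x (i, j))⁻¹ *
        x (⟨i.1 + 1 + s.1, by omega⟩, j)) ⟨s, by omega⟩
      rw [this, mul_inv_cancel_left₀ hxa]
      congr 2
      exact Fin.ext (by simp only; omega)
  · rw [mul_zero]
    exact hx m (by rw [Fin.lt_def]; omega)

/-- Expansions in powers of `X * u` are unique by triangularity, so the order of the jet and the
monomial shape of component `j` can be read off from `c`. -/
lemma isNormal_of_dvd {x c : Fin n × Fin d → ℂ} {i : Fin n} {j : Fin d} {u : ℂ⟦X⟧}
    (hu : constantCoeff u = 1) (hx : ∀ m < i, ∀ j', x (m, j') = 0) (hxa : x (i, j) ≠ 0)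
    (h : ∀ j', (X : ℂ⟦X⟧) ^ (n + 1) ∣ arcSeries x j' X - arcSeries c j' (X * u))
    (hj : (X : ℂ⟦X⟧) ^ (n + 1) ∣ arcSeries x j X - C (x (i, j)) * (X * u) ^ (i.1 + 1)) :
    IsNormal i j c := by
  have hlow : ∀ m < i, ∀ j', c (m, j') = 0 := by
    intro m hm j'
    refine coeff_eq_zero_of_dvd_arcSeries (N := i.1 + 1) hu ?_ m (by
      have : m.1 < i.1 := hm
      omega)
    have h1 : (X : ℂ⟦X⟧) ^ (i.1 + 1) ∣ arcSeries x j' X := by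
      refine Finset.dvd_sum fun l _ => ?_
      by_cases hl : l < i
      · simp [hx l hl j']
      · have : i.1 ≤ l.1 := not_lt.1 hl
        exact (pow_dvd_pow _ (by omega)).mul_left _
    have h2 := dvd_sub h1 ((pow_dvd_pow _ (by omega)).trans (h j'))
    rwa [sub_sub_cancel] at h2
  have hcj : ∀ m, c (m, j) = if m = i then x (i, j) else 0 := by
    intro m
    have h1 : arcSeries (fun p : Fin n × Fin d => if p.1 = i then x (i, j) else 0) j (X * u) =
        C (x (i, j)) * (X * u) ^ (i.1 + 1) := by
      rw [arcSeries, Finset.sum_eq_single i]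
      · simp
      · intro l _ hl
        simp [hl]
      · simp
    have h2 := dvd_sub (h j) hj
    rw [← h1, sub_sub_sub_cancel_left, arcSeries_sub] at h2
    have := coeff_eq_zero_of_dvd_arcSeries hu h2 m (by omega)
    rw [Pi.sub_apply, sub_eq_zero] at this
    exact this.symm
  refine ⟨hlow, ?_, fun m hm => ?_⟩
  · rwa [hcj, if_pos rfl]
  · rw [hcj, if_neg hm]

/-- Normal forms over a ring `A`, in a form that is compatible with homomorphisms to `ℂ`. -/
lemma exists_normal_form_ring {A : Type*} [CommRing A] [Algebra ℂ A] (i : Fin n) (j : Fin d)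
    {r : ℕ} (xs : Fin n × Fin d → A) (ainv : A) (hr : r + (i.1 + 1) = n) :
    ∃ (c : Fin n × Fin d → A) (b : Fin r → A), ∀ e : A →+* ℂ,
      (∀ m < i, ∀ j', e (xs (m, j')) = 0) → e (xs (i, j)) ≠ 0 → e ainv = (e (xs (i, j)))⁻¹ →
      IsNormal i j (fun p => e (c p)) ∧ ∀ j', (X : ℂ⟦X⟧) ^ (n + 1) ∣
        arcSeries (fun p => e (xs p)) j' X -
        arcSeries (fun p => e (c p)) j' (X * unipotent fun s => e (b s)) := by
  -- Component `j` divided by its leading term; its `(i+1)`-st root is the parameter in which this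
  -- component becomes a monomial.
  let F : A⟦X⟧ := unipotent fun s : Fin r => ainv * xs (⟨i.1 + 1 + s.1, by omega⟩, j)
  have hunit : IsUnit ((i.1 + 1 : ℕ) : A) := by
    have h1 : IsUnit ((i.1 + 1 : ℕ) : ℂ) := (Nat.cast_ne_zero.2 (Nat.succ_ne_zero _)).isUnit
    simpa using h1.map (algebraMap ℂ A)
  obtain ⟨u, hu, hFu⟩ := exists_root_of_constantCoeff_one F (constantCoeff_unipotent _) hunit r
  let b : Fin r → A := fun s => coeff (s.1 + 1) u
  have hFb : (X : A⟦X⟧) ^ (r + 1) ∣ F - unipotent b ^ (i.1 + 1) := by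
    have := dvd_add hFu ((dvd_sub_unipotent hu r).trans (sub_dvd_pow_sub_pow _ _ (i.1 + 1)))
    convert this using 1
    ring
  have hexp : ∀ j' : Fin d, ∃ c : ℕ → A, (X : A⟦X⟧) ^ (n + 1) ∣ arcSeries xs j' X -
      ∑ m ∈ Finset.range n, C (c m) * (X * unipotent b) ^ (m + 1) := fun j' =>
    exists_expansion _ _ (constantCoeff_arcSeries _ _ constantCoeff_X) (constantCoeff_unipotent _) n
  choose c hc using hexp
  refine ⟨fun p => c p.2 p.1, b, fun e hlow hlead hinv => ?_⟩
  have hdvd : ∀ j', (X : ℂ⟦X⟧) ^ (n + 1) ∣ arcSeries (fun p => e (xs p)) j' X -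
      arcSeries (fun p : Fin n × Fin d => e (c p.2 p.1)) j' (X * unipotent fun s => e (b s)) := by
    intro j'
    have h1 := map_dvd (PowerSeries.map e) (hc j')
    rw [map_pow, map_X, map_sub, map_arcSeries, map_X, Finset.sum_range, map_sum] at h1
    simp only [map_mul, map_pow, map_X, map_unipotent, map_C] at h1
    exact h1
  refine ⟨isNormal_of_dvd (constantCoeff_unipotent _) hlow hlead hdvd ?_, hdvd⟩
  have h1 := map_dvd (PowerSeries.map e) hFb
  rw [map_pow, map_X, map_sub, map_pow, map_unipotent, map_unipotent] at h1
  simp only [map_mul, hinv] at h1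
  have h2 := dvd_sub_leading (x := fun p => e (xs p)) hr (fun m hm => hlow m hm j) hlead
  have h3 := (mul_dvd_mul_left (X ^ (i.1 + 1)) h1).mul_left (C (e (xs (i, j))))
  rw [← pow_add, show i.1 + 1 + (r + 1) = n + 1 by omega] at h3
  convert dvd_add h2 h3 using 1
  ring

/-- Normal forms exist and depend regularly on the jet. -/
lemma exists_normal_form (i : Fin n) (j : Fin d) {r : ℕ} (hr : r + (i.1 + 1) = n) :
    ∃ (c : Fin n × Fin d → Jet d n → ℂ) (b : Fin r → Jet d n → ℂ),
      (∀ p, ∀ x : Jet d n, x.coords (i, j) ≠ 0 → (jetSpace d n).regAt (c p) x) ∧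
      (∀ s, ∀ x : Jet d n, x.coords (i, j) ≠ 0 → (jetSpace d n).regAt (b s) x) ∧
      ∀ x ∈ orderStratum d n i, x.coords (i, j) ≠ 0 →
        IsNormal i j (fun p => c p x) ∧ x = jetOf (fun p => c p x) (fun s => b s x) := by
  let T : Set (Jet d n) := {x | x.coords (i, j) ≠ 0}
  -- The construction is carried out once, over the ring of functions regular where the leading
  -- coefficient is invertible. Evaluating at points gives the individual normal forms, and
  -- regularity is built in.
  obtain ⟨c, b, h⟩ := exists_normal_form_ring (A := (jetSpace d n).regOn T) i j
    (fun p => ⟨fun y : Jet d n => y.coords p, fun y _ => affineSpace_regAt_coord p y⟩)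
    ⟨fun y : Jet d n => (y.coords (i, j))⁻¹, fun y hy =>
      FunSpace.inv' _ _ _ (affineSpace_regAt_coord (i, j) y) hy⟩ hr
  refine ⟨fun p => (c p).1, fun s => (b s).1, fun p x hx => (c p).2 x hx,
    fun s x hx => (b s).2 x hx, fun x hx hxa => ?_⟩
  obtain ⟨h1, h2⟩ := h (evalHom x) hx.1 hxa rfl
  exact ⟨h1, eq_jetOf h2⟩

/-- Coordinate changes rescale the lowest coefficients. -/
lemma JetRel.exists_scale {x x' : Jet d n} (h : JetRel d n x x') {i : Fin n}
    (hx' : x' ∈ orderStratum d n i) : ∃ a : ℂ, a ≠ 0 ∧ ∀ j, x.coords (i, j) = a * x'.coords (i, j) := by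
  obtain ⟨v, hv, h⟩ := h.exists_series
  refine ⟨constantCoeff v ^ (i.1 + 1), pow_ne_zero _ hv, fun j => ?_⟩
  have h1 := X_pow_dvd_iff.1 (h j) (i.1 + 1) (by omega)
  rw [map_sub, coeff_arcSeries_X, coeff_arcSeries x'.coords j v i fun m hm => hx'.1 m hm j,
    sub_eq_zero] at h1
  rw [h1, mul_comm]

/-- The lowest coefficients of a jet and of its normal form agree. -/
lemma coords_jetOf {r : ℕ} {c : Fin n × Fin d → ℂ} {i : Fin n} (hc : ∀ m < i, ∀ j, c (m, j) = 0)
    (b : Fin r → ℂ) (j : Fin d) : (jetOf c b).coords (i, j) = c (i, j) := by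
  have := coeff_arcSeries c j (unipotent b) i fun m hm => hc m hm j
  rw [constantCoeff_unipotent, one_pow, mul_one] at this
  exact this

lemma jetOf_mem_orderStratum {r : ℕ} {c : Fin n × Fin d → ℂ} {i : Fin n} {j : Fin d}
    (hc : IsNormal i j c) (b : Fin r → ℂ) : jetOf c b ∈ orderStratum d n i := by
  refine ⟨fun l hl j' => ?_, j, ?_⟩
  · have := coords_jetOf (i := l) (fun m hm j => hc.low m (hm.trans hl) j) b j'
    rw [hc.low l hl] at this
    exact this
  · have := coords_jetOf hc.low b j
    exact fun h => hc.lead (this.symm.trans h)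

lemma jetRel_jetOf {r : ℕ} (c : Fin n × Fin d → ℂ) (b : Fin r → ℂ) :
    JetRel d n (jetOf c b) (AffinePoint.mk c) := by
  obtain ⟨p, hp⟩ := unipotent_coe b
  refine jetRel_of_dvd (p := p) (by rw [← hp, constantCoeff_unipotent]; exact one_ne_zero) ?_
  rw [← hp]
  exact dvd_sub_jetOf c b

/-- Multiplication of the parameter by a constant. -/
lemma jetRel_scale {c c' : Fin n × Fin d → ℂ} {a : ℂ} (ha : a ≠ 0)
    (h : ∀ p, c p = a ^ (p.1.1 + 1) * c' p) : JetRel d n (AffinePoint.mk c) (AffinePoint.mk c') := by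
  refine jetRel_of_dvd (p := Polynomial.C a) (by simpa using ha) fun j => ?_
  refine (dvd_zero _).trans (dvd_of_eq (sub_eq_zero.2 ?_).symm)
  refine Finset.sum_congr rfl fun m _ => ?_
  change C (c (m, j)) * _ = C (c' (m, j)) * _
  rw [h, mul_pow, Polynomial.coe_C, map_mul, map_pow]
  ring

lemma JetRel.normal_scale {x x' : Jet d n} (h : JetRel d n x x') {i : Fin n} {j : Fin d} {r : ℕ}
    {c c' : Fin n × Fin d → ℂ} (hc : IsNormal i j c) (hc' : IsNormal i j c') {b b' : Fin r → ℂ}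
    (hx : x = jetOf c b) (hx' : x' = jetOf c' b') :
    ∃ a : ℂ, a ≠ 0 ∧ ∀ p, c p = a ^ (p.1.1 + 1) * c' p := by
  obtain ⟨v, hv, h⟩ := h.exists_series
  exact ⟨_, hv, fun p => hc.rescale hc' (constantCoeff_unipotent b) (constantCoeff_unipotent b') hv
    (fun j' => hx ▸ dvd_sub_jetOf c b j') (fun j' => hx' ▸ dvd_sub_jetOf c' b' j') h p.1 p.2⟩

/-- The parameter is determined modulo `X ^ (n - i)`, and `n - i = r + 1` is just enough to see all
`r` entries of `b`. -/
lemma jetOf_injective {i : Fin n} {j : Fin d} {r : ℕ} (hr : r + (i.1 + 1) = n)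
    {c c' : Fin n × Fin d → ℂ} (hc : IsNormal i j c) (hc' : IsNormal i j c') {b b' : Fin r → ℂ}
    (h : jetOf c b = jetOf c' b') : c = c' ∧ b = b' := by
  obtain ⟨h1, h2⟩ := hc.unique hc' (constantCoeff_unipotent b) (constantCoeff_unipotent b')
    fun j' => by
      have h1 := dvd_sub_jetOf c b j'
      have h2 := dvd_sub_jetOf c' b' j'
      rw [← h] at h2
      convert dvd_sub h2 h1 using 1
      ring
  refine ⟨h1, unipotent_injective ?_⟩
  rwa [show n - i.1 = r + 1 by omega] at h2

end Jets

/-! ### Monomials and the weighted action of `ℂ*` -/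

section Monomials

variable {ι : Type} (F : Finset ι) (v : ι → ℤ) (e : ι → ℕ)

/-- Bézout's identity for positive weights. -/
lemma exists_bezout {F : Finset ι} (hF : F.Nonempty) (w : ι → ℕ) (hw : ∀ f, w f ≠ 0) :
    ∃ (g : ℕ) (e : ι → ℕ) (v : ι → ℤ), g ≠ 0 ∧ (∀ f ∈ F, e f * g = w f) ∧
      ∑ f ∈ F, (e f : ℤ) * v f = 1 := by
  obtain ⟨a, ha⟩ := Finset.gcd_eq_sum_mul F (fun f => (w f : ℤ))
  set G := F.gcd fun f => (w f : ℤ)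
  have hdvd : ∀ f ∈ F, G ∣ (w f : ℤ) := fun f hf => Finset.gcd_dvd hf
  have hG : G ≠ 0 := by
    obtain ⟨f, hf⟩ := hF
    intro h
    have := hdvd f hf
    rw [h, zero_dvd_iff] at this
    exact hw f (by exact_mod_cast this)
  have hGn : (G.natAbs : ℤ) = G := by
    have := Finset.normalize_gcd (s := F) (f := fun f => (w f : ℤ))
    rw [Int.natCast_natAbs, Int.abs_eq_normalize]
    exact this
  have he : ∀ f ∈ F, w f / G.natAbs * G.natAbs = w f := fun f hf =>
    Nat.div_mul_cancel (Int.natAbs_dvd_natAbs.2 (hdvd f hf))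
  refine ⟨G.natAbs, fun f => w f / G.natAbs, a, Int.natAbs_ne_zero.2 hG, he, ?_⟩
  apply mul_left_cancel₀ hG
  rw [mul_one, Finset.mul_sum]
  refine Eq.trans (Finset.sum_congr rfl fun f hf => ?_) ha.symm
  have h : ((w f / G.natAbs : ℕ) : ℤ) * (G.natAbs : ℤ) = w f := by rw [← Nat.cast_mul, he f hf]
  rw [hGn] at h
  rw [← h]
  ring

/-- A Laurent monomial. -/
noncomputable def monomialAt (y : ι → ℂ) : ℂ := ∏ f ∈ F, y f ^ v f

open Classical in
/-- The representative with `monomialAt = 1` of an orbit of the weighted action of `ℂ*`. -/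
noncomputable def torusSection (y : ι → ℂ) (f : ι) : ℂ :=
  if f ∈ F then y f * monomialAt F v y ^ (-(e f : ℤ)) else 0

variable {F v e}

lemma monomialAt_ne_zero {y : ι → ℂ} (h : ∀ f ∈ F, y f ≠ 0) : monomialAt F v y ≠ 0 :=
  Finset.prod_ne_zero_iff.2 fun f hf => zpow_ne_zero _ (h f hf)

lemma prod_zpow_eq_zpow_sum {t : ℂ} (ht : t ≠ 0) (s : Finset ι) (a : ι → ℤ) :
    ∏ f ∈ s, t ^ a f = t ^ ∑ f ∈ s, a f := by
  classical
  induction s using Finset.induction_on with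
  | empty => simp
  | insert b s hb ih => rw [Finset.prod_insert hb, Finset.sum_insert hb, zpow_add₀ ht, ih]

/-- Bézout's identity says that the monomial has weight one, so it serves as a coordinate along the
orbits. -/
lemma monomialAt_scale (hev : ∑ f ∈ F, (e f : ℤ) * v f = 1) {t : ℂ} (ht : t ≠ 0) {y y' : ι → ℂ}
    (h : ∀ f ∈ F, y' f = t ^ (e f) * y f) : monomialAt F v y' = t * monomialAt F v y := by
  have : ∀ f ∈ F, y' f ^ v f = t ^ ((e f : ℤ) * v f) * y f ^ v f := fun f hf => by
    rw [h f hf, mul_zpow, zpow_mul, zpow_natCast]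
  rw [monomialAt, Finset.prod_congr rfl this, Finset.prod_mul_distrib, monomialAt]
  congr 1
  rw [prod_zpow_eq_zpow_sum ht, hev, zpow_one]

lemma torusSection_of_mem {y : ι → ℂ} {f : ι} (hf : f ∈ F) :
    torusSection F v e y f = (monomialAt F v y)⁻¹ ^ e f * y f := by
  rw [torusSection, if_pos hf, zpow_neg, zpow_natCast, inv_pow, mul_comm]

lemma torusSection_of_notMem {y : ι → ℂ} {f : ι} (hf : f ∉ F) : torusSection F v e y f = 0 := by
  rw [torusSection, if_neg hf]

lemma monomialAt_torusSection (hev : ∑ f ∈ F, (e f : ℤ) * v f = 1) {y : ι → ℂ}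
    (h : ∀ f ∈ F, y f ≠ 0) : monomialAt F v (torusSection F v e y) = 1 := by
  rw [monomialAt_scale hev (inv_ne_zero (monomialAt_ne_zero h))
    (fun f hf => torusSection_of_mem hf), inv_mul_cancel₀ (monomialAt_ne_zero h)]

lemma torusSection_scale (hev : ∑ f ∈ F, (e f : ℤ) * v f = 1) {t : ℂ} (ht : t ≠ 0) {y y' : ι → ℂ}
    (h : ∀ f ∈ F, y' f = t ^ (e f) * y f) : torusSection F v e y' = torusSection F v e y := by
  funext f
  by_cases hf : f ∈ F
  · rw [torusSection_of_mem hf, torusSection_of_mem hf, monomialAt_scale hev ht h, h f hf]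
    rw [mul_inv, mul_pow, inv_pow]
    field_simp
  · rw [torusSection_of_notMem hf, torusSection_of_notMem hf]

lemma torusSection_eq_self {y : ι → ℂ} (h : monomialAt F v y = 1) (h0 : ∀ f ∉ F, y f = 0) :
    torusSection F v e y = y := by
  funext f
  by_cases hf : f ∈ F
  · rw [torusSection_of_mem hf, h]
    simp
  · rw [torusSection_of_notMem hf, h0 f hf]

lemma mul_torusSection {y : ι → ℂ} (h : ∀ f ∈ F, y f ≠ 0) (h0 : ∀ f ∉ F, y f = 0) (f : ι) :
    monomialAt F v y ^ e f * torusSection F v e y f = y f := by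
  by_cases hf : f ∈ F
  · rw [torusSection_of_mem hf, ← mul_assoc, ← mul_pow, mul_inv_cancel₀ (monomialAt_ne_zero h),
      one_pow, one_mul]
  · rw [torusSection_of_notMem hf, h0 f hf, mul_zero]

lemma regAt_monomialAt {X : FunSpace} {x : X.carrier} {y : ι → X.carrier → ℂ}
    (hy : ∀ f ∈ F, X.regAt (y f) x) (h0 : ∀ f ∈ F, y f x ≠ 0) :
    X.regAt (fun z => monomialAt F v fun f => y f z) x := by
  have h : ∏ f ∈ F, (fun z => y f z ^ v f) ∈ X.regOn {x} := prod_mem fun f hf => by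
    rintro _ rfl
    exact regAt_zpow (hy f hf) (h0 f hf) _
  convert h x rfl using 1
  funext z
  simp [monomialAt]

lemma regAt_torusSection {X : FunSpace} {x : X.carrier} {y : ι → X.carrier → ℂ}
    (hy : ∀ f ∈ F, X.regAt (y f) x) (h0 : ∀ f ∈ F, y f x ≠ 0) (f : ι) :
    X.regAt (fun z => torusSection F v e (fun f => y f z) f) x := by
  by_cases hf : f ∈ F
  · simp only [torusSection, if_pos hf]
    exact X.mul' _ _ x (hy f hf) (regAt_zpow (regAt_monomialAt hy h0) (monomialAt_ne_zero h0) _)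
  · simp only [torusSection, if_neg hf]
    exact X.const' 0 x

end Monomials

/-! ### Saturated sets and zero sets of regular functions -/

/-- The image of a saturated set in a quotient. -/
def quotSet {α : Type*} {r : α → α → Prop} (S : Set α) (h : ∀ x y, r x y → (x ∈ S ↔ y ∈ S)) :
    Set (Quot r) :=
  {q | Quot.lift (· ∈ S) (fun x y hxy => propext (h x y hxy)) q}

lemma isOpen_ne_zero {X : FunSpace} {O : Set X.carrier} (hO : IsOpen O) {f : X.carrier → ℂ}
    (hf : ∀ x ∈ O, X.regAt f x) : IsOpen {x | x ∈ O ∧ f x ≠ 0} := by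
  rw [isOpen_iff_mem_nhds]
  rintro x ⟨hx, hx0⟩
  filter_upwards [hO.mem_nhds hx, X.ne' f x (hf x hx) hx0] with y h1 h2
  exact ⟨h1, h2⟩

lemma isLocallyClosed_eq_zero {X : FunSpace} {O : Set X.carrier} (hO : IsOpen O)
    {f : X.carrier → ℂ} (hf : ∀ x ∈ O, X.regAt f x) : IsLocallyClosed {x | x ∈ O ∧ f x = 0} := by
  convert hO.isLocallyClosed.inter (isOpen_ne_zero hO hf).isClosed_compl.isLocallyClosed using 1
  ext x
  simp only [Set.mem_ofPred_eq, Set.mem_inter_iff, Set.mem_compl_iff]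
  tauto

lemma isOpen_coords_ne {ι : Type} (p : ι) : IsOpen {x : AffinePoint ι | x.coord p ≠ 0} := by
  refine TopologicalSpace.isOpen_generateFrom_of_mem ⟨MvPolynomial.X p, ?_⟩
  ext x; simp

lemma isClosed_coords_eq {ι : Type} (p : ι) : IsClosed {x : AffinePoint ι | x.coord p = 0} :=
  ⟨isOpen_coords_ne p⟩

lemma isLocallyClosed_orderStratum (d n : ℕ) (i : Fin n) : IsLocallyClosed (orderStratum d n i) := by
  have : ({x | (∀ l < i, ∀ j, x.coord (l, j) = 0) ∧ ∃ j, x.coord (i, j) ≠ 0} :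
      Set (AffinePoint (Fin n × Fin d))) = (⋂ l : Fin n, ⋂ (_ : l < i), ⋂ j : Fin d,
      {x : AffinePoint (Fin n × Fin d) | x.coord (l, j) = 0}) ∩
      ⋃ j : Fin d, {x : AffinePoint (Fin n × Fin d) | x.coord (i, j) ≠ 0} := by
    ext x
    simp
  change IsLocallyClosed ({x | (∀ l < i, ∀ j, x.coord (l, j) = 0) ∧ ∃ j, x.coord (i, j) ≠ 0} :
      Set (AffinePoint (Fin n × Fin d)))
  rw [this]
  exact (isClosed_iInter fun l => isClosed_iInter fun _ => isClosed_iInter fun j =>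
    isClosed_coords_eq _).isLocallyClosed.inter (isOpen_iUnion fun j =>
    isOpen_coords_ne _).isLocallyClosed

/-- The jets over a subset of the quotient of a stratum. -/
def liftStratum {d n : ℕ} {i : Fin n} (Z : Set (stratumQuotient d n i).carrier) : Set (Jet d n) :=
  {x | ∃ h : x ∈ orderStratum d n i, (Quot.mk _ ⟨x, h⟩ : (stratumQuotient d n i).carrier) ∈ Z}

lemma isLocallyClosed_liftStratum {d n : ℕ} {i : Fin n} {Z : Set (stratumQuotient d n i).carrier}
    (hZ : IsLocallyClosed Z) : IsLocallyClosed (liftStratum Z) := by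
  have h1 : IsLocallyClosed (Quot.mk _ ⁻¹' Z : Set (orderStratum d n i)) :=
    hZ.preimage continuous_quot_mk
  have h2 := h1.image IsInducing.subtypeVal
    (by rw [Subtype.range_coe]; exact isLocallyClosed_orderStratum d n i)
  convert h2 using 1
  ext x
  constructor
  · rintro ⟨h, hx⟩
    exact ⟨⟨x, h⟩, hx, rfl⟩
  · rintro ⟨⟨x, h⟩, hx, rfl⟩
    exact ⟨h, hx⟩

/-! ### The pieces of a stratum on which the quotient has a section -/

section Pieces

variable {d n : ℕ}

/-- Functions that assign to each jet with nonvanishing coefficient `(i, j)` its normal form. -/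
structure IsNormalFormMap (i : Fin n) (j : Fin d) {r : ℕ} (c : Fin n × Fin d → Jet d n → ℂ)
    (b : Fin r → Jet d n → ℂ) : Prop where
  regAt_c : ∀ p, ∀ x : Jet d n, x.coords (i, j) ≠ 0 → (jetSpace d n).regAt (c p) x
  regAt_b : ∀ s, ∀ x : Jet d n, x.coords (i, j) ≠ 0 → (jetSpace d n).regAt (b s) x
  normal : ∀ x ∈ orderStratum d n i, x.coords (i, j) ≠ 0 → IsNormal i j fun p => c p x
  eq_jetOf : ∀ x ∈ orderStratum d n i, x.coords (i, j) ≠ 0 →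
    x = jetOf (fun p => c p x) (fun s => b s x)

namespace IsNormalFormMap

variable {i : Fin n} {j : Fin d} {r : ℕ} {c : Fin n × Fin d → Jet d n → ℂ}
  {b : Fin r → Jet d n → ℂ}

lemma coords_ne_iff {x x' : Jet d n} (h : JetRel d n x x')
    (hx' : x' ∈ orderStratum d n i) (j : Fin d) : x.coords (i, j) ≠ 0 ↔ x'.coords (i, j) ≠ 0 := by
  obtain ⟨a, ha, h⟩ := h.exists_scale hx'
  simp [h, ha]

lemma scale (hD : IsNormalFormMap i j c b) {x x' : Jet d n} (h : JetRel d n x x')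
    (hx : x ∈ orderStratum d n i) (hx' : x' ∈ orderStratum d n i) (hj : x.coords (i, j) ≠ 0) :
    ∃ a : ℂ, a ≠ 0 ∧ ∀ p, c p x = a ^ (p.1.1 + 1) * c p x' := by
  have hj' := (coords_ne_iff h hx' j).1 hj
  exact h.normal_scale (hD.normal x hx hj) (hD.normal x' hx' hj') (hD.eq_jetOf x hx hj)
    (hD.eq_jetOf x' hx' hj')

lemma ne_iff (hD : IsNormalFormMap i j c b) {x x' : Jet d n} (h : JetRel d n x x')
    (hx : x ∈ orderStratum d n i) (hx' : x' ∈ orderStratum d n i) (hj : x.coords (i, j) ≠ 0)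
    (p : Fin n × Fin d) : c p x ≠ 0 ↔ c p x' ≠ 0 := by
  obtain ⟨a, ha, h⟩ := hD.scale h hx hx' hj
  simp [h, ha]

/-- The open part of a stratum where the coefficient `(i, j)` and the coefficients in `F` of the
normal form do not vanish. -/
def openPart (i : Fin n) (j : Fin d) (c : Fin n × Fin d → Jet d n → ℂ)
    (F : Finset (Fin n × Fin d)) : Set (Jet d n) :=
  {x | x.coords (i, j) ≠ 0 ∧ ∀ f ∈ F, c f x ≠ 0}

lemma isOpen_openPart (hD : IsNormalFormMap i j c b) (F : Finset (Fin n × Fin d)) :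
    IsOpen (openPart i j c F) := by
  have h0 : IsOpen {x : Jet d n | x.coords (i, j) ≠ 0} := isOpen_coords_ne _
  have : openPart i j c F = {x : Jet d n | x.coords (i, j) ≠ 0} ∩
      ⋂ f ∈ F, {x | x ∈ {x : Jet d n | x.coords (i, j) ≠ 0} ∧ c f x ≠ 0} := by
    ext x
    simp only [openPart, Set.mem_inter_iff, Set.mem_iInter, Set.mem_ofPred_eq]
    exact ⟨fun h => ⟨h.1, fun f hf => ⟨h.1, h.2 f hf⟩⟩, fun h => ⟨h.1, fun f hf => (h.2 f hf).2⟩⟩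
  rw [this]
  exact h0.inter (isOpen_biInter_finset fun f _ => isOpen_ne_zero h0 fun x hx => hD.regAt_c f x hx)

/-- The part of a stratum where `F` is the support of the normal form and the coefficients `(i, j')`,
`j' < j`, vanish. -/
def piece (i : Fin n) (j : Fin d) (c : Fin n × Fin d → Jet d n → ℂ) (F : Finset (Fin n × Fin d)) :
    Set (orderStratum d n i) :=
  {x | x.1 ∈ openPart i j c F ∧ (∀ f ∉ F, c f x.1 = 0) ∧ ∀ j' < j, (i, j') ∉ F}

/-- Equivalent jets have normal forms differing by nonzero factors in each coefficient, so the
support is an invariant of the orbit. -/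
lemma openPart_saturated (hD : IsNormalFormMap i j c b) (F : Finset (Fin n × Fin d))
    (x y : orderStratum d n i) (h : JetRel d n x.1 y.1) :
    x ∈ (Subtype.val ⁻¹' openPart i j c F : Set (orderStratum d n i)) ↔
      y ∈ (Subtype.val ⁻¹' openPart i j c F : Set (orderStratum d n i)) := by
  have h1 := coords_ne_iff h y.2 j
  constructor
  · rintro ⟨hj, hF⟩
    exact ⟨h1.1 hj, fun f hf => (hD.ne_iff h x.2 y.2 hj f).1 (hF f hf)⟩
  · rintro ⟨hj, hF⟩
    exact ⟨h1.2 hj, fun f hf => (hD.ne_iff h x.2 y.2 (h1.2 hj) f).2 (hF f hf)⟩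

lemma piece_saturated (hD : IsNormalFormMap i j c b) (F : Finset (Fin n × Fin d))
    (x y : orderStratum d n i) (h : JetRel d n x.1 y.1) :
    x ∈ piece i j c F ↔ y ∈ piece i j c F := by
  have h1 := hD.openPart_saturated F x y h
  constructor
  · rintro ⟨hU, h2, h3⟩
    refine ⟨h1.1 hU, fun f hf => ?_, h3⟩
    exact not_not.1 (mt (hD.ne_iff h x.2 y.2 hU.1 f).2 (not_not.2 (h2 f hf)))
  · rintro ⟨hU, h2, h3⟩
    have hU' := h1.2 hU
    refine ⟨hU', fun f hf => ?_, h3⟩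
    exact not_not.1 (mt (hD.ne_iff h x.2 y.2 hU'.1 f).1 (not_not.2 (h2 f hf)))

/-- The image of `openPart` in the quotient. -/
def openQuot (hD : IsNormalFormMap i j c b) (F : Finset (Fin n × Fin d)) :
    Set (stratumQuotient d n i).carrier :=
  quotSet _ (hD.openPart_saturated F)

/-- The image of `piece` in the quotient. -/
def pieceQuot (hD : IsNormalFormMap i j c b) (F : Finset (Fin n × Fin d)) :
    Set (stratumQuotient d n i).carrier :=
  quotSet _ (hD.piece_saturated F)

lemma isOpen_openQuot (hD : IsNormalFormMap i j c b) (F : Finset (Fin n × Fin d)) :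
    IsOpen (hD.openQuot F) :=
  isOpen_coinduced.2 ((hD.isOpen_openPart F).preimage continuous_subtype_val)

/-- Vanishing of a further coefficient `f` means lying outside the open set for `insert f F`. The
condition on smaller `j'` concerns only `F`: it either holds throughout or makes the piece empty. -/
lemma isLocallyClosed_pieceQuot (hD : IsNormalFormMap i j c b) (F : Finset (Fin n × Fin d)) :
    IsLocallyClosed (hD.pieceQuot F) := by
  classical
  by_cases hF : ∀ j' < j, (i, j') ∉ F
  · have : hD.pieceQuot F = hD.openQuot F ∩ ⋂ f ∈ Fᶜ, (hD.openQuot (insert f F))ᶜ := by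
      ext q
      obtain ⟨x, rfl⟩ := Quot.exists_rep q
      have h1 : x ∈ piece i j c F ↔ x.1 ∈ openPart i j c F ∧
          ∀ f ∉ F, x.1 ∉ openPart i j c (insert f F) := ?_
      · exact h1.trans ⟨fun h => ⟨h.1, Set.mem_iInter₂.2 fun f hf => h.2 f (Finset.mem_compl.1 hf)⟩,
          fun h => ⟨h.1, fun f hf => Set.mem_iInter₂.1 h.2 f (Finset.mem_compl.2 hf)⟩⟩
      simp only [piece, openPart, Set.mem_ofPred_eq, Finset.mem_insert, forall_eq_or_imp]
      constructor
      · rintro ⟨h1, h2, -⟩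
        exact ⟨h1, fun f hf h => h.2.1 (h2 f hf)⟩
      · rintro ⟨h1, h2⟩
        exact ⟨h1, fun f hf => by_contra fun h => h2 f hf ⟨h1.1, h, h1.2⟩, hF⟩
    rw [this]
    exact (hD.isOpen_openQuot F).isLocallyClosed.inter (isClosed_biInter fun f _ =>
      (hD.isOpen_openQuot _).isClosed_compl).isLocallyClosed
  · have : hD.pieceQuot F = ∅ := by
      refine Set.eq_empty_of_forall_notMem fun q hq => ?_
      obtain ⟨x, rfl⟩ := Quot.exists_rep q
      exact hF (hq : x ∈ piece i j c F).2.2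
    rw [this]
    exact isClosed_empty.isLocallyClosed

end IsNormalFormMap

/-- The slice for the action of coordinate changes on `piece`. -/
def slice (F : Finset (Fin n × Fin d)) (v : Fin n × Fin d → ℤ) : Set (AffinePoint (Fin n × Fin d)) :=
  {w | (∀ f ∈ F, w.coord f ≠ 0) ∧ (∀ f ∉ F, w.coord f = 0) ∧ monomialAt F v w.coord = 1}

lemma isLocallyClosed_slice (F : Finset (Fin n × Fin d)) (v : Fin n × Fin d → ℤ) :
    IsLocallyClosed (slice F v) := by
  classical
  have hO : IsOpen (⋂ f ∈ F, {w : AffinePoint (Fin n × Fin d) | w.coord f ≠ 0}) :=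
    isOpen_biInter_finset fun f _ => isOpen_coords_ne f
  have h1 := isLocallyClosed_eq_zero (X := affineSpace (Fin n × Fin d)) hO
    (f := fun w : AffinePoint (Fin n × Fin d) => monomialAt F v w.coord + (-1)) fun w hw => by
    refine FunSpace.add' _ _ _ _ (regAt_monomialAt (X := affineSpace (Fin n × Fin d))
      (y := fun f (w : AffinePoint (Fin n × Fin d)) => w.coord f)
      (fun f _ => affineSpace_regAt_coord f w) fun f hf => ?_) (FunSpace.const' _ _ _)
    exact Set.mem_iInter₂.1 hw f hf
  have h2 : IsClosed (⋂ f ∈ Fᶜ, {w : AffinePoint (Fin n × Fin d) | w.coord f = 0}) :=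
    isClosed_biInter fun f _ => isClosed_coords_eq f
  convert IsLocallyClosed.inter (X := AffinePoint (Fin n × Fin d)) h1 h2.isLocallyClosed using 1
  refine Set.ext fun w => ?_
  constructor
  · rintro ⟨h1, h2, h3⟩
    exact ⟨⟨Set.mem_iInter₂.2 h1, by rw [h3]; ring⟩,
      Set.mem_iInter₂.2 fun f hf => h2 f (Finset.mem_compl.1 hf)⟩
  · rintro ⟨⟨h1, h3⟩, h2⟩
    exact ⟨Set.mem_iInter₂.1 h1, fun f hf => Set.mem_iInter₂.1 h2 f (Finset.mem_compl.2 hf),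
      by linear_combination h3⟩

/-- One point of a piece therefore certifies normality for the whole slice with the same support. -/
lemma IsNormal.of_support {i : Fin n} {j : Fin d} {c c' : Fin n × Fin d → ℂ} (h : IsNormal i j c)
    (hc : ∀ p, c' p = 0 ↔ c p = 0) : IsNormal i j c' :=
  ⟨fun m hm j' => (hc _).2 (h.low m hm j'), fun h' => h.lead ((hc _).1 h'),
    fun m hm => (hc _).2 (h.rest m hm)⟩

lemma IsNormal.mem_orderStratum {i : Fin n} {j : Fin d} {c : Fin n × Fin d → ℂ}
    (h : IsNormal i j c) : (AffinePoint.mk c : Jet d n) ∈ orderStratum d n i :=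
  ⟨h.low, j, h.lead⟩

lemma eq_jetOf_zero (r : ℕ) (c : Fin n × Fin d → ℂ) :
    (AffinePoint.mk c : Jet d n) = jetOf c (0 : Fin r → ℂ) := by
  refine eq_jetOf fun j => ?_
  have : unipotent (0 : Fin r → ℂ) = 1 := by simp [unipotent]
  rw [this, mul_one]
  change _ ∣ arcSeries c j _ - arcSeries c j _
  rw [sub_self]
  exact dvd_zero _

/-- The data of a piece with support `F`, with the weights of the action of `ℂ*`. -/
structure IsPiece (i : Fin n) (j : Fin d) {r : ℕ} (c : Fin n × Fin d → Jet d n → ℂ)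
    (b : Fin r → Jet d n → ℂ) (F : Finset (Fin n × Fin d)) (g : ℕ) (e : Fin n × Fin d → ℕ)
    (v : Fin n × Fin d → ℤ) : Prop extends IsNormalFormMap i j c b where
  add_eq : r + (i.1 + 1) = n
  normal_of_support : ∀ w : Fin n × Fin d → ℂ, (∀ f ∈ F, w f ≠ 0) → (∀ f ∉ F, w f = 0) →
    IsNormal i j w
  notMem : ∀ j' < j, (i, j') ∉ F
  ne_zero : g ≠ 0
  weight : ∀ f ∈ F, e f * g = f.1.1 + 1
  bezout : ∑ f ∈ F, (e f : ℤ) * v f = 1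

/-! ### Trivialization of the pieces by slices -/

namespace IsPiece

open IsNormalFormMap

variable {i : Fin n} {j : Fin d} {r : ℕ} {c : Fin n × Fin d → Jet d n → ℂ}
  {b : Fin r → Jet d n → ℂ} {F : Finset (Fin n × Fin d)} {g : ℕ} {e : Fin n × Fin d → ℕ}
  {v : Fin n × Fin d → ℤ}

/-- The retraction to the slice. -/
noncomputable def toSlice (c : Fin n × Fin d → Jet d n → ℂ) (F : Finset (Fin n × Fin d))
    (e : Fin n × Fin d → ℕ) (v : Fin n × Fin d → ℤ) (x : Jet d n) : AffinePoint (Fin n × Fin d) :=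
  ⟨torusSection F v e fun p => c p x⟩

lemma toSlice_coord (x : Jet d n) :
    (toSlice c F e v x).coord = torusSection F v e fun p => c p x := rfl

lemma toSlice_mem (h : IsPiece i j c b F g e v) {x : Jet d n} (hx : x ∈ openPart i j c F) :
    toSlice c F e v x ∈ slice F v := by
  refine ⟨fun f hf => ?_, fun f hf => ?_, ?_⟩ <;> rw [toSlice_coord]
  rotate_left
  · exact torusSection_of_notMem hf
  · exact monomialAt_torusSection h.bezout hx.2
  rw [torusSection_of_mem hf]
  exact mul_ne_zero (pow_ne_zero _ (inv_ne_zero (monomialAt_ne_zero hx.2))) (hx.2 f hf)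

/-- Scaling the parameter by `a` acts with weights `e f * g`, which is the action of `a ^ g` with
weights `e f`; the retraction is invariant under the latter. -/
lemma toSlice_eq (h : IsPiece i j c b F g e v) {x x' : Jet d n} (hxx : JetRel d n x x')
    (hx : x ∈ orderStratum d n i) (hx' : x' ∈ orderStratum d n i) (hj : x.coords (i, j) ≠ 0) :
    toSlice c F e v x = toSlice c F e v x' := by
  obtain ⟨a, ha, hs⟩ := h.scale hxx hx hx' hj
  refine congrArg AffinePoint.mk (torusSection_scale h.bezout (pow_ne_zero g ha) fun f hf => ?_)
  rw [hs, ← pow_mul, mul_comm g, h.weight f hf]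

lemma normal_of_mem_slice (h : IsPiece i j c b F g e v) {w : AffinePoint (Fin n × Fin d)}
    (hw : w ∈ slice F v) : IsNormal i j w.coord :=
  h.normal_of_support _ hw.1 hw.2.1

lemma mem_orderStratum_of_mem_slice (h : IsPiece i j c b F g e v)
    {w : AffinePoint (Fin n × Fin d)} (hw : w ∈ slice F v) : (w : Jet d n) ∈ orderStratum d n i :=
  (h.normal_of_mem_slice hw).mem_orderStratum

/-- The normal form of a jet that is given by a normal form. -/
lemma normal_form_jetOf (h : IsPiece i j c b F g e v) {y : Fin n × Fin d → ℂ} {s : Fin r → ℂ}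
    (hy : IsNormal i j y) : (fun p => c p (jetOf y s)) = y ∧ (fun t => b t (jetOf y s)) = s := by
  have h1 := jetOf_mem_orderStratum hy s
  have h2 : (jetOf y s).coords (i, j) ≠ 0 := by
    rw [coords_jetOf hy.low]
    exact hy.lead
  have h3 := jetOf_injective h.add_eq hy (h.normal _ h1 h2) (h.eq_jetOf _ h1 h2)
  exact ⟨h3.1.symm, h3.2.symm⟩

/-- Read as a jet, a point of the slice is `jetOf` of itself with trivial parameter change, so it is
its own normal form. -/
lemma normal_form_of_mem_slice (h : IsPiece i j c b F g e v) {w : AffinePoint (Fin n × Fin d)}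
    (hw : w ∈ slice F v) : (fun p => c p w) = w.coord := by
  have := (h.normal_form_jetOf (s := 0) (h.normal_of_mem_slice hw)).1
  rwa [← eq_jetOf_zero] at this

lemma mem_piece_of_mem_slice (h : IsPiece i j c b F g e v) {w : AffinePoint (Fin n × Fin d)}
    (hw : w ∈ slice F v) :
    (⟨w, h.mem_orderStratum_of_mem_slice hw⟩ : orderStratum d n i) ∈ piece i j c F := by
  have h1 := h.normal_form_of_mem_slice hw
  have h2 : ∀ f, c f w = w.coord f := congrFun h1
  exact ⟨⟨(h.normal_of_mem_slice hw).lead, fun f hf => by rw [h2]; exact hw.1 f hf⟩,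
    fun f hf => by rw [h2]; exact hw.2.1 f hf, h.notMem⟩

lemma toSlice_of_mem_slice (h : IsPiece i j c b F g e v) {w : AffinePoint (Fin n × Fin d)}
    (hw : w ∈ slice F v) : toSlice c F e v w = w := by
  refine AffinePoint.ext ?_
  refine (toSlice_coord (w : Jet d n)).trans ?_
  rw [h.normal_form_of_mem_slice hw]
  exact torusSection_eq_self hw.2.2 hw.2.1

/-- A jet in the piece and its representative in the slice have the same class. -/
lemma mk_eq_mk_toSlice (h : IsPiece i j c b F g e v) {x : orderStratum d n i}
    (hx : x ∈ piece i j c F) : (Quot.mk _ x : (stratumQuotient d n i).carrier) =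
      Quot.mk _ ⟨toSlice c F e v x.1, h.mem_orderStratum_of_mem_slice (h.toSlice_mem hx.1)⟩ := by
  have hn := h.normal x.1 x.2 hx.1.1
  have h1 : JetRel d n x.1 (AffinePoint.mk fun p => c p x.1) := by
    have := jetRel_jetOf (fun p => c p x.1) (fun s => b s x.1)
    rwa [← h.eq_jetOf x.1 x.2 hx.1.1] at this
  -- The retraction divides by powers of the monomial with weights `e`. An actual coordinate change
  -- has weights `e * g`, so it must scale by a `g`-th root of the monomial.
  obtain ⟨t, ht⟩ := IsAlgClosed.exists_pow_nat_eq (monomialAt F v fun p => c p x.1)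
    (Nat.pos_of_ne_zero h.ne_zero)
  have ht0 : t ≠ 0 := by
    rintro rfl
    rw [zero_pow h.ne_zero] at ht
    exact monomialAt_ne_zero hx.1.2 ht.symm
  have h2 : JetRel d n (AffinePoint.mk fun p => c p x.1) (toSlice c F e v x.1) := by
    refine jetRel_scale ht0 fun p => ?_
    by_cases hp : p ∈ F
    · rw [← h.weight p hp, mul_comm (e p), pow_mul, ht]
      exact (mul_torusSection hx.1.2 hx.2.1 p).symm
    · rw [torusSection_of_notMem hp, hx.2.1 p hp, mul_zero]
  exact (Quot.sound (r := fun x y : orderStratum d n i => JetRel d n x.1 y.1) (a := x)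
    (b := ⟨_, hn.mem_orderStratum⟩) h1).trans (Quot.sound h2)

lemma regAt_toSlice (h : IsPiece i j c b F g e v) {x : Jet d n} (hx : x ∈ openPart i j c F)
    (p : Fin n × Fin d) :
    (jetSpace d n).regAt (fun y : Jet d n => (toSlice c F e v y).coord p) x :=
  regAt_torusSection (X := jetSpace d n) (fun f _ => h.regAt_c f x hx.1) hx.2 p

open Classical in
/-- The retraction to the slice, on the quotient. -/
noncomputable def quotToSlice (h : IsPiece i j c b F g e v) (q : (stratumQuotient d n i).carrier) :
    AffinePoint (Fin n × Fin d) :=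
  Quot.lift (fun x : orderStratum d n i =>
    if x.1 ∈ openPart i j c F then toSlice c F e v x.1 else ⟨0⟩) (by
    intro x y hxy
    have h1 := h.openPart_saturated F x y hxy
    by_cases hx : x.1 ∈ openPart i j c F
    · have hy : y.1 ∈ openPart i j c F := h1.1 hx
      rw [if_pos hx, if_pos hy]
      exact h.toSlice_eq hxy x.2 y.2 hx.1
    · have hy : y.1 ∉ openPart i j c F := mt h1.2 hx
      rw [if_neg hx, if_neg hy]) q

lemma quotToSlice_mk (h : IsPiece i j c b F g e v) {x : orderStratum d n i}
    (hx : x.1 ∈ openPart i j c F) : h.quotToSlice (Quot.mk _ x) = toSlice c F e v x.1 :=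
  if_pos hx

/-- Regularity on a quotient is tested on an open set. The formula for the retraction is invariant
and regular on the whole open part, not only on the locally closed piece. -/
lemma regAt_quotToSlice (h : IsPiece i j c b F g e v) {q : (stratumQuotient d n i).carrier}
    (hq : q ∈ h.openQuot F) (p : Fin n × Fin d) :
    (stratumQuotient d n i).regAt (fun y => (h.quotToSlice y).coord p) q := by
  refine quot_regAt (h.isOpen_openQuot F) hq fun u hu => ?_
  have hu' : u.1 ∈ openPart i j c F := hu
  refine FunSpace.congr' _ _ _ _ ?_ (sub_regAt (h.regAt_toSlice hu' p))
  have : IsOpen (Subtype.val ⁻¹' openPart i j c F : Set (orderStratum d n i)) :=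
    (h.isOpen_openPart F).preimage continuous_subtype_val
  filter_upwards [this.mem_nhds hu'] with y hy
  rw [h.quotToSlice_mk hy]

/-- The quotient of the piece is isomorphic to the slice. -/
lemma quot_iso_slice (h : IsPiece i j c b F g e v) (Z : Set (stratumQuotient d n i).carrier) :
    ((stratumQuotient d n i).sub (Z ∩ h.pieceQuot F)).Iso
      ((affineSpace (Fin n × Fin d)).sub (slice F v ∩ liftStratum Z)) := by
  have hZ : ∀ x : orderStratum d n i, Quot.mk _ x ∈ Z ∩ h.pieceQuot F →
      toSlice c F e v x.1 ∈ slice F v ∩ liftStratum Z := by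
    intro x hx
    have hp : x ∈ piece i j c F := hx.2
    refine ⟨h.toSlice_mem hp.1, h.mem_orderStratum_of_mem_slice (h.toSlice_mem hp.1), ?_⟩
    rw [← h.mk_eq_mk_toSlice hp]
    exact hx.1
  refine Iso.of_maps (fun q => ⟨h.quotToSlice q.1, ?_⟩)
    (fun w => ⟨Quot.mk _ ⟨w.1, h.mem_orderStratum_of_mem_slice w.2.1⟩, ?_⟩) ?_ ?_ ?_ ?_
  · obtain ⟨q, hq⟩ := q
    obtain ⟨x, rfl⟩ := Quot.exists_rep q
    have hp : x ∈ piece i j c F := hq.2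
    rw [h.quotToSlice_mk hp.1]
    exact hZ x hq
  · obtain ⟨w, hw, hs, hwZ⟩ := w
    exact ⟨hwZ, h.mem_piece_of_mem_slice hw⟩
  · refine isMorphism_to_sub (isMorphism_affine fun p q => ?_)
    refine sub_regAt (f := fun q => (h.quotToSlice q).coord p) (h.regAt_quotToSlice ?_ p)
    obtain ⟨q, hq⟩ := q
    obtain ⟨x, rfl⟩ := Quot.exists_rep q
    exact (hq.2 : x ∈ piece i j c F).1
  · refine isMorphism_to_sub ?_
    refine (isMorphism_mk (X := (jetSpace d n).sub (orderStratum d n i)) _).comp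
      (X := (affineSpace (Fin n × Fin d)).sub (slice F v ∩ liftStratum Z)) ?_
    exact isMorphism_to_sub (isMorphism_val _)
  · rintro ⟨q, hq⟩
    obtain ⟨x, rfl⟩ := Quot.exists_rep q
    have hp : x ∈ piece i j c F := hq.2
    refine Subtype.ext ?_
    refine Eq.trans ?_ (h.mk_eq_mk_toSlice hp).symm
    exact congrArg (Quot.mk _) (Subtype.ext (h.quotToSlice_mk hp.1))
  · rintro ⟨w, hw⟩
    refine Subtype.ext ?_
    exact (h.quotToSlice_mk (h.mem_piece_of_mem_slice hw.1).1).trans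
      (h.toSlice_of_mem_slice hw.1)

/-- The piece is isomorphic to the product of the slice, `ℂ*` and an affine space. -/
lemma lift_iso_slice (h : IsPiece i j c b F g e v) (Z : Set (stratumQuotient d n i).carrier) :
    ((jetSpace d n).sub (liftStratum (Z ∩ h.pieceQuot F))).Iso
      ((affineSpace (Option (Fin n × Fin d) ⊕ Fin r)).sub (AffinePoint.comap Sum.inl ⁻¹'
        (AffinePoint.comap some ⁻¹' (slice F v ∩ liftStratum Z) ∩ {x | x.coord none ≠ 0}))) := by
  -- The coordinate `none` moves a slice point along its orbit with weights `e`. The monomial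
  -- recovers this coordinate since it is `1` on the slice.
  let Θ : AffinePoint (Option (Fin n × Fin d) ⊕ Fin r) → Fin n × Fin d → ℂ := fun z p =>
    z.coord (Sum.inl none) ^ e p * z.coord (Sum.inl (some p))
  have hΘ : ∀ z, AffinePoint.comap some (AffinePoint.comap Sum.inl z) ∈ slice F v →
      z.coord (Sum.inl none) ≠ 0 → (∀ f ∈ F, Θ z f ≠ 0) ∧ (∀ f ∉ F, Θ z f = 0) ∧
      monomialAt F v (Θ z) = z.coord (Sum.inl none) := by
    intro z hz hz0
    refine ⟨fun f hf => mul_ne_zero (pow_ne_zero _ hz0) (hz.1 f hf), fun f hf => ?_, ?_⟩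
    · have : z.coord (Sum.inl (some f)) = 0 := hz.2.1 f hf
      simp [Θ, this]
    · rw [monomialAt_scale h.bezout hz0 (y := fun p => z.coord (Sum.inl (some p))) fun f _ => rfl]
      have : monomialAt F v (fun p => z.coord (Sum.inl (some p))) = 1 := hz.2.2
      rw [this, mul_one]
  have hmem : ∀ x ∈ liftStratum (Z ∩ h.pieceQuot F), ∃ hx : x ∈ orderStratum d n i,
      (⟨x, hx⟩ : orderStratum d n i) ∈ piece i j c F ∧
        (Quot.mk _ ⟨x, hx⟩ : (stratumQuotient d n i).carrier) ∈ Z := fun x hx => by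
    obtain ⟨hs, hZ, hp⟩ := hx
    exact ⟨hs, hp, hZ⟩
  have hjet : ∀ z : AffinePoint (Option (Fin n × Fin d) ⊕ Fin r),
      AffinePoint.comap some (AffinePoint.comap Sum.inl z) ∈ slice F v →
      z.coord (Sum.inl none) ≠ 0 →
      (fun p => c p (jetOf (Θ z) fun s => z.coord (Sum.inr s))) = Θ z ∧
      (fun t => b t (jetOf (Θ z) fun s => z.coord (Sum.inr s))) = (fun s => z.coord (Sum.inr s)) ∧
      ∃ hs : jetOf (Θ z) (fun s => z.coord (Sum.inr s)) ∈ orderStratum d n i,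
        (⟨_, hs⟩ : orderStratum d n i) ∈ piece i j c F ∧
        toSlice c F e v (jetOf (Θ z) fun s => z.coord (Sum.inr s)) =
          AffinePoint.comap some (AffinePoint.comap Sum.inl z) := by
    intro z hz hz0
    obtain ⟨h1, h2, h3⟩ := hΘ z hz hz0
    have hn := h.normal_of_support _ h1 h2
    obtain ⟨h4, h5⟩ := h.normal_form_jetOf (s := fun s => z.coord (Sum.inr s)) hn
    have h4' : ∀ p, c p (jetOf (Θ z) fun s => z.coord (Sum.inr s)) = Θ z p := congrFun h4
    refine ⟨h4, h5, jetOf_mem_orderStratum hn _, ⟨⟨?_, fun f hf => ?_⟩, fun f hf => ?_, h.notMem⟩, ?_⟩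
    · rw [coords_jetOf hn.low]
      exact hn.lead
    · rw [h4']
      exact h1 f hf
    · rw [h4']
      exact h2 f hf
    · refine AffinePoint.ext ?_
      rw [toSlice_coord, h4, torusSection_scale h.bezout hz0
        (y := fun p => z.coord (Sum.inl (some p))) fun f _ => rfl]
      exact torusSection_eq_self hz.2.2 hz.2.1
  refine Iso.sub_of_maps (X := jetSpace d n)
    (Y := affineSpace (Option (Fin n × Fin d) ⊕ Fin r))
    (fun x => ⟨Sum.elim (fun o => o.elim (monomialAt F v fun p => c p x)
      (toSlice c F e v x).coord) fun s => b s x⟩)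
    (fun z => jetOf (Θ z) fun s => AffinePoint.coord z (Sum.inr s)) ?_ ?_ ?_ ?_ ?_ ?_
  · refine isMorphism_affine fun p x => ?_
    obtain ⟨hs, hp, -⟩ := hmem x.1 x.2
    rcases p with (_ | p) | s
    · exact sub_regAt (X := jetSpace d n) (regAt_monomialAt (X := jetSpace d n)
        (fun f _ => h.regAt_c f x.1 hp.1.1) hp.1.2)
    · exact sub_regAt (X := jetSpace d n) (S := liftStratum (Z ∩ h.pieceQuot F)) (x := x)
        (f := fun y : Jet d n => (toSlice c F e v y).coord p) (h.regAt_toSlice hp.1 p)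
    · exact sub_regAt (X := jetSpace d n) (h.regAt_b s x.1 hp.1.1)
  · refine IsMorphism.comp (X := (affineSpace (Option (Fin n × Fin d) ⊕ Fin r)).sub _)
      (Y := affineSpace (Option (Fin n × Fin d) ⊕ Fin r)) (Z := jetSpace d n)
      (g := fun z => jetOf (Θ z) fun s => AffinePoint.coord z (Sum.inr s))
      (isMorphism_affine fun p z => ?_) (isMorphism_val _)
    refine regAt_jetOf (X := affineSpace (Option (Fin n × Fin d) ⊕ Fin r))
      (c := fun p z => Θ z p) (b := fun s z => AffinePoint.coord z (Sum.inr s)) (fun p => ?_)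
      (fun s => affineSpace_regAt_coord _ z) p
    have h1 := pow_mem (S := (affineSpace (Option (Fin n × Fin d) ⊕ Fin r)).regOn Set.univ)
      (x := fun z => AffinePoint.coord z (Sum.inl none))
      (fun z _ => affineSpace_regAt_coord _ z) (e p) z trivial
    exact FunSpace.mul' _ _ _ z h1 (affineSpace_regAt_coord _ z)
  · intro x hx
    obtain ⟨hs, hp, hZ⟩ := hmem x hx
    refine ⟨⟨h.toSlice_mem hp.1, h.mem_orderStratum_of_mem_slice (h.toSlice_mem hp.1), ?_⟩,
      monomialAt_ne_zero hp.1.2⟩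
    exact h.mk_eq_mk_toSlice hp ▸ hZ
  · rintro z ⟨⟨hz, hzZ⟩, hz0⟩
    obtain ⟨-, -, hs, hp, ht⟩ := hjet z hz hz0
    refine ⟨hs, ?_, hp⟩
    rw [h.mk_eq_mk_toSlice hp]
    obtain ⟨hs', hzZ⟩ := hzZ
    exact (congrArg (· ∈ Z) (congrArg (Quot.mk _) (Subtype.ext ht))).mpr hzZ
  · intro x hx
    obtain ⟨hs, hp, hZ⟩ := hmem x hx
    have : (fun p => monomialAt F v (fun p => c p x) ^ e p * (toSlice c F e v x).coord p) =
        fun p => c p x := funext fun p => mul_torusSection hp.1.2 hp.2.1 p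
    change jetOf (fun p => monomialAt F v (fun p => c p x) ^ e p * (toSlice c F e v x).coord p)
      (fun s => b s x) = x
    rw [this]
    exact (h.eq_jetOf x hs hp.1.1).symm
  · rintro z ⟨⟨hz, hzZ⟩, hz0⟩
    obtain ⟨h1, h2, hs, hp, ht⟩ := hjet z hz hz0
    refine AffinePoint.ext (funext fun p => ?_)
    rcases p with (_ | p) | s
    · change monomialAt F v (fun p => c p (jetOf (Θ z) fun s => AffinePoint.coord z (Sum.inr s))) = _
      rw [h1]
      exact (hΘ z hz hz0).2.2
    · exact congrArg (fun w => AffinePoint.coord w p) ht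
    · exact congrFun h2 s

lemma isLocallyClosed_slice_inter {Z : Set (stratumQuotient d n i).carrier}
    (hZ : IsLocallyClosed Z) (F : Finset (Fin n × Fin d)) (v : Fin n × Fin d → ℤ) :
    IsLocallyClosed (slice F v ∩ liftStratum Z : Set (AffinePoint (Fin n × Fin d))) :=
  (isLocallyClosed_slice F v).inter (isLocallyClosed_liftStratum hZ)

lemma isQuasiProjective_quot (h : IsPiece i j c b F g e v)
    {Z : Set (stratumQuotient d n i).carrier} (hZ : IsLocallyClosed Z) :
    ((stratumQuotient d n i).sub (Z ∩ h.pieceQuot F)).IsQuasiProjective :=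
  (isQuasiProjective_affine_sub (isLocallyClosed_slice_inter hZ F v)).of_iso (h.quot_iso_slice Z)

lemma classOf_lift (h : IsPiece i j c b F g e v)
    {Z : Set (stratumQuotient d n i).carrier} (hZ : IsLocallyClosed Z) :
    affineClass (liftStratum (Z ∩ h.pieceQuot F)) =
      classOf ((stratumQuotient d n i).sub (Z ∩ h.pieceQuot F)) * (lef - 1) * lef ^ r := by
  have hl := isLocallyClosed_slice_inter hZ F v
  have h1 : classOf ((stratumQuotient d n i).sub (Z ∩ h.pieceQuot F)) =
      affineClass (slice F v ∩ liftStratum Z) := classOf_congr (h.quot_iso_slice Z)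
  rw [h1, ← classOf_comap_some_ne hl, ← classOf_comap_inl]
  · exact classOf_congr (h.lift_iso_slice Z)
  · exact (hl.preimage (affineSpace_continuous_comap some)).inter
      (isOpen_coords_ne none).isLocallyClosed

end IsPiece

/-- The class of the jets over a locally closed subset of a piece of the quotient. -/
lemma IsNormalFormMap.classOf_lift {i : Fin n} {j : Fin d} {r : ℕ} (hr : r + (i.1 + 1) = n)
    {c : Fin n × Fin d → Jet d n → ℂ} {b : Fin r → Jet d n → ℂ} (h : IsNormalFormMap i j c b)
    (F : Finset (Fin n × Fin d)) {Z : Set (stratumQuotient d n i).carrier}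
    (hZ : IsLocallyClosed Z) :
    ((stratumQuotient d n i).sub (Z ∩ h.pieceQuot F)).IsQuasiProjective ∧
    affineClass (liftStratum (Z ∩ h.pieceQuot F)) =
      classOf ((stratumQuotient d n i).sub (Z ∩ h.pieceQuot F)) * (lef - 1) * lef ^ r := by
  by_cases hx : ∃ x, x ∈ piece i j c F
  · obtain ⟨x, hx⟩ := hx
    have hn := h.normal x.1 x.2 hx.1.1
    have hF : F.Nonempty := ⟨(i, j), by
      by_contra hF
      exact hn.lead (hx.2.1 _ hF)⟩
    -- The weights are the exponents of the parameter: the coefficient with index `m` belongs to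
    -- degree `m + 1`.
    obtain ⟨g, e, v, hg, he, hev⟩ := exists_bezout hF (fun f => f.1.1 + 1) fun f => Nat.succ_ne_zero _
    have hp : IsPiece i j c b F g e v := ⟨h, hr, fun w hw hw' => hn.of_support fun p => by
      by_cases hpF : p ∈ F
      · simp [hw p hpF, hx.1.2 p hpF]
      · simp [hw' p hpF, hx.2.1 p hpF], hx.2.2, hg, he, hev⟩
    exact ⟨hp.isQuasiProjective_quot hZ, hp.classOf_lift hZ⟩
  · have h0 : Z ∩ h.pieceQuot F = ∅ := by
      refine Set.eq_empty_of_forall_notMem fun q hq => ?_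
      obtain ⟨x, rfl⟩ := Quot.exists_rep q
      exact hx ⟨x, hq.2⟩
    have h1 : liftStratum (∅ : Set (stratumQuotient d n i).carrier) = ∅ :=
      Set.eq_empty_of_forall_notMem fun x hx => hx.2
    rw [h0, h1, classOf_sub_empty, zero_mul, zero_mul]
    exact ⟨isQuasiProjective_of_isEmpty (inferInstanceAs (IsEmpty (∅ : Set _))),
      classOf_sub_empty _⟩

end Pieces

/-! ### Classes of sets of jets over the strata -/

section Strata

variable {d n : ℕ}

lemma liftStratum_iUnion {i : Fin n} {τ : Type*} (P : τ → Set (stratumQuotient d n i).carrier) :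
    liftStratum (⋃ t, P t) = ⋃ t, liftStratum (P t) := by
  ext x
  rw [Set.mem_iUnion]
  constructor
  · rintro ⟨hx, h⟩
    obtain ⟨t, ht⟩ := Set.mem_iUnion.1 h
    exact ⟨t, hx, ht⟩
  · rintro ⟨t, hx, ht⟩
    exact ⟨hx, Set.mem_iUnion.2 ⟨t, ht⟩⟩

lemma disjoint_liftStratum {i : Fin n} {Z Z' : Set (stratumQuotient d n i).carrier}
    (h : Disjoint Z Z') : Disjoint (liftStratum Z) (liftStratum Z') :=
  Set.disjoint_left.2 fun _ ⟨_, hx⟩ ⟨_, hx'⟩ => Set.disjoint_left.1 h hx hx'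

/-- The class of the set of jets over a constructible subset of the quotient of a stratum. -/
lemma constructibleClass_liftStratum {i : Fin n} {r : ℕ} (hr : r + (i.1 + 1) = n)
    {Z : Set (stratumQuotient d n i).carrier} (hZ : IsConstructible Z) :
    IsConstructible (liftStratum Z) ∧ constructibleClass (jetSpace d n) (liftStratum Z) =
      constructibleClass (stratumQuotient d n i) Z * (lef - 1) * lef ^ r := by
  classical
  have hex : ∀ j : Fin d, ∃ (c : Fin n × Fin d → Jet d n → ℂ) (b : Fin r → Jet d n → ℂ),
      IsNormalFormMap i j c b := fun j => by
    obtain ⟨c, b, h1, h2, h3⟩ := exists_normal_form i j hr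
    exact ⟨c, b, h1, h2, fun x hx hj => (h3 x hx hj).1, fun x hx hj => (h3 x hx hj).2⟩
  choose c b H using hex
  obtain ⟨m, f, A, hf, rfl⟩ := exists_map_of_isConstructible hZ
  -- The locally closed parts of `Z` are refined by the first component with nonzero lowest
  -- coefficient and by the support of its normal form.
  let P : {t // t ∈ A} × (Fin d × Finset (Fin n × Fin d)) →
      Set (stratumQuotient d n i).carrier := fun s => f ⁻¹' {s.1.1} ∩ (H s.2.1).pieceQuot s.2.2
  have hP : ∀ s, IsLocallyClosed (P s) := fun s =>
    (hf _).inter ((H s.2.1).isLocallyClosed_pieceQuot s.2.2)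
  -- Passing to the normal form does not alter the lowest coefficients. So the support conditions on
  -- `(i, j')` with `j' < j` make `j` the first nonvanishing component, and pieces for different `j`
  -- are disjoint.
  have hlead : ∀ (j j' : Fin d) (x : orderStratum d n i), Jet.coords x.1 (i, j') ≠ 0 →
      Jet.coords x.1 (i, j) = c j' (i, j) x.1 := by
    intro j j' x hx
    have h1 := (H j').eq_jetOf x.1 x.2 hx
    have h2 := coords_jetOf (c := fun p => c j' p x.1) ((H j').normal x.1 x.2 hx).low (fun s => b j' s x.1) j
    rwa [← h1] at h2
  have hlt : ∀ (j j' : Fin d) (F F' : Finset (Fin n × Fin d)) (x : orderStratum d n i),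
      x ∈ IsNormalFormMap.piece i j (c j) F → x ∈ IsNormalFormMap.piece i j' (c j') F' →
      ¬ j < j' := by
    intro j j' F F' x hx hx' hjj
    refine hx.1.1 ((hlead j j' x hx'.1.1).trans (hx'.2.1 _ (hx'.2.2 j hjj)))
  have hdisj : Pairwise fun s s' => Disjoint (P s) (P s') := by
    rintro ⟨t, j, F⟩ ⟨t', j', F'⟩ hne
    refine Set.disjoint_left.2 fun q hq hq' => hne ?_
    obtain ⟨x, rfl⟩ := Quot.exists_rep q
    have ht : t = t' := Subtype.ext (hq.1.symm.trans hq'.1)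
    have hx : x ∈ IsNormalFormMap.piece i j (c j) F := hq.2
    have hx' : x ∈ IsNormalFormMap.piece i j' (c j') F' := hq'.2
    obtain rfl : j = j' := le_antisymm (not_lt.1 (hlt _ _ _ _ x hx' hx))
      (not_lt.1 (hlt _ _ _ _ x hx hx'))
    have hF : F = F' := by
      ext p
      constructor
      · intro hp
        by_contra hp'
        exact hx.1.2 p hp (hx'.2.1 p hp')
      · intro hp
        by_contra hp'
        exact hx'.1.2 p hp (hx.2.1 p hp')
    rw [ht, hF]
  have hunion : ⋃ s, P s = f ⁻¹' A := by
    refine Set.ext fun q => ?_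
    rw [Set.mem_iUnion]
    constructor
    · rintro ⟨⟨t, j, F⟩, hq, -⟩
      have : f q = t.1 := hq
      rw [Set.mem_preimage, this]
      exact t.2
    · intro hq
      obtain ⟨x, rfl⟩ := Quot.exists_rep q
      obtain ⟨j, hj, hmin⟩ := WellFounded.has_min (wellFounded_lt (α := Fin d))
        {j | Jet.coords x.1 (i, j) ≠ 0} x.2.2
      refine ⟨⟨⟨_, hq⟩, j, Finset.univ.filter fun p => c j p x.1 ≠ 0⟩, rfl, ⟨hj, fun p hp => ?_⟩,
        fun p hp => ?_, fun j' hj' hp => ?_⟩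
      · exact (Finset.mem_filter.1 hp).2
      · by_contra h
        exact hp (Finset.mem_filter.2 ⟨Finset.mem_univ _, h⟩)
      · refine hmin j' ?_ hj'
        change Jet.coords x.1 (i, j') ≠ 0
        rw [hlead j' j x hj]
        exact (Finset.mem_filter.1 hp).2
  have hclass := fun s : {t // t ∈ A} × (Fin d × Finset (Fin n × Fin d)) =>
    (H s.2.1).classOf_lift hr s.2.2 (hf s.1.1)
  have hlift : ⋃ s, liftStratum (P s) = liftStratum (f ⁻¹' A) := by
    rw [← liftStratum_iUnion, hunion]
  constructor
  · rw [← hlift]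
    exact IsConstructible.iUnion fun s =>
      isConstructible_of_isLocallyClosed (X := AffinePoint (Fin n × Fin d))
        (isLocallyClosed_liftStratum (hP s))
  · rw [constructibleClass_eq_sum (X := jetSpace d n)
      (fun s => isLocallyClosed_liftStratum (hP s))
      (fun s => isQuasiProjective_affine_sub (isLocallyClosed_liftStratum (hP s)))
      (fun s s' hs => disjoint_liftStratum (hdisj hs)) hlift,
      constructibleClass_eq_sum hP (fun s => (hclass s).1) hdisj hunion, Finset.sum_mul,
      Finset.sum_mul]
    exact Finset.sum_congr rfl fun s _ => (hclass s).2

end Strata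

/-! ### The motivic measure of cylindric sets of arcs -/

lemma classOf_comap_injective {ι κ : Type} [Fintype ι] [Fintype κ] {e : ι → κ}
    (he : Function.Injective e) {k : ℕ} (hk : Fintype.card κ = Fintype.card ι + k)
    {S : Set (AffinePoint ι)} (hS : IsLocallyClosed S) :
    affineClass (AffinePoint.comap e ⁻¹' S) = affineClass S * lef ^ k := by
  classical
  have hc : Fintype.card ↥(Set.range e)ᶜ = k := by
    rw [Fintype.card_compl_set, hk, Set.card_range_of_injective he, Nat.add_sub_cancel_left]
  let E : ι ⊕ Fin k ≃ κ := (Equiv.sumCongr (Equiv.ofInjective e he)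
    (Fintype.equivFinOfCardEq hc).symm).trans (Equiv.Set.sumCompl (Set.range e))
  rw [← classOf_comap_inl hS k, ← classOf_comap_equiv E]
  rfl

lemma constructibleClass_comap {ι κ : Type} [Fintype ι] [Fintype κ] {e : ι → κ}
    (he : Function.Injective e) {k : ℕ} (hk : Fintype.card κ = Fintype.card ι + k)
    {S : Set (AffinePoint ι)} (hS : IsConstructible S) :
    constructibleClass (affineSpace κ) (AffinePoint.comap e ⁻¹' S) =
      constructibleClass (affineSpace ι) S * lef ^ k := by
  classical
  obtain ⟨m, f, A, hf, rfl⟩ := exists_map_of_isConstructible hS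
  have h1 := constructibleClass_affine_eq_sum hf A
  have h2 := constructibleClass_affine_eq_sum (f := f ∘ AffinePoint.comap e)
    (fun t => (hf t).preimage (affineSpace_continuous_comap e)) A
  refine h2.trans (Eq.trans ?_ (congrArg (· * lef ^ k) h1).symm)
  refine Eq.trans ?_ (Finset.sum_mul _ _ _).symm
  exact Finset.sum_congr rfl fun t _ => classOf_comap_injective he hk (hf t)

lemma constructibleClass_empty (X : FunSpace) : constructibleClass X ∅ = 0 := by
  rw [constructibleClass_eq_sum (ι := Empty) (P := fun _ => ∅) (fun i => i.elim) (fun i => i.elim)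
    (fun i => i.elim) (Set.iUnion_of_empty _)]
  simp

lemma coe_lefUnit : (lefUnit : K0L) = algebraMap K0 K0L lef := IsUnit.unit_spec _

/-- Since every jet lifts to an arc, `Y'` is the full preimage of `Y`. Each additional order adds
`d` free coordinates, which the normalization cancels. -/
lemma jetClass_well_defined {d n m : ℕ} (hnm : n ≤ m) {Y : Set (Jet d n)} {Y' : Set (Jet d m)}
    (hY : IsConstructible Y) (h : jet n ⁻¹' Y = jet m ⁻¹' Y') :
    algebraMap K0 K0L (constructibleClass (jetSpace d m) Y') *
      ((lefUnit ^ (-((d : ℤ) * m)) : K0Lˣ) : K0L) =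
    algebraMap K0 K0L (constructibleClass (jetSpace d n) Y) *
      ((lefUnit ^ (-((d : ℤ) * n)) : K0Lˣ) : K0L) := by
  obtain ⟨l, rfl⟩ := Nat.exists_eq_add_of_le hnm
  have he : Function.Injective (Prod.map (Fin.castLE hnm) id : Fin n × Fin d → Fin (n + l) × Fin d) :=
    (Fin.castLE_injective hnm).prodMap Function.injective_id
  have hY' : Y' = AffinePoint.comap (Prod.map (Fin.castLE hnm) id) ⁻¹' Y := by
    refine Set.ext fun x => ?_
    obtain ⟨φ, rfl⟩ := jet_surjective d (n + l) x
    exact (Set.ext_iff.1 h φ).symm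
  have hc : constructibleClass (jetSpace d (n + l)) Y' =
      constructibleClass (jetSpace d n) Y * lef ^ (l * d) := by
    rw [hY']
    exact constructibleClass_comap he
      (by simp only [Fintype.card_prod, Fintype.card_fin]; ring) hY
  rw [hc, map_mul, map_pow, ← coe_lefUnit, mul_assoc, ← Units.val_pow_eq_pow_val, ← Units.val_mul,
    ← zpow_natCast, ← zpow_add]
  congr 3
  push_cast
  ring

lemma arcMeasure_eq {d n : ℕ} {Y : Set (Jet d n)} (hY : IsConstructible Y) :
    arcMeasure (jet n ⁻¹' Y) = algebraMap K0 K0L (constructibleClass (jetSpace d n) Y) *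
      ((lefUnit ^ (-((d : ℤ) * n)) : K0Lˣ) : K0L) := by
  have h : IsArcCylinder (jet n ⁻¹' Y) := ⟨⟨n, Y⟩, hY, rfl⟩
  rw [arcMeasure, dif_pos h]
  rcases le_total n h.choose.1 with hle | hle
  · exact jetClass_well_defined hle hY h.choose_spec.2
  · exact (jetClass_well_defined hle h.choose_spec.1 h.choose_spec.2.symm).symm

lemma isArcCylinder_empty (d : ℕ) : IsArcCylinder (∅ : Set (Arc d)) :=
  ⟨⟨0, ∅⟩, .empty, rfl⟩

lemma arcMeasure_empty (d : ℕ) : arcMeasure (∅ : Set (Arc d)) = 0 := by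
  have h := arcMeasure_eq (d := d) (n := 0) (Y := ∅) .empty
  rwa [Set.preimage_empty, constructibleClass_empty, map_zero, zero_mul] at h

/-! ### Arcs of given order over a cylindric set of branches -/

lemma Arc.ord_eq_iff {d : ℕ} (φ : Arc d) (k : ℕ) : φ.ord = k ↔
    (∀ l < k, ∀ j, PowerSeries.coeff l (φ.1 j) = 0) ∧ ∃ j, PowerSeries.coeff k (φ.1 j) ≠ 0 := by
  constructor
  · intro h
    have hle : ∀ j, (k : ℕ∞) ≤ (φ.1 j).order := fun j => h ▸ iInf_le _ j
    have hlow : ∀ l < k, ∀ j, PowerSeries.coeff l (φ.1 j) = 0 := fun l hl j =>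
      PowerSeries.coeff_of_lt_order l (lt_of_lt_of_le (by exact_mod_cast hl) (hle j))
    refine ⟨hlow, ?_⟩
    by_contra! hk
    have : ((k + 1 : ℕ) : ℕ∞) ≤ φ.ord := le_iInf fun j => PowerSeries.nat_le_order _ _ fun l hl => by
      rcases Nat.lt_succ_iff_lt_or_eq.1 hl with h | rfl
      · exact hlow l h j
      · exact hk j
    rw [h] at this
    exact absurd (by exact_mod_cast this : k + 1 ≤ k) (by omega)
  · rintro ⟨h1, j, hj⟩
    refine le_antisymm ((iInf_le _ j).trans (PowerSeries.order_le k hj)) (le_iInf fun j => ?_)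
    exact PowerSeries.nat_le_order _ _ fun l hl => h1 l hl j

lemma jet_mem_orderStratum_iff {d n : ℕ} (φ : Arc d) (i : Fin n) :
    jet n φ ∈ orderStratum d n i ↔ φ.ord = (i.1 + 1 : ℕ) := by
  rw [Arc.ord_eq_iff]
  constructor
  · rintro ⟨h1, h2⟩
    refine ⟨?_, h2⟩
    rintro (_ | l) hl j
    · simpa using (φ.2 j).1
    · exact h1 ⟨l, by omega⟩ (by rw [Fin.lt_def]; simp only; omega) j
  · rintro ⟨h1, h2⟩
    exact ⟨fun l hl j => h1 (l.1 + 1) (by rw [Fin.lt_def] at hl; omega) j, h2⟩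

/-- The arcs of order `k` whose branch is in `B`. -/
def arcsOver {d : ℕ} (B : Set (Branch d)) (k : ℕ) : Set (Arc d) :=
  {φ | φ.ord = k ∧ toBranch φ ∈ B}

lemma arcsOver_eq_preimage {d n : ℕ} (Y : Set (BranchJet d n)) (i : Fin n) :
    arcsOver (branchJet n ⁻¹' Y) (i.1 + 1) = jet n ⁻¹' liftStratum (stratumPart Y i) := by
  ext φ
  constructor
  · rintro ⟨h1, h2⟩
    exact ⟨(jet_mem_orderStratum_iff φ i).2 h1, h2⟩
  · rintro ⟨h1, h2⟩
    exact ⟨(jet_mem_orderStratum_iff φ i).1 h1, h2⟩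

lemma arcsOver_zero {d : ℕ} (B : Set (Branch d)) : arcsOver B 0 = ∅ := by
  refine Set.eq_empty_of_forall_notMem ?_
  rintro φ ⟨h, -⟩
  obtain ⟨-, j, hj⟩ := (Arc.ord_eq_iff φ 0).1 (by exact_mod_cast h)
  exact hj (by simpa using (φ.2 j).1)

/-- Arcs of order greater than `n` have zero `n`-jet, which is excluded from `Y`. This makes the sum
over orders finite. -/
lemma arcsOver_of_lt {d n : ℕ} {Y : Set (BranchJet d n)} (hY : BranchJet.zero d n ∉ Y) {k : ℕ}
    (hk : n < k) : arcsOver (branchJet n ⁻¹' Y) k = ∅ := by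
  refine Set.eq_empty_of_forall_notMem ?_
  rintro φ ⟨h1, h2⟩
  refine hY ?_
  have : jet n φ = AffinePoint.mk fun _ => 0 := AffinePoint.ext (funext fun p =>
    ((Arc.ord_eq_iff φ k).1 h1).1 (p.1.1 + 1) (by omega) p.2)
  have h3 : (Quot.mk _ (jet n φ) : BranchJet d n) ∈ Y := h2
  rwa [this] at h3

/-- The measure of a cylindric set of branches, in terms of the measures of the sets of arcs of
given order over it. -/
lemma sum_arcMeasure_arcsOver {d : ℕ} {B : Set (Branch d)} (hB : IsBranchCylinder B) :
    (∀ k, IsArcCylinder (arcsOver B k)) ∧ ∃ N, (∀ k, N ≤ k → arcsOver B k = ∅) ∧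
      ∑ k ∈ Finset.range N, algebraMap K0 K0L lef ^ k * arcMeasure (arcsOver B k) =
        (algebraMap K0 K0L lef - 1) * branchMeasure B := by
  have hμ : branchMeasure B = algebraMap K0 K0L (branchJetClass hB.choose.2) *
      ((lefUnit ^ (-(((d : ℤ) - 1) * hB.choose.1)) : K0Lˣ) : K0L) := dif_pos hB
  obtain ⟨⟨h0, hY⟩, hBY⟩ := hB.choose_spec
  rw [hμ]
  -- The argument works for whatever jet level and set the definition of `branchMeasure` has picked,
  -- so their independence is not needed.
  generalize hB.choose = p at h0 hY hBY ⊢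
  obtain ⟨n, Y⟩ := p
  subst hBY
  simp only at h0 hY ⊢
  have hcls := fun i : Fin n => constructibleClass_liftStratum (r := n - (i.1 + 1))
    (by omega) (hY i)
  -- Orders `1, …, n` correspond to the strata `i = k - 1`; order `0` does not occur.
  refine ⟨fun k => ?_, n + 1, fun k hk => arcsOver_of_lt h0 hk, ?_⟩
  · rcases k with _ | k
    · rw [arcsOver_zero]
      exact isArcCylinder_empty d
    · by_cases hk : k < n
      · exact ⟨⟨n, _⟩, (hcls ⟨k, hk⟩).1, arcsOver_eq_preimage Y ⟨k, hk⟩⟩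
      · rw [arcsOver_of_lt h0 (by omega)]
        exact isArcCylinder_empty d
  · rw [Finset.sum_range_succ', arcsOver_zero, arcMeasure_empty, mul_zero, add_zero,
      Finset.sum_range, branchJetClass, map_sum, Finset.sum_mul, Finset.mul_sum]
    refine Finset.sum_congr rfl fun i _ => ?_
    rw [arcsOver_eq_preimage, arcMeasure_eq (hcls i).1, (hcls i).2]
    simp only [map_mul, map_sub, map_one, map_pow, ← coe_lefUnit]
    -- The weight `𝕃^k` from the substitution and the unipotent fibre `𝕃^(n-k)` combine to `𝕃^n`,
    -- the ratio of the two normalizations.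
    have h : ((lefUnit ^ (-(((d : ℤ) - 1) * n)) : K0Lˣ) : K0L) = (lefUnit : K0L) ^ (i.1 + 1) *
        ((lefUnit : K0L) ^ (n - (i.1 + 1)) * ((lefUnit ^ (-((d : ℤ) * n)) : K0Lˣ) : K0L)) := by
      rw [← mul_assoc, ← pow_add, Nat.add_sub_of_le (by omega : i.1 + 1 ≤ n),
        ← Units.val_pow_eq_pow_val, ← Units.val_mul, ← zpow_natCast, ← zpow_add]
      congr 2
      ring
    rw [h]
    ring

/-- All jets lift to arcs, so any set of jets that represents the empty cylinder is itself empty. -/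
lemma branchMeasure_empty (d : ℕ) : branchMeasure (∅ : Set (Branch d)) = 0 := by
  by_cases hB : IsBranchCylinder (∅ : Set (Branch d))
  · rw [branchMeasure, dif_pos hB]
    have h := hB.choose_spec.2
    generalize hB.choose = p at h ⊢
    obtain ⟨n, Y⟩ := p
    have hY : Y = ∅ := by
      refine Set.eq_empty_of_forall_notMem fun q hq => ?_
      obtain ⟨x, rfl⟩ := Quot.exists_rep q
      obtain ⟨φ, rfl⟩ := jet_surjective d n x
      exact (Set.ext_iff.1 h (toBranch φ)).2 hq
    have : ∀ i, stratumPart Y i = ∅ := fun i => by rw [hY]; rfl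
    simp [branchJetClass, this, constructibleClass_empty]
  · rw [branchMeasure, dif_neg hB]

/-! ### Sums in the completed tensor product -/

section Completed

variable {G : Type*} [AddCommGroup G] [TopologicalSpace G]

/-- The component of an element of the completed tensor product. -/
noncomputable def Completed.proj (U : OpenAddSubgroup G) :
    Completed G →ₗ[K0L] K0L ⊗[ℤ] (G ⧸ (U : AddSubgroup G)) :=
  (LinearMap.proj U).comp (Completed G).subtype

lemma Completed.proj_apply (U : OpenAddSubgroup G) (x : Completed G) : Completed.proj U x = x.1 U :=
  rfl

/-- The topology is induced from discrete factors, so convergence means that the partial sums are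
eventually constant in each component. -/
lemma Completed.hasSum_iff {ι : Type*} {f : ι → Completed G} {x : Completed G} :
    HasSum f x ↔ ∀ U : OpenAddSubgroup G, ∀ᶠ s : Finset ι in atTop,
      ∑ i ∈ s, Completed.proj U (f i) = Completed.proj U x := by
  rw [HasSum, SummationFilter.unconditional_filter, Tendsto, nhds_iInf]
  rw [le_iInf_iff]
  refine forall_congr' fun U => ?_
  let _ : TopologicalSpace (K0L ⊗[ℤ] (G ⧸ (U : AddSubgroup G))) := ⊥
  have : DiscreteTopology (K0L ⊗[ℤ] (G ⧸ (U : AddSubgroup G))) := ⟨rfl⟩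
  rw [nhds_induced]
  change Tendsto _ _ _ ↔ _
  rw [tendsto_comap_iff]
  rw [nhds_discrete, tendsto_pure]
  simp only [Function.comp_def, ← Completed.proj_apply, map_sum]

instance : T2Space (Completed G) := by
  let _ : ∀ U : OpenAddSubgroup G, TopologicalSpace (K0L ⊗[ℤ] (G ⧸ (U : AddSubgroup G))) :=
    fun _ => ⊥
  have : ∀ U : OpenAddSubgroup G, DiscreteTopology (K0L ⊗[ℤ] (G ⧸ (U : AddSubgroup G))) :=
    fun _ => ⟨rfl⟩
  refine T2Space.of_injective_continuous (f := fun x : Completed G => x.1) Subtype.val_injective ?_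
  exact continuous_pi fun U => continuous_iInf_dom (i := U) continuous_induced_dom

/-- A family with finitely many nonzero terms in each component is summable. -/
lemma Completed.hasSum_of_finite {ι : Type*} {f : ι → Completed G}
    (h : ∀ U, (Function.support fun i => Completed.proj U (f i)).Finite) :
    ∃ x : Completed G, HasSum f x ∧ ∀ U, Completed.proj U x = ∑ᶠ i, Completed.proj U (f i) := by
  refine ⟨⟨fun U => ∑ᶠ i, Completed.proj U (f i), fun U V hUV => ?_⟩, ?_, fun U => rfl⟩
  · rw [map_finsum _ (h U)]
    exact finsum_congr fun i => (f i).2 U V hUV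
  · rw [Completed.hasSum_iff]
    intro U
    filter_upwards [eventually_ge_atTop (h U).toFinset] with s hs
    refine (finsum_eq_sum_of_support_subset _ fun i hi => ?_).symm
    exact hs ((h U).mem_toFinset.2 hi)

lemma finsum_ne_zero_eq_sum {α M : Type*} [Zero α] [AddCommMonoid M] {g : α → M} (h0 : g 0 = 0)
    {s : Finset α} (hs : ∀ a, g a ≠ 0 → a ∈ s) : ∑ᶠ a : {a : α // a ≠ 0}, g a = ∑ a ∈ s, g a := by
  rw [finsum_subtype_eq_finsum_cond, ← finsum_eq_sum_of_support_subset (f := g) hs]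
  refine finsum_congr fun a => ?_
  by_cases ha : a = 0
  · simp [ha, h0]
  · simp [ha]

/-- The components of an integral. -/
lemma proj_integral {S : Type*} {cyl : Set S → Prop} {μ : Set S → K0L} (hμ : μ ∅ = 0) {ψ : S → G}
    (hψ : IsIntegrableFun cyl ψ) (U : OpenAddSubgroup G) {s : Finset G}
    (hs : ∀ a ∈ Set.range ψ, a ∉ U → a ∈ s) :
    Completed.proj U (integral μ ψ) = ∑ a ∈ s, μ (ψ ⁻¹' {a}) ⊗ₜ[ℤ]
      (QuotientAddGroup.mk a : G ⧸ (U : AddSubgroup G)) := by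
  -- A value that is not attained contributes `μ ∅ = 0`, and a value in `U` dies in the quotient.
  have hsupp : ∀ (U : OpenAddSubgroup G) (a : G), μ (ψ ⁻¹' {a}) ⊗ₜ[ℤ]
      (QuotientAddGroup.mk a : G ⧸ (U : AddSubgroup G)) ≠ 0 → a ∈ Set.range ψ ∧ a ∉ U := by
    intro U a ha
    constructor
    · by_contra h
      have : ψ ⁻¹' {a} = ∅ := Set.preimage_singleton_eq_empty.2 h
      rw [this, hμ, TensorProduct.zero_tmul] at ha
      exact ha rfl
    · intro h
      have : (QuotientAddGroup.mk a : G ⧸ (U : AddSubgroup G)) = 0 :=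
        (QuotientAddGroup.eq_zero_iff a).2 h
      rw [this, TensorProduct.tmul_zero] at ha
      exact ha rfl
  obtain ⟨x, hx, hxU⟩ := Completed.hasSum_of_finite
    (f := fun a : {a : G // a ≠ 0} => pureTensor (μ (ψ ⁻¹' {a.1})) a.1) fun U => by
      refine ((hψ.2 U).preimage (f := Subtype.val) Subtype.val_injective.injOn).subset fun a ha => ?_
      exact hsupp U a.1 ha
  rw [integral, hx.tsum_eq, hxU]
  refine finsum_ne_zero_eq_sum (g := fun a => μ (ψ ⁻¹' {a}) ⊗ₜ[ℤ]
      (QuotientAddGroup.mk a : G ⧸ (U : AddSubgroup G))) ?_ fun a ha => ?_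
  · exact TensorProduct.tmul_zero _ _
  · exact hs a (hsupp U a ha).1 (hsupp U a ha).2

end Completed

/-! ### The lifted function -/

section Lift

variable {d : ℕ} {G : Type*} [AddCommGroup G]

lemma twistedLift_eq_single {ψ : Branch d → G} {φ : Arc d} {F : ℕ → G} (hF : F ≠ 0)
    (h : twistedLift ψ φ = F) : ∃ k : ℕ, φ.ord = k ∧ F = Pi.single k (ψ (toBranch φ)) := by
  classical
  subst h
  obtain ⟨k, hk⟩ := Function.ne_iff.1 hF
  have hord : φ.ord = k := by
    by_contra h
    exact hk (if_neg h)
  refine ⟨k, hord, funext fun l => ?_⟩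
  rw [Pi.single_apply]
  change (if φ.ord = l then _ else _) = _
  rw [hord]
  simp only [Nat.cast_inj, eq_comm (a := k)]

lemma preimage_twistedLift_single (ψ : Branch d → G) (k : ℕ) {a : G} (ha : a ≠ 0) :
    twistedLift ψ ⁻¹' {Pi.single k a} = arcsOver (ψ ⁻¹' {a}) k := by
  classical
  ext φ
  constructor
  · intro h
    have h1 : twistedLift ψ φ k = a := by
      rw [show twistedLift ψ φ = _ from h, Pi.single_eq_same]
    have hord : φ.ord = k := by
      by_contra h
      exact ha (h1.symm.trans (if_neg h))
    exact ⟨hord, ((if_pos hord).symm.trans h1 : ψ (toBranch φ) = a)⟩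
  · rintro ⟨hord, h⟩
    have h : ψ (toBranch φ) = a := h
    refine funext fun l => ?_
    rw [Pi.single_apply]
    change (if φ.ord = l then _ else _) = _
    rw [hord, h]
    simp only [Nat.cast_inj, eq_comm (a := k)]

lemma range_twistedLift_subset (ψ : Branch d → G) {F : ℕ → G} (hF : F ≠ 0)
    (h : F ∈ Set.range (twistedLift ψ)) : ∃ k : ℕ, F = Pi.single k (F k) ∧ F k ∈ Set.range ψ := by
  obtain ⟨φ, rfl⟩ := h
  obtain ⟨k, -, hk⟩ := twistedLift_eq_single hF rfl
  have : twistedLift ψ φ k = ψ (toBranch φ) := by rw [hk, Pi.single_eq_same]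
  exact ⟨k, by rw [this]; exact hk, _, this.symm⟩

variable [TopologicalSpace G]

lemma proj_coeffT (k : ℕ) (A : Completed (ℕ → G)) (V : OpenAddSubgroup G) :
    Completed.proj V (coeffT k A) = quotientMap (Pi.evalAddMonoidHom (fun _ : ℕ => G) k)
      (V.comap (Pi.evalAddMonoidHom (fun _ => G) k) (continuous_apply k) : OpenAddSubgroup (ℕ → G))
      V le_rfl (Completed.proj (V.comap (Pi.evalAddMonoidHom (fun _ => G) k) (continuous_apply k)) A) :=
  rfl

/-- The nonzero values are monomials `a T^k` with `a` a value of `ψ`. Their level sets are the arcs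
of order `k` over the level set of `a`. -/
lemma arcIntegrable_twistedLift {ψ : Branch d → G} (hψ : BranchIntegrable ψ) :
    ArcIntegrable (twistedLift ψ) := by
  refine ⟨⟨?_, fun F hF => ?_⟩, fun U => ?_⟩
  · have h : (Set.range fun p : ℕ × Set.range ψ => (Pi.single p.1 p.2.1 : ℕ → G)).Countable := by
      have := hψ.1.1.to_subtype
      exact Set.countable_range _
    refine (h.insert 0).mono fun F hF => ?_
    by_cases h0 : F = 0
    · exact Or.inl h0
    · obtain ⟨k, hk, hr⟩ := range_twistedLift_subset ψ h0 hF
      exact Or.inr ⟨⟨k, _, hr⟩, hk.symm⟩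
  · by_cases h : F ∈ Set.range (twistedLift ψ)
    · obtain ⟨k, hk, -⟩ := range_twistedLift_subset ψ hF h
      have ha : F k ≠ 0 := fun h0 => hF (by rw [hk, h0, Pi.single_zero])
      rw [hk, preimage_twistedLift_single ψ k ha]
      exact (sum_arcMeasure_arcsOver (hψ.1.2 _ ha)).1 k
    · rw [Set.preimage_singleton_eq_empty.2 h]
      exact isArcCylinder_empty d
  -- An open subgroup for the product topology contains all series supported outside a finite set
  -- `I` of exponents. For each `k ∈ I`, pulling it back along `a ↦ a T^k` leaves finitely many
  -- values of `ψ`.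
  · obtain ⟨I, t, ht, htU⟩ := (isOpen_pi_iff (s := (U : Set (ℕ → G)))).1 U.isOpen' 0 U.zero_mem'
    have hsingle : ∀ k : ℕ, Continuous (AddMonoidHom.single (fun _ : ℕ => G) k) := fun k =>
      continuous_single (A := fun _ : ℕ => G) k
    have hfin : (⋃ k ∈ (I : Set ℕ), (fun a : G => (Pi.single k a : ℕ → G)) '' (Set.range ψ \
        (U.comap (AddMonoidHom.single (fun _ : ℕ => G) k) (hsingle k) : Set G))).Finite :=
      I.finite_toSet.biUnion fun k _ => (hψ.2 _).image _
    refine hfin.subset ?_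
    rintro F ⟨hF, hFU⟩
    have h0 : F ≠ 0 := by
      rintro rfl
      exact hFU U.zero_mem'
    obtain ⟨k, hk, hr⟩ := range_twistedLift_subset ψ h0 hF
    refine Set.mem_biUnion (x := k) ?_ ⟨F k, ⟨hr, fun h => ?_⟩, hk.symm⟩
    · by_contra hkI
      refine hFU (htU fun l hl => ?_)
      rw [hk, Pi.single_eq_of_ne (fun h => hkI (by rw [← h]; exact hl))]
      exact (ht l hl).2
    · refine hFU ?_
      rw [hk]
      exact h

/-- The coefficients of the integral of the lifted function. -/
lemma proj_coeffT_arcIntegral {ψ : Branch d → G} (hψ : BranchIntegrable ψ) (k : ℕ)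
    (V : OpenAddSubgroup G) :
    Completed.proj V (coeffT k (arcIntegral (twistedLift ψ))) =
      ∑ a ∈ (hψ.2 V).toFinset, arcMeasure (arcsOver (ψ ⁻¹' {a}) k) ⊗ₜ[ℤ]
        (QuotientAddGroup.mk a : G ⧸ (V : AddSubgroup G)) := by
  classical
  rw [proj_coeffT, arcIntegral, proj_integral (arcMeasure_empty d) (arcIntegrable_twistedLift hψ) _
    (s := (hψ.2 V).toFinset.image (Pi.single k)) fun F hF hFV => ?_, map_sum,
    Finset.sum_image fun a _ b _ h => Pi.single_injective k h]
  · refine Finset.sum_congr rfl fun a ha => ?_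
    have ha0 : a ≠ 0 := by
      rintro rfl
      exact ((hψ.2 V).mem_toFinset.1 ha).2 V.zero_mem'
    rw [preimage_twistedLift_single ψ k ha0]
    refine (LinearMap.baseChange_tmul ..).trans (congrArg _ ?_)
    change (QuotientAddGroup.mk ((Pi.single k a : ℕ → G) k) : G ⧸ (V : AddSubgroup G)) = _
    rw [Pi.single_eq_same]
  · have hk : F k ∉ V := hFV
    have h0 : F ≠ 0 := by
      rintro rfl
      exact hk V.zero_mem'
    obtain ⟨l, hl, hr⟩ := range_twistedLift_subset ψ h0 hF
    have : k = l := by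
      by_contra h
      rw [hl, Pi.single_eq_of_ne h] at hk
      exact hk V.zero_mem'
    subst this
    exact Finset.mem_image.2 ⟨F k, (hψ.2 V).mem_toFinset.2 ⟨hr, hk⟩, hl.symm⟩

end Lift

end MotivicArcs

theorem proposition2 (d : ℕ) {G : Type*} [AddCommGroup G] [TopologicalSpace G]
    [NonarchimedeanAddGroup G] (ψ : Branch d → G) (hψ : BranchIntegrable ψ) :
    ArcIntegrable (twistedLift ψ) ∧
      HasValueAtLef (arcIntegral (twistedLift ψ))
        ((algebraMap K0 K0L lef - 1) • branchIntegral ψ) := by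
  refine ⟨arcIntegrable_twistedLift hψ, Completed.hasSum_iff.2 fun V => ?_⟩
  have h0 : ∀ a ∈ (hψ.2 V).toFinset, a ≠ 0 := by
    rintro a ha rfl
    exact ((hψ.2 V).mem_toFinset.1 ha).2 V.zero_mem'
  have hN : ∀ a : G, ∃ N, a ∈ (hψ.2 V).toFinset → (∀ k, N ≤ k → arcsOver (ψ ⁻¹' {a}) k = ∅) ∧
      ∑ k ∈ Finset.range N, algebraMap K0 K0L lef ^ k * arcMeasure (arcsOver (ψ ⁻¹' {a}) k) =
        (algebraMap K0 K0L lef - 1) * branchMeasure (ψ ⁻¹' {a}) := fun a => by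
    by_cases ha : a ∈ (hψ.2 V).toFinset
    · obtain ⟨N, hN⟩ := (sum_arcMeasure_arcsOver (hψ.1.2 a (h0 a ha))).2
      exact ⟨N, fun _ => hN⟩
    · exact ⟨0, fun h => absurd h ha⟩
  choose N hN using hN
  have hb : Completed.proj V (branchIntegral ψ) = ∑ a ∈ (hψ.2 V).toFinset,
      branchMeasure (ψ ⁻¹' {a}) ⊗ₜ[ℤ] (QuotientAddGroup.mk a : G ⧸ (V : AddSubgroup G)) :=
    proj_integral (branchMeasure_empty d) hψ V fun a ha haV => (hψ.2 V).mem_toFinset.2 ⟨ha, haV⟩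
  -- Modulo `V` only finitely many values matter, so one bound on the orders serves for all of them.
  -- Interchanging the two finite sums reduces the claim to the identity for each level set.
  filter_upwards [eventually_ge_atTop (Finset.range ((hψ.2 V).toFinset.sup N))] with s hs
  simp only [map_smul, proj_coeffT_arcIntegral hψ, hb, Finset.smul_sum]
  rw [Finset.sum_comm]
  refine Finset.sum_congr rfl fun a ha => ?_
  simp only [TensorProduct.smul_tmul', smul_eq_mul]
  rw [← TensorProduct.sum_tmul, ← (hN a ha).2]
  congr 1
  refine (Finset.sum_subset (fun k hk => hs ?_) fun k _ hk => ?_).symm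
  · exact Finset.mem_range.2 ((Finset.mem_range.1 hk).trans_le (Finset.le_sup ha))
  · rw [(hN a ha).1 k (not_lt.1 fun h => hk (Finset.mem_range.2 h)), arcMeasure_empty, mul_zero]
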